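/- Let $r,n\ge 1$, let $\mathbb K$ be an algebraically closed field whose characteristic does not divide $r$, and let $q\in\mathbb K^{*}$. Let $\widehat Y_{r,n}^{\mathbb K}$ be the affine Yokonuma–Hecke algebra: the unital associative $\mathbb K$-algebra generated by $t_1,\dots,t_n,g_1,\dots,g_{n-1},X_1^{\pm1}$ with relations $g_ig_j=g_jg_i$ ($|i-j|\ge2$), $g_ig_{i+1}g_i=g_{i+1}g_ig_{i+1}$, $t_it_j=t_jt_i$, $g_it_j=t_{s_i(j)}g_i$ with $s_i=(i,i+1)$, $t_i^r=1$, $g_i^2=1+(q-q^{-1})e_ig_i$ with $e_i=\frac1r\sum_{s=0}^{r-1}t_i^st_{i+1}^{-s}$, $X_1X_1^{-1}=X_1^{-1}X_1=1$, $g_1X_1g_1X_1=X_1g_1X_1g_1$, $g_iX_1=X_1g_i$ ($i\ge2$), $t_jX_1=X_1t_j$. Put $X_{i+1}=g_iX_ig_i$ for $1\le i\le n-1$. For $m\ge0$ let $\widehat{\mathcal H}_m^{\mathbb K}$ be the extended affine Hecke algebra of type $A$: the $\mathbb K$-algebra generated by $T_1,\dots,T_{m-1},Y_1^{\pm1},\dots,Y_m^{\pm1}$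 with relations $(T_i-q)(T_i+q^{-1})=0$, $T_iT_{i+1}T_i=T_{i+1}T_iT_{i+1}$, $T_iT_j=T_jT_i$ ($|i-j|\ge2$), $Y_iY_i^{-1}=Y_i^{-1}Y_i=1$, $Y_iY_j=Y_jY_i$, $T_iY_iT_i=Y_{i+1}$, $T_iY_j=Y_jT_i$ ($j\ne i,i+1$). Let $V_1,\dots,V_r$ be a complete set of pairwise non-isomorphic simple $\mathbb K[\mathbb Z/r\mathbb Z]$-modules (each is one-dimensional). For an $r$-composition $\mu=(\mu_1,\dots,\mu_r)$ of $n$ (non-negative integers with sum $n$), cut $\{1,\dots,n\}$ into consecutive blocks of sizes $\mu_1,\dots,\mu_r$, and let $\widehat Y_{r,\mu}^{\mathbb K}\subseteq\widehat Y_{r,n}^{\mathbb K}$ be the subalgebra generated by all $t_j$, all $X_j^{\pm1}$, and those $g_i$ for which $i,i+1$ lie in the same block. Let $L_k$ be a simple $\widehat{\mathcal H}_{\mu_k}^{\mathbb K}$-module for $1\le k\le r$. Then the vector space $(V_1^{\otimes\mu_1}\otimes L_1)\otimes\cdots\otimes(V_r^{\otimes\mu_r}\otimes L_r)$ has a unique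 $\widehat Y_{r,\mu}^{\mathbb K}$-module structure in which, for the $p$-th position $j$ of the $k$-th block, $t_j$ acts by the generator of $\mathbb Z/r\mathbb Z$ on the $p$-th tensor factor of $V_k^{\otimes\mu_k}$, $X_j^{\pm1}$ acts as $Y_p^{\pm1}$ on $L_k$, and, if $j+1$ also lies in the $k$-th block, $g_j$ acts as $T_p$ on $L_k$ (all other tensor factors being left unchanged). Put $$S_\mu(L_\bullet)=\mathrm{Ind}_{\widehat Y_{r,\mu}^{\mathbb K}}^{\widehat Y_{r,n}^{\mathbb K}}\big((V_1^{\otimes\mu_1}\otimes L_1)\otimes\cdots\otimes(V_r^{\otimes\mu_r}\otimes L_r)\big)=\widehat Y_{r,n}^{\mathbb K}\otimes_{\widehat Y_{r,\mu}^{\mathbb K}}\big((V_1^{\otimes\mu_1}\otimes L_1)\otimes\cdots\otimes(V_r^{\otimes\mu_r}\otimes L_r)\big).$$ **Theorem.** Every $S_\mu(L_\bullet)$ as above is a simple $\widehat Y_{r,n}^{\mathbb K}$-module. Every simple $\widehat Y_{r,n}^{\mathbb K}$-module is isomorphic to $S_\mu(L_\bullet)$ for some $r$-composition $\mu$ of $n$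 and some simple $\widehat{\mathcal H}_{\mu_k}^{\mathbb K}$-modules $L_k$ ($1\le k\le r$). Finally, $S_\mu(L_\bullet)\cong S_\nu(L'_\bullet)$ if and only if $\mu=\nu$ and $L_k\cong L'_k$ as $\widehat{\mathcal H}_{\mu_k}^{\mathbb K}$-modules for all $k$. -/

import Mathlib

open scoped TensorProduct

universe u v w x

noncomputable section

namespace AffineYokonuma

/-- For the (zero-based) index `i` of a simple transposition, the smaller of the two positions. -/
def lo {n : ℕ} (i : Fin (n - 1)) : Fin n := ⟨i, by omega⟩

/-- For the (zero-based) index `i` of a simple transposition, the larger of the two positions. -/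
def hi {n : ℕ} (i : Fin (n - 1)) : Fin n := ⟨i + 1, by omega⟩

/-! ### The affine Yokonuma-Hecke algebra -/

/-- Generators `t_1, …, t_n`, `g_1, …, g_{n-1}`, `X_1`, `X_1⁻¹` (indices are zero-based). -/
inductive YGen (n : ℕ) : Type
  | t (j : Fin n)
  | g (i : Fin (n - 1))
  | X
  | Xinv

section YRelations

variable (K : Type u) [Field K] (r n : ℕ)

/-- The generator `t_j` in the free algebra. -/
abbrev fT (j : Fin n) : FreeAlgebra K (YGen n) := FreeAlgebra.ι K (YGen.t j)

/-- The generator `g_i` in the free algebra. -/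
abbrev fG (i : Fin (n - 1)) : FreeAlgebra K (YGen n) := FreeAlgebra.ι K (YGen.g i)

/-- The generator `X_1` in the free algebra. -/
abbrev fX : FreeAlgebra K (YGen n) := FreeAlgebra.ι K YGen.X

/-- The generator `X_1⁻¹` in the free algebra. -/
abbrev fXinv : FreeAlgebra K (YGen n) := FreeAlgebra.ι K YGen.Xinv

/-- `e_i = (1/r) ∑_{s=0}^{r-1} t_i^s t_{i+1}^{-s}`; since `t_{i+1}^r = 1` is imposed,
`t_{i+1}^{-s}` is written `t_{i+1}^{r-s}`. -/
def fE (i : Fin (n - 1)) : FreeAlgebra K (YGen n) :=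
  (r : K)⁻¹ • ∑ s ∈ Finset.range r, fT K n (lo i) ^ s * fT K n (hi i) ^ (r - s)

/-- The defining relations of the affine Yokonuma-Hecke algebra over `K` with parameter `q`. -/
inductive YRel (q : Kˣ) : FreeAlgebra K (YGen n) → FreeAlgebra K (YGen n) → Prop
  | g_comm (i j : Fin (n - 1)) (h : (i : ℕ) + 2 ≤ j ∨ (j : ℕ) + 2 ≤ i) :
      YRel q (fG K n i * fG K n j) (fG K n j * fG K n i)
  | g_braid (i j : Fin (n - 1)) (h : (j : ℕ) = i + 1) :
      YRel q (fG K n i * fG K n j * fG K n i) (fG K n j * fG K n i * fG K n j)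
  | t_comm (i j : Fin n) : YRel q (fT K n i * fT K n j) (fT K n j * fT K n i)
  | g_t (i : Fin (n - 1)) (j : Fin n) :
      YRel q (fG K n i * fT K n j) (fT K n (Equiv.swap (lo i) (hi i) j) * fG K n i)
  | t_pow (j : Fin n) : YRel q (fT K n j ^ r) 1
  | g_sq (i : Fin (n - 1)) :
      YRel q (fG K n i ^ 2) (1 + ((q : K) - (q : K)⁻¹) • (fE K r n i * fG K n i))
  | X_Xinv : YRel q (fX K n * fXinv K n) 1
  | Xinv_X : YRel q (fXinv K n * fX K n) 1
  | g_X_g_X (i : Fin (n - 1)) (h : (i : ℕ) = 0) :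
      YRel q (fG K n i * fX K n * fG K n i * fX K n) (fX K n * fG K n i * fX K n * fG K n i)
  | g_X (i : Fin (n - 1)) (h : 1 ≤ (i : ℕ)) :
      YRel q (fG K n i * fX K n) (fX K n * fG K n i)
  | t_X (j : Fin n) : YRel q (fT K n j * fX K n) (fX K n * fT K n j)

end YRelations

/-- The affine Yokonuma-Hecke algebra of parameters `r, n, q` over `K` (for `n ≥ 1`). -/
def Yhat (K : Type u) [Field K] (r n : ℕ) (q : Kˣ) : Type u := RingQuot (YRel K r n q)

namespace Yhat

variable {K : Type u} [Field K] {r n : ℕ} {q : Kˣ}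

instance : Ring (Yhat K r n q) := inferInstanceAs (Ring (RingQuot (YRel K r n q)))

instance : Algebra K (Yhat K r n q) := inferInstanceAs (Algebra K (RingQuot (YRel K r n q)))

variable (K r n q) in
/-- The quotient map from the free algebra. -/
def mk : FreeAlgebra K (YGen n) →ₐ[K] Yhat K r n q := RingQuot.mkAlgHom K (YRel K r n q)

theorem mk_rel {x y : FreeAlgebra K (YGen n)} (h : YRel K r n q x y) :
    mk K r n q x = mk K r n q y := RingQuot.mkAlgHom_rel K h

/-- The element `t_j`. -/
def t (j : Fin n) : Yhat K r n q := mk K r n q (fT K n j)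

/-- The element `g_i`. -/
def g (i : Fin (n - 1)) : Yhat K r n q := mk K r n q (fG K n i)

/-- The element `e_i`. -/
def e (i : Fin (n - 1)) : Yhat K r n q := mk K r n q (fE K r n i)

theorem e_eq (i : Fin (n - 1)) : (e i : Yhat K r n q) =
    (r : K)⁻¹ • ∑ s ∈ Finset.range r, t (lo i) ^ s * t (hi i) ^ (r - s) := by
  simp [e, fE, t]

theorem t_comm (i j : Fin n) : (t i : Yhat K r n q) * t j = t j * t i := by
  simpa [t, g] using mk_rel (YRel.t_comm (q := q) (r := r) i j)

theorem t_pow (j : Fin n) : (t j : Yhat K r n q) ^ r = 1 := by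
  simpa [t, g] using mk_rel (YRel.t_pow (q := q) (r := r) j)

theorem g_t (i : Fin (n - 1)) (j : Fin n) :
    (g i : Yhat K r n q) * t j = t (Equiv.swap (lo i) (hi i) j) * g i := by
  simpa [t, g] using mk_rel (YRel.g_t (q := q) (r := r) i j)

theorem g_sq (i : Fin (n - 1)) :
    (g i : Yhat K r n q) * g i = 1 + ((q : K) - (q : K)⁻¹) • (e i * g i) := by
  have h := mk_rel (YRel.g_sq (q := q) (r := r) i)
  rw [map_pow, map_add, map_one, map_smul, map_mul, sq] at h
  exact h

theorem g_mul_e (i : Fin (n - 1)) : (g i : Yhat K r n q) * e i = e i * g i := by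
  have hlo : SemiconjBy (g i : Yhat K r n q) (t (lo i)) (t (hi i)) := by
    have := g_t (K := K) (r := r) (q := q) i (lo i)
    rwa [Equiv.swap_apply_left] at this
  have hhi : SemiconjBy (g i : Yhat K r n q) (t (hi i)) (t (lo i)) := by
    have := g_t (K := K) (r := r) (q := q) i (hi i)
    rwa [Equiv.swap_apply_right] at this
  have hc : Commute (t (hi i) : Yhat K r n q) (t (lo i)) := t_comm _ _
  have h1 : ∀ s ∈ Finset.range r,
      (g i : Yhat K r n q) * (t (lo i) ^ s * t (hi i) ^ (r - s)) =
        t (lo i) ^ (r - s) * t (hi i) ^ (r - (r - s)) * g i := by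
    intro s hs
    have hs' : r - (r - s) = s := by have := Finset.mem_range.1 hs; omega
    rw [hs', ← (hc.pow_pow s (r - s)).eq]
    exact (hlo.pow_right s).mul_right (hhi.pow_right (r - s))
  have h2 : ∑ s ∈ Finset.range r,
        (t (lo i) : Yhat K r n q) ^ (r - s) * t (hi i) ^ (r - (r - s)) =
      ∑ s ∈ Finset.range r, t (lo i) ^ s * t (hi i) ^ (r - s) := by
    have h := Finset.sum_range_reflect
      (fun s => (t (lo i) : Yhat K r n q) ^ s * t (hi i) ^ (r - s)) (r + 1)
    rw [Finset.sum_range_succ, Finset.sum_range_succ] at h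
    simpa [t_pow] using h
  rw [e_eq, mul_smul_comm, smul_mul_assoc, Finset.mul_sum, Finset.sum_congr rfl h1,
    ← Finset.sum_mul, h2]

/-- `g_i` as a unit, with inverse `g_i - (q - q⁻¹) e_i`. -/
def gUnit (i : Fin (n - 1)) : (Yhat K r n q)ˣ where
  val := g i
  inv := g i - ((q : K) - (q : K)⁻¹) • e i
  val_inv := by rw [mul_sub, g_sq, mul_smul_comm, g_mul_e]; abel
  inv_val := by rw [sub_mul, g_sq, smul_mul_assoc]; abel

/-- `X_1` as a unit. -/
def X1 : (Yhat K r n q)ˣ where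
  val := mk K r n q (fX K n)
  inv := mk K r n q (fXinv K n)
  val_inv := by simpa using mk_rel (YRel.X_Xinv (K := K) (n := n) (q := q) (r := r))
  inv_val := by simpa using mk_rel (YRel.Xinv_X (K := K) (n := n) (q := q) (r := r))

/-- The units `X_j`, defined inductively by `X_{i+1} = g_i X_i g_i`. -/
def Xaux : (j : ℕ) → j < n → (Yhat K r n q)ˣ
  | 0, _ => X1
  | j + 1, h => gUnit ⟨j, by omega⟩ * Xaux j (by omega) * gUnit ⟨j, by omega⟩

/-- The unit `X_j` for a (zero-based) position `j`. -/
def X (j : Fin n) : (Yhat K r n q)ˣ := Xaux j j.isLt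

end Yhat

/-! ### The extended affine Hecke algebra of type `A` -/

/-- Generators `T_1, …, T_{m-1}`, `Y_1^{±1}, …, Y_m^{±1}` (indices are zero-based). -/
inductive HGen (m : ℕ) : Type
  | T (i : Fin (m - 1))
  | Y (j : Fin m)
  | Yinv (j : Fin m)

section HRelations

variable (K : Type u) [Field K] (m : ℕ)

/-- The generator `T_i` in the free algebra. -/
abbrev hT (i : Fin (m - 1)) : FreeAlgebra K (HGen m) := FreeAlgebra.ι K (HGen.T i)

/-- The generator `Y_j` in the free algebra. -/
abbrev hY (j : Fin m) : FreeAlgebra K (HGen m) := FreeAlgebra.ι K (HGen.Y j)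

/-- The generator `Y_j⁻¹` in the free algebra. -/
abbrev hYinv (j : Fin m) : FreeAlgebra K (HGen m) := FreeAlgebra.ι K (HGen.Yinv j)

/-- The defining relations of the extended affine Hecke algebra over `K` with parameter `q`. -/
inductive HRel (q : Kˣ) : FreeAlgebra K (HGen m) → FreeAlgebra K (HGen m) → Prop
  | quad (i : Fin (m - 1)) :
      HRel q ((hT K m i - algebraMap K _ (q : K)) * (hT K m i + algebraMap K _ (q : K)⁻¹)) 0
  | braid (i j : Fin (m - 1)) (h : (j : ℕ) = i + 1) :
      HRel q (hT K m i * hT K m j * hT K m i) (hT K m j * hT K m i * hT K m j)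
  | T_comm (i j : Fin (m - 1)) (h : (i : ℕ) + 2 ≤ j ∨ (j : ℕ) + 2 ≤ i) :
      HRel q (hT K m i * hT K m j) (hT K m j * hT K m i)
  | Y_Yinv (j : Fin m) : HRel q (hY K m j * hYinv K m j) 1
  | Yinv_Y (j : Fin m) : HRel q (hYinv K m j * hY K m j) 1
  | Y_comm (i j : Fin m) : HRel q (hY K m i * hY K m j) (hY K m j * hY K m i)
  | T_Y_T (i : Fin (m - 1)) : HRel q (hT K m i * hY K m (lo i) * hT K m i) (hY K m (hi i))
  | T_Y (i : Fin (m - 1)) (j : Fin m) (h₁ : j ≠ lo i) (h₂ : j ≠ hi i) :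
      HRel q (hT K m i * hY K m j) (hY K m j * hT K m i)

end HRelations

/-- The extended affine Hecke algebra of type `A` with `m` strands over `K`; it is `K` for
`m = 0`. -/
def Hhat (K : Type u) [Field K] (m : ℕ) (q : Kˣ) : Type u := RingQuot (HRel K m q)

namespace Hhat

variable {K : Type u} [Field K] {m : ℕ} {q : Kˣ}

instance : Ring (Hhat K m q) := inferInstanceAs (Ring (RingQuot (HRel K m q)))

instance : Algebra K (Hhat K m q) := inferInstanceAs (Algebra K (RingQuot (HRel K m q)))

variable (K m q) in
/-- The quotient map from the free algebra. -/
def mk : FreeAlgebra K (HGen m) →ₐ[K] Hhat K m q := RingQuot.mkAlgHom K (HRel K m q)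

/-- The element `T_i`. -/
def T (i : Fin (m - 1)) : Hhat K m q := mk K m q (hT K m i)

/-- The element `Y_j`. -/
def Y (j : Fin m) : Hhat K m q := mk K m q (hY K m j)

/-- The element `Y_j⁻¹`. -/
def Yinv (j : Fin m) : Hhat K m q := mk K m q (hYinv K m j)

end Hhat

/-! ### Compositions and parabolic subalgebras -/

/-- The `r`-compositions of `n`: `r`-tuples of non-negative integers with sum `n`. -/
abbrev RComp (r n : ℕ) : Type := {μ : Fin r → ℕ // ∑ k, μ k = n}

namespace RComp

variable {r n : ℕ}

theorem offset_add_le (μ : RComp r n) (k : Fin r) :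
    ∑ l ∈ Finset.Iio k, μ.1 l + μ.1 k ≤ n := by
  have h : ∑ l ∈ insert k (Finset.Iio k), μ.1 l ≤ ∑ l, μ.1 l :=
    Finset.sum_le_sum_of_subset (Finset.subset_univ _)
  rw [Finset.sum_insert (by simp), μ.2] at h
  omega

/-- The `p`-th position of the `k`-th block of `μ` inside `{1, …, n}` (zero-based). The blocks are
consecutive, so every position arises from exactly one pair `(k, p)`. -/
def pos (μ : RComp r n) (k : Fin r) (p : Fin (μ.1 k)) : Fin n :=
  ⟨∑ l ∈ Finset.Iio k, μ.1 l + p, by have := offset_add_le μ k; omega⟩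

/-- The index of the simple transposition of the `p`-th and `(p+1)`-st position of the `k`-th
block. The simple transpositions of the Young subgroup of `μ` are exactly these. -/
def transp (μ : RComp r n) (k : Fin r) (p : Fin (μ.1 k - 1)) : Fin (n - 1) :=
  ⟨∑ l ∈ Finset.Iio k, μ.1 l + p, by have := offset_add_le μ k; omega⟩

end RComp

/-- Names for the generators of the parabolic subalgebra attached to `μ`: the elements `t_j` and
`X_j^{±1}` at all positions, and the `g_i` for all simple transpositions of the Young subgroup. -/
inductive PGen {r n : ℕ} (μ : RComp r n) : Type
  | t (k : Fin r) (p : Fin (μ.1 k))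
  | g (k : Fin r) (p : Fin (μ.1 k - 1))
  | X (k : Fin r) (p : Fin (μ.1 k))
  | Xinv (k : Fin r) (p : Fin (μ.1 k))

/-- The generators of the parabolic subalgebra as elements of the affine Yokonuma-Hecke
algebra. -/
def PGen.val {r n : ℕ} {μ : RComp r n} (K : Type u) [Field K] (q : Kˣ) :
    PGen μ → Yhat K r n q
  | .t k p => Yhat.t (μ.pos k p)
  | .g k p => Yhat.g (μ.transp k p)
  | .X k p => ((Yhat.X (μ.pos k p) : (Yhat K r n q)ˣ) : Yhat K r n q)
  | .Xinv k p => (((Yhat.X (μ.pos k p) : (Yhat K r n q)ˣ)⁻¹ : (Yhat K r n q)ˣ) : Yhat K r n q)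

/-- The parabolic subalgebra of the affine Yokonuma-Hecke algebra attached to `μ`. -/
def Ypar (K : Type u) [Field K] (q : Kˣ) {r n : ℕ} (μ : RComp r n) :
    Subalgebra K (Yhat K r n q) :=
  Algebra.adjoin K (Set.range (PGen.val (μ := μ) K q))

/-- A generator as an element of the parabolic subalgebra. -/
def PGen.toPar {r n : ℕ} {μ : RComp r n} (K : Type u) [Field K] (q : Kˣ) (x : PGen μ) :
    Ypar K q μ :=
  ⟨x.val K q, Algebra.subset_adjoin ⟨x, rfl⟩⟩

/-! ### The modules -/

/-- The group algebra `K[ℤ/rℤ]`, with `ℤ/rℤ` written multiplicatively. -/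
abbrev KG (K : Type u) [Field K] (r : ℕ) : Type u := MonoidAlgebra K (Multiplicative (ZMod r))

/-- The canonical generator of `ℤ/rℤ`, inside the group algebra. -/
def KG.gen (K : Type u) [Field K] (r : ℕ) : KG K r :=
  MonoidAlgebra.of K (Multiplicative (ZMod r)) (Multiplicative.ofAdd 1)

/-- The endomorphism of `⨂ᵢ Mᵢ` that is `f` on the factor `M_k` and the identity on the others. -/
def onFactor (K : Type u) [Field K] {ι : Type} [DecidableEq ι] {M : ι → Type v}
    [∀ i, AddCommGroup (M i)] [∀ i, Module K (M i)] (k : ι) (f : Module.End K (M k)) :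
    Module.End K (⨂[K] i, M i) :=
  PiTensorProduct.map (Function.update (fun _ => LinearMap.id) k f)

/-- The vector space `(V_1^{⊗ μ_1} ⊗ L_1) ⊗ ⋯ ⊗ (V_r^{⊗ μ_r} ⊗ L_r)`. -/
abbrev VL (K : Type u) [Field K] {r n : ℕ} (μ : RComp r n)
    (V : Fin r → Type v) [∀ k, AddCommGroup (V k)] [∀ k, Module K (V k)]
    (L : Fin r → Type w) [∀ k, AddCommGroup (L k)] [∀ k, Module K (L k)] :
    Type (max u v w) :=
  ⨂[K] k : Fin r, ((⨂[K] _p : Fin (μ.1 k), V k) ⊗[K] L k)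

/-- How the generators of the parabolic subalgebra act on
`(V_1^{⊗ μ_1} ⊗ L_1) ⊗ ⋯ ⊗ (V_r^{⊗ μ_r} ⊗ L_r)`: in the `k`-th block, the `p`-th `t` acts by the
generator of `ℤ/rℤ` on the `p`-th factor of `V_k^{⊗ μ_k}`, while the `g`'s and `X^{±1}`'s act as
the `T`'s and `Y^{±1}`'s on `L_k`. -/
def genAct (K : Type u) [Field K] (q : Kˣ) {r n : ℕ} (μ : RComp r n)
    (V : Fin r → Type v) [∀ k, AddCommGroup (V k)] [∀ k, Module K (V k)]
    [∀ k, Module (KG K r) (V k)] [∀ k, IsScalarTower K (KG K r) (V k)]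
    (L : Fin r → Type w) [∀ k, AddCommGroup (L k)] [∀ k, Module K (L k)]
    [∀ k, Module (Hhat K (μ.1 k) q) (L k)] [∀ k, IsScalarTower K (Hhat K (μ.1 k) q) (L k)] :
    PGen μ → Module.End K (VL K μ V L)
  | .t k p => onFactor K k (TensorProduct.map
      (onFactor K p (Algebra.lsmul K K (V k) (KG.gen K r))) LinearMap.id)
  | .g k p => onFactor K k (TensorProduct.map LinearMap.id
      (Algebra.lsmul K K (L k) (Hhat.T p : Hhat K (μ.1 k) q)))
  | .X k p => onFactor K k (TensorProduct.map LinearMap.id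
      (Algebra.lsmul K K (L k) (Hhat.Y p : Hhat K (μ.1 k) q)))
  | .Xinv k p => onFactor K k (TensorProduct.map LinearMap.id
      (Algebra.lsmul K K (L k) (Hhat.Yinv p : Hhat K (μ.1 k) q)))

/-- `ρ` is the module structure of `(V_1^{⊗ μ_1} ⊗ L_1) ⊗ ⋯ ⊗ (V_r^{⊗ μ_r} ⊗ L_r)` over the
parabolic subalgebra: the generators act by `genAct`. As they generate the subalgebra, there is at
most one such `ρ`. -/
def IsVLAction (K : Type u) [Field K] (q : Kˣ) {r n : ℕ} (μ : RComp r n)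
    (V : Fin r → Type v) [∀ k, AddCommGroup (V k)] [∀ k, Module K (V k)]
    [∀ k, Module (KG K r) (V k)] [∀ k, IsScalarTower K (KG K r) (V k)]
    (L : Fin r → Type w) [∀ k, AddCommGroup (L k)] [∀ k, Module K (L k)]
    [∀ k, Module (Hhat K (μ.1 k) q) (L k)] [∀ k, IsScalarTower K (Hhat K (μ.1 k) q) (L k)]
    (ρ : Ypar K q μ →ₐ[K] Module.End K (VL K μ V L)) : Prop :=
  ∀ x : PGen μ, ρ (x.toPar K q) = genAct K q μ V L x

/-- The `B`-submodule of `B ⊗_K N` generated by all `b a ⊗ x - b ⊗ a x` with `a ∈ A`. -/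
def indRel {K : Type u} [Field K] {B : Type v} [Ring B] [Algebra K B] {A : Subalgebra K B}
    {N : Type w} [AddCommGroup N] [Module K N] (ρ : A →ₐ[K] Module.End K N) :
    Submodule B (B ⊗[K] N) :=
  Submodule.span B {z | ∃ (b : B) (a : A) (x : N), z = (b * (a : B)) ⊗ₜ[K] x - b ⊗ₜ[K] (ρ a x)}

/-- The induced module `Ind_A^B N = B ⊗_A N`, for a subalgebra `A` of `B` and an `A`-module `N`
given by its structure map `ρ`. -/
abbrev Ind {K : Type u} [Field K] {B : Type v} [Ring B] [Algebra K B] {A : Subalgebra K B}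
    {N : Type w} [AddCommGroup N] [Module K N] (ρ : A →ₐ[K] Module.End K N) : Type (max v w) :=
  (B ⊗[K] N) ⧸ indRel ρ

/-- The module `S_μ(L.)` over the affine Yokonuma-Hecke algebra, induced from the parabolic
subalgebra. -/
abbrev S (K : Type u) [Field K] (q : Kˣ) {r n : ℕ} (μ : RComp r n)
    (V : Fin r → Type v) [∀ k, AddCommGroup (V k)] [∀ k, Module K (V k)]
    (L : Fin r → Type w) [∀ k, AddCommGroup (L k)] [∀ k, Module K (L k)]
    (ρ : Ypar K q μ →ₐ[K] Module.End K (VL K μ V L)) : Type (max u v w) :=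
  Ind (K := K) (B := Yhat K r n q) (A := Ypar K q μ) (N := VL K μ V L) ρ

end AffineYokonuma

end

open AffineYokonuma

/-!
Fix the composition `μ` and a module `N` over the tensor product of the affine Hecke algebras of
sizes `μ_1, …, μ_r` (a `HeckeFamily`). The idempotents of the commuting `t_j` split a module over
the affine Yokonuma-Hecke algebra into weight spaces indexed by words `χ_1 … χ_n` in the `r`-th
roots of unity. If `χ_i = χ_{i+1}`, then `e_i` acts on the weight space of `χ` by `1`, so `g_i`
preserves it and satisfies the quadratic relation of a Hecke generator; otherwise `e_i` acts by
`0`, so `g_i` is an involution that identifies the weight spaces of `χ` and of `χ` with letters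
`i, i+1` exchanged. Hence the module is determined by the weight space of the sorted word of each
content, on which the parabolic subalgebra acts through the affine Hecke algebras.

This is made precise by an explicit model: on the functions from the words of content `μ` to `N`,
let `t_j` act through the `j`-th letter, `X_j` as the `Y` whose index is the number of earlier
letters equal to the `j`-th one, and `g_i` as a Hecke generator or as the exchange of two letters
(`HeckeFamily.toEnd`, `FMod`). The relations are checked directly, so no basis theorem for the
algebra is needed. The model has the universal property of the induced module
(`FMod.extend`, `HeckeFamily.indEquiv`): a product of `g`'s that sorts `χ` (`sorter`) carries the
sorted weight space to that of `χ`, and it is well defined by the braid relations. Every nonzero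
submodule of the model meets the sorted weight space `N`, so the model is simple exactly when `N`
is simple (`HeckeFamily.isSimpleModule_fMod`, `HeckeFamily.irred_of_isSimpleModule_fMod`), it
determines `μ` and `N` (`HeckeFamily.content_eq_of_equiv`, `HeckeFamily.Iso.of_fMod`), and every
simple module is such a model (`HeckeFamily.exists_equiv_fMod`).

It remains to compare simple modules over the tensor product of the Hecke algebras with tuples of
simple modules `L_k`. Both algebras are finitely generated as modules over commutative subalgebras
of finite type, so their simple modules are finite-dimensional (`finite_of_isSimpleModule`).
Burnside's theorem then makes external tensor products of simple modules simple, every simple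
module is of this form, and the factors are recovered from their annihilators
(`HeckeFamily.irred_tensor`, `HeckeFamily.Irred.exists_iso_tensor`,
`HeckeFamily.iso_tensor_lsmul_iff`). The factors `V_k^{⊗ μ_k}` are one-dimensional and only fix the
scalars by which the `t_j` act.
-/

noncomputable section

namespace AffineYokonuma

/-! ### Relations in the affine Yokonuma-Hecke algebra -/

namespace Yhat

variable {K : Type u} [Field K] {r n : ℕ} {q : Kˣ}

theorem commute_g_g {i j : Fin (n - 1)} (h : (i : ℕ) + 2 ≤ j ∨ (j : ℕ) + 2 ≤ i) :
    Commute (g i : Yhat K r n q) (g j) := by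
  simpa [g, Commute, SemiconjBy] using mk_rel (YRel.g_comm (q := q) (r := r) i j h)

theorem g_braid {i j : Fin (n - 1)} (h : (j : ℕ) = i + 1) :
    (g i : Yhat K r n q) * g j * g i = g j * g i * g j := by
  simpa [g] using mk_rel (YRel.g_braid (q := q) (r := r) i j h)

/-- The element `X_j`. -/
abbrev Xv (j : Fin n) : Yhat K r n q := (X j : (Yhat K r n q)ˣ)

/-- The element `X_1`. -/
abbrev X1v : Yhat K r n q := (X1 : (Yhat K r n q)ˣ)

theorem X_zero (h : 0 < n) : (Xv ⟨0, h⟩ : Yhat K r n q) = X1v := by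
  rfl

theorem X_hi (i : Fin (n - 1)) :
    (Xv (hi i) : Yhat K r n q) = g i * Xv (lo i) * g i := rfl

theorem commute_g_X1 {i : Fin (n - 1)} (h : 1 ≤ (i : ℕ)) :
    Commute (g i : Yhat K r n q) X1v := by
  simpa [g, X1v, X1, Commute, SemiconjBy] using mk_rel (YRel.g_X (q := q) (r := r) i h)

theorem g_X1_g_X1 {i : Fin (n - 1)} (h : (i : ℕ) = 0) :
    (g i : Yhat K r n q) * X1v * g i * X1v =
      X1v * g i * X1v * g i := by
  simpa [g, X1v, X1] using mk_rel (YRel.g_X_g_X (q := q) (r := r) i h)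

theorem commute_t_X1 (j : Fin n) : Commute (t j : Yhat K r n q) X1v := by
  simpa [t, X1v, X1, Commute, SemiconjBy] using mk_rel (YRel.t_X (q := q) (r := r) j)

theorem t_g (i : Fin (n - 1)) (j : Fin n) :
    (t j : Yhat K r n q) * g i = g i * t (Equiv.swap (lo i) (hi i) j) := by
  rw [g_t, Equiv.swap_apply_self]

/-- Induction over positions along the recursion `X_{i+1} = g_i X_i g_i`. -/
theorem pos_induction {P : Fin n → Prop} (h0 : ∀ h : 0 < n, P ⟨0, h⟩)
    (hs : ∀ i : Fin (n - 1), P (lo i) → P (hi i)) (j : Fin n) : P j := by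
  obtain ⟨j, hj⟩ := j
  induction j with
  | zero => exact h0 hj
  | succ j ih => exact hs ⟨j, by omega⟩ (ih (by omega))

theorem commute_t_X (l j : Fin n) : Commute (t l : Yhat K r n q) (Xv j) := by
  revert l
  induction j using pos_induction with
  | h0 h => intro l; rw [X_zero]; exact commute_t_X1 l
  | hs i ih =>
    intro l
    rw [X_hi, commute_iff_eq, ← mul_assoc, ← mul_assoc, t_g, mul_assoc (g i), (ih _).eq, mul_assoc,
      mul_assoc, t_g, Equiv.swap_apply_self]
    simp only [mul_assoc]

theorem commute_g_X_of_lt {i : Fin (n - 1)} {j : Fin n} (h : (j : ℕ) < i) :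
    Commute (g i : Yhat K r n q) (Xv j) := by
  induction j using pos_induction with
  | h0 hn => rw [X_zero]; exact commute_g_X1 h
  | hs l ih =>
    have h' : (l : ℕ) + 1 < i := h
    rw [X_hi]
    have hg : Commute (g i : Yhat K r n q) (g l) := commute_g_g (by omega)
    exact (hg.mul_right (ih (by simp [lo]; omega))).mul_right hg

theorem commute_g_X_of_gt {i : Fin (n - 1)} {j : Fin n} (h : (i : ℕ) + 1 < j) :
    Commute (g i : Yhat K r n q) (Xv j) := by
  induction j using pos_induction with
  | h0 hn => simp at h
  | hs l ih =>
    have h' : (i : ℕ) + 1 < l + 1 := h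
    rcases Nat.lt_or_ge ((i : ℕ) + 1) l with h2 | h2
    · have hg : Commute (g i : Yhat K r n q) (g l) := commute_g_g (by omega)
      rw [X_hi]
      exact (hg.mul_right (ih h2)).mul_right hg
    · have hl : lo l = hi i := Fin.ext (by simp [lo, hi]; omega)
      have hb : (g i : Yhat K r n q) * g l * g i = g l * g i * g l := g_braid (by omega)
      have hx : Commute (g l : Yhat K r n q) (Xv (lo i)) :=
        commute_g_X_of_lt (by simp [lo]; omega)
      rw [X_hi, hl, X_hi, commute_iff_eq]
      generalize (Xv (lo i) : Yhat K r n q) = y at *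
      generalize (g i : Yhat K r n q) = a at *
      generalize (g l : Yhat K r n q) = b at *
      calc a * (b * (a * y * a) * b) = (a * b * a) * y * a * b := by simp only [mul_assoc]
        _ = b * a * (b * y) * a * b := by rw [hb]; simp only [mul_assoc]
        _ = b * a * y * (b * a * b) := by rw [hx.eq]; simp only [mul_assoc]
        _ = b * (a * y * a) * b * a := by rw [← hb]; simp only [mul_assoc]

theorem commute_g_X {i : Fin (n - 1)} {j : Fin n} (h₁ : j ≠ lo i) (h₂ : j ≠ hi i) :
    Commute (g i : Yhat K r n q) (Xv j) := by
  have h₁' : (j : ℕ) ≠ i := fun h => h₁ (Fin.ext h)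
  have h₂' : (j : ℕ) ≠ i + 1 := fun h => h₂ (Fin.ext h)
  rcases Nat.lt_or_ge (j : ℕ) i with h | h
  · exact commute_g_X_of_lt h
  · exact commute_g_X_of_gt (by omega)

theorem commute_X1_X (j : Fin n) :
    Commute (X1v : Yhat K r n q) (Xv j) := by
  induction j using pos_induction with
  | h0 h => rw [X_zero]
  | hs i ih =>
    rw [X_hi]
    rcases Nat.eq_zero_or_pos (i : ℕ) with h | h
    · have h0 : lo i = ⟨0, by omega⟩ := Fin.ext h
      rw [h0, X_zero, commute_iff_eq, g_X1_g_X1 h]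
      simp only [mul_assoc]
    · have hg := (commute_g_X1 (K := K) (r := r) (q := q) h).symm
      exact (hg.mul_right ih).mul_right hg

theorem commute_X_X_of_lt {i j : Fin n} (h : i < j) :
    Commute (Xv i : Yhat K r n q) (Xv j) := by
  induction i using pos_induction with
  | h0 hn => rw [X_zero]; exact commute_X1_X j
  | hs l ih =>
    have h' : (l : ℕ) + 1 < j := h
    have hg : Commute (g l : Yhat K r n q) (Xv j) := commute_g_X_of_gt h'
    rw [X_hi]
    exact (hg.mul_left (ih (Fin.lt_def.2 (by simp [lo]; omega)))).mul_left hg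

theorem commute_X_X (i j : Fin n) :
    Commute (Xv i : Yhat K r n q) (Xv j) := by
  rcases lt_trichotomy i j with h | rfl | h
  · exact commute_X_X_of_lt h
  · exact Commute.refl _
  · exact (commute_X_X_of_lt h).symm

/-- Algebra homomorphisms out of the affine Yokonuma-Hecke algebra. -/
def lift {B : Type*} [Ring B] [Algebra K B] (f : YGen n → B)
    (hf : ∀ ⦃x y⦄, YRel K r n q x y → FreeAlgebra.lift K f x = FreeAlgebra.lift K f y) :
    Yhat K r n q →ₐ[K] B :=
  RingQuot.liftAlgHom K ⟨FreeAlgebra.lift K f, hf⟩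

theorem lift_mk {B : Type*} [Ring B] [Algebra K B] (f : YGen n → B)
    (hf : ∀ ⦃x y⦄, YRel K r n q x y → FreeAlgebra.lift K f x = FreeAlgebra.lift K f y)
    (a : FreeAlgebra K (YGen n)) :
    lift f hf (mk K r n q a) = FreeAlgebra.lift K f a :=
  RingQuot.liftAlgHom_mkAlgHom_apply K _ _ _

theorem mk_surjective : Function.Surjective (mk K r n q) := RingQuot.mkAlgHom_surjective K _

/-- The affine Yokonuma-Hecke algebra is generated by the `t_j`, the `g_i` and `X_1^{±1}`. -/
theorem induction {P : Yhat K r n q → Prop} (halg : ∀ c : K, P (algebraMap K _ c))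
    (ht : ∀ j, P (t j)) (hg : ∀ i, P (g i)) (hX : P X1v)
    (hXi : P ((X1⁻¹ : (Yhat K r n q)ˣ) : Yhat K r n q))
    (hadd : ∀ a b, P a → P b → P (a + b)) (hmul : ∀ a b, P a → P b → P (a * b))
    (a : Yhat K r n q) : P a := by
  obtain ⟨a, rfl⟩ := mk_surjective a
  induction a using FreeAlgebra.induction with
  | grade0 c => simpa using halg c
  | grade1 x =>
    cases x with
    | t j => exact ht j
    | g i => exact hg i
    | X => exact hX
    | Xinv => exact hXi
  | mul a b ha hb => rw [map_mul]; exact hmul _ _ ha hb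
  | add a b ha hb => rw [map_add]; exact hadd _ _ ha hb

end Yhat

namespace Hhat

variable {K : Type u} [Field K] {m : ℕ} {q : Kˣ}

theorem mk_rel {x y : FreeAlgebra K (HGen m)} (h : HRel K m q x y) :
    mk K m q x = mk K m q y := RingQuot.mkAlgHom_rel K h

theorem T_sq (i : Fin (m - 1)) :
    (T i : Hhat K m q) * T i = 1 + ((q : K) - (q : K)⁻¹) • T i := by
  have h := mk_rel (HRel.quad (q := q) i)
  simp only [map_mul, map_sub, map_add, AlgHom.commutes, map_zero] at h
  change (T i - _) * (T i + _) = 0 at h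
  have hq : algebraMap K (Hhat K m q) q * algebraMap K _ (q : K)⁻¹ = 1 := by
    rw [← map_mul, mul_inv_cancel₀ q.ne_zero, map_one]
  rw [Algebra.smul_def, map_sub, ← sub_eq_zero, ← h, sub_mul, sub_mul, mul_add, mul_add, hq,
    ← Algebra.commutes]
  abel

theorem T_braid {i j : Fin (m - 1)} (h : (j : ℕ) = i + 1) :
    (T i : Hhat K m q) * T j * T i = T j * T i * T j := by
  simpa [T] using mk_rel (HRel.braid (q := q) i j h)

theorem commute_T_T {i j : Fin (m - 1)} (h : (i : ℕ) + 2 ≤ j ∨ (j : ℕ) + 2 ≤ i) :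
    Commute (T i : Hhat K m q) (T j) := by
  simpa [T, Commute, SemiconjBy] using mk_rel (HRel.T_comm (q := q) i j h)

theorem Y_mul_Yinv (j : Fin m) : (Y j : Hhat K m q) * Yinv j = 1 := by
  simpa [Y, Yinv] using mk_rel (HRel.Y_Yinv (q := q) j)

theorem Yinv_mul_Y (j : Fin m) : (Yinv j : Hhat K m q) * Y j = 1 := by
  simpa [Y, Yinv] using mk_rel (HRel.Yinv_Y (q := q) j)

theorem commute_Y_Y (i j : Fin m) : Commute (Y i : Hhat K m q) (Y j) := by
  simpa [Y, Commute, SemiconjBy] using mk_rel (HRel.Y_comm (q := q) i j)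

theorem T_Y_T (i : Fin (m - 1)) : (T i : Hhat K m q) * Y (lo i) * T i = Y (hi i) := by
  simpa [Y, T] using mk_rel (HRel.T_Y_T (q := q) i)

theorem commute_T_Y {i : Fin (m - 1)} {j : Fin m} (h₁ : j ≠ lo i) (h₂ : j ≠ hi i) :
    Commute (T i : Hhat K m q) (Y j) := by
  simpa [Y, T, Commute, SemiconjBy] using mk_rel (HRel.T_Y (q := q) i j h₁ h₂)

/-- Algebra homomorphisms out of the affine Hecke algebra. -/
def lift {B : Type*} [Ring B] [Algebra K B] (f : HGen m → B)
    (hf : ∀ ⦃x y⦄, HRel K m q x y → FreeAlgebra.lift K f x = FreeAlgebra.lift K f y) :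
    Hhat K m q →ₐ[K] B :=
  RingQuot.liftAlgHom K ⟨FreeAlgebra.lift K f, hf⟩

theorem lift_mk {B : Type*} [Ring B] [Algebra K B] (f : HGen m → B)
    (hf : ∀ ⦃x y⦄, HRel K m q x y → FreeAlgebra.lift K f x = FreeAlgebra.lift K f y)
    (a : FreeAlgebra K (HGen m)) :
    lift f hf (mk K m q a) = FreeAlgebra.lift K f a :=
  RingQuot.liftAlgHom_mkAlgHom_apply K _ _ _

theorem mk_surjective : Function.Surjective (mk K m q) := RingQuot.mkAlgHom_surjective K _

/-- The affine Hecke algebra is generated by the `T_i` and the `Y_j^{±1}`. -/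
theorem induction {P : Hhat K m q → Prop} (halg : ∀ c : K, P (algebraMap K _ c))
    (hT : ∀ i, P (T i)) (hY : ∀ j, P (Y j)) (hYi : ∀ j, P (Yinv j))
    (hadd : ∀ a b, P a → P b → P (a + b)) (hmul : ∀ a b, P a → P b → P (a * b))
    (a : Hhat K m q) : P a := by
  obtain ⟨a, rfl⟩ := mk_surjective a
  induction a using FreeAlgebra.induction with
  | grade0 c => simpa using halg c
  | grade1 x =>
    cases x with
    | T i => exact hT i
    | Y j => exact hY j
    | Yinv j => exact hYi j
  | mul a b ha hb => rw [map_mul]; exact hmul _ _ ha hb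
  | add a b ha hb => rw [map_add]; exact hadd _ _ ha hb

end Hhat

/-! ### Words in the block labels -/

section Words

variable {r n : ℕ}

/-- The simple transposition of two neighbouring positions. -/
abbrev sw (i : Fin (n - 1)) : Equiv.Perm (Fin n) := Equiv.swap (lo i) (hi i)

theorem lo_lt_hi (i : Fin (n - 1)) : lo i < hi i := Fin.lt_def.2 (by simp [lo, hi])

theorem lo_ne_hi (i : Fin (n - 1)) : lo i ≠ hi i := (lo_lt_hi i).ne

@[simp] theorem val_lo (i : Fin (n - 1)) : ((lo i : Fin n) : ℕ) = i := rfl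

@[simp] theorem val_hi (i : Fin (n - 1)) : ((hi i : Fin n) : ℕ) = i + 1 := rfl

theorem sw_of_ne {i : Fin (n - 1)} {j : Fin n} (h₁ : (j : ℕ) ≠ i) (h₂ : (j : ℕ) ≠ i + 1) :
    sw i j = j :=
  Equiv.swap_apply_of_ne_of_ne (fun h => h₁ (by rw [h]; rfl)) (fun h => h₂ (by rw [h]; rfl))

theorem val_sw (i : Fin (n - 1)) (j : Fin n) :
    ((sw i j : Fin n) : ℕ) =
      if (j : ℕ) = i then (i : ℕ) + 1 else if (j : ℕ) = i + 1 then i else j := by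
  split_ifs with h₁ h₂
  · rw [show j = lo i from Fin.ext h₁, Equiv.swap_apply_left]; rfl
  · rw [show j = hi i from Fin.ext h₂, Equiv.swap_apply_right]; rfl
  · rw [sw_of_ne h₁ h₂]

/-- The number of earlier positions carrying the same label. -/
def rank (χ : Fin n → Fin r) (j : Fin n) : ℕ :=
  (Finset.univ.filter fun l => l < j ∧ χ l = χ j).card

theorem rank_zero (χ : Fin n → Fin r) (h : 0 < n) : rank χ ⟨0, h⟩ = 0 := by
  rw [rank, Finset.card_eq_zero, Finset.filter_eq_empty_iff]
  rintro l - ⟨h', -⟩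
  exact absurd (Fin.lt_def.1 h') (by simp)

theorem rank_lt_rank {χ : Fin n → Fin r} {j l : Fin n} (h : j < l) (hχ : χ j = χ l) :
    rank χ j < rank χ l := by
  refine Finset.card_lt_card (Finset.ssubset_iff_of_subset ?_ |>.2 ⟨j, ?_, ?_⟩)
  · intro m hm
    simp only [Finset.mem_filter, Finset.mem_univ, true_and] at hm ⊢
    exact ⟨hm.1.trans h, hm.2.trans hχ⟩
  · simp [h, hχ]
  · simp

theorem rank_hi {χ : Fin n → Fin r} {i : Fin (n - 1)} (h : χ (lo i) = χ (hi i)) :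
    rank χ (hi i) = rank χ (lo i) + 1 := by
  have : (Finset.univ.filter fun l => l < hi i ∧ χ l = χ (hi i)) =
      insert (lo i) (Finset.univ.filter fun l => l < lo i ∧ χ l = χ (lo i)) := by
    ext m
    simp only [Finset.mem_filter, Finset.mem_univ, true_and, Finset.mem_insert, Fin.lt_def, val_lo,
      val_hi, h]
    constructor
    · rintro ⟨h1, h2⟩
      rcases Nat.lt_or_ge (m : ℕ) i with h3 | h3
      · exact Or.inr ⟨h3, h2⟩
      · exact Or.inl (Fin.ext (by simp; omega))
    · rintro (rfl | ⟨h1, h2⟩)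
      · exact ⟨by simp, h⟩
      · exact ⟨by omega, h2⟩
  rw [rank, this, Finset.card_insert_of_notMem (by simp), rank]

/-- Exchanging two neighbouring distinct labels does not change the ranks. -/
theorem rank_comp_sw {χ : Fin n → Fin r} {i : Fin (n - 1)} (h : χ (lo i) ≠ χ (hi i)) (j : Fin n) :
    rank (χ ∘ sw i) (sw i j) = rank χ j := by
  refine Finset.card_bij (fun l _ => sw i l) ?_ (fun _ _ _ _ h => (sw i).injective h) ?_
  · intro l hl
    simp only [Finset.mem_filter, Finset.mem_univ, true_and, Function.comp_apply,
      Equiv.swap_apply_self] at hl ⊢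
    refine ⟨?_, hl.2⟩
    by_contra hc
    obtain ⟨h1, h2⟩ := hl
    rw [Fin.lt_def, val_sw] at h1
    rw [Fin.lt_def, val_sw] at hc
    have h3 : ¬ ((l : ℕ) = i ∧ (j : ℕ) = i) := by
      rintro ⟨h4, h5⟩
      rw [show l = lo i from Fin.ext h4, show j = lo i from Fin.ext h5,
        Equiv.swap_apply_left] at h2
      exact h h2.symm
    split_ifs at h1 hc <;> omega
  · intro l hl
    simp only [Finset.mem_filter, Finset.mem_univ, true_and] at hl
    refine ⟨sw i l, ?_, by simp⟩
    obtain ⟨h1, h2⟩ := hl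
    simp only [Finset.mem_filter, Finset.mem_univ, true_and, Function.comp_apply,
      Equiv.swap_apply_self, h2, and_true]
    have h3' : ¬ ((l : ℕ) = i ∧ (j : ℕ) = i + 1) := by
      rintro ⟨h4, h5⟩
      rw [show l = lo i from Fin.ext h4, show j = hi i from Fin.ext h5] at h2
      exact h h2
    rw [Fin.lt_def, val_sw, val_sw]
    rw [Fin.lt_def] at h1
    split_ifs <;> omega

/-- A statistic that drops when a descent is removed. -/
def height (χ : Fin n → Fin r) : ℕ := ∑ j : Fin n, (n - j) * χ j

theorem height_comp_sw {χ : Fin n → Fin r} {i : Fin (n - 1)} (h : χ (hi i) < χ (lo i)) :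
    height (χ ∘ sw i) < height χ := by
  have h1 : height (χ ∘ sw i) = ∑ j : Fin n, (n - sw i j) * χ j := by
    rw [height, ← Equiv.sum_comp (sw i)]
    simp
  have hm : hi i ∈ Finset.univ.erase (lo i) := by simp [(lo_ne_hi i).symm]
  rw [h1, height, ← Finset.add_sum_erase _ _ (Finset.mem_univ (lo i)),
    ← Finset.add_sum_erase _ _ hm, ← Finset.add_sum_erase _ _ (Finset.mem_univ (lo i)),
    ← Finset.add_sum_erase _ _ hm]
  have h2 : ∑ x ∈ (Finset.univ.erase (lo i)).erase (hi i), (n - (sw i x : ℕ)) * (χ x : ℕ) =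
      ∑ x ∈ (Finset.univ.erase (lo i)).erase (hi i), (n - x) * (χ x : ℕ) := by
    refine Finset.sum_congr rfl fun x hx => ?_
    simp only [Finset.mem_erase, Finset.mem_univ, and_true] at hx
    rw [Equiv.swap_apply_of_ne_of_ne hx.2 hx.1]
  rw [h2, Equiv.swap_apply_left, Equiv.swap_apply_right, val_lo, val_hi]
  rw [Fin.lt_def] at h
  have h3 : (n - (i : ℕ)) = (n - (i + 1)) + 1 := by have := i.2; omega
  rw [h3, add_mul, add_mul]
  omega

theorem monotone_of_no_descent {χ : Fin n → Fin r} (h : ∀ i : Fin (n - 1), χ (lo i) ≤ χ (hi i)) :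
    Monotone χ := by
  intro a b hab
  induction b using Yhat.pos_induction with
  | h0 h0 => rw [show a = ⟨0, h0⟩ from Fin.ext (by have := Fin.le_def.1 hab; simpa using this)]
  | hs i ih =>
    rcases eq_or_lt_of_le hab with rfl | h'
    · exact le_rfl
    · exact (ih (Fin.le_def.2 (by have := Fin.lt_def.1 h'; simp at this ⊢; omega))).trans (h i)

/-- Every word can be sorted by removing descents. -/
theorem sort_induction {P : (Fin n → Fin r) → Prop} (h0 : ∀ χ, Monotone χ → P χ)
    (hs : ∀ χ (i : Fin (n - 1)), χ (hi i) < χ (lo i) → P (χ ∘ sw i) → P χ) (χ : Fin n → Fin r) :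
    P χ := by
  induction hN : height χ using Nat.strong_induction_on generalizing χ with
  | _ N ih =>
    by_cases h : ∀ i : Fin (n - 1), χ (lo i) ≤ χ (hi i)
    · exact h0 χ (monotone_of_no_descent h)
    · push Not at h
      obtain ⟨i, hi⟩ := h
      exact hs χ i hi (ih _ (hN ▸ height_comp_sw hi) _ rfl)

/-- The words with `μ_k` letters equal to `k`. -/
def HasContent (μ : RComp r n) (χ : Fin n → Fin r) : Prop :=
  ∀ k, (Finset.univ.filter fun j => χ j = k).card = μ.1 k

theorem HasContent.comp_perm {μ : RComp r n} {χ : Fin n → Fin r} (h : HasContent μ χ)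
    (σ : Equiv.Perm (Fin n)) : HasContent μ (χ ∘ σ) := by
  intro k
  rw [← h k]
  refine Finset.card_bij (fun l _ => σ l) (by simp) (fun _ _ _ _ h => σ.injective h) ?_
  intro l hl
  exact ⟨σ.symm l, by simpa using hl, by simp⟩

theorem HasContent.rank_lt {μ : RComp r n} {χ : Fin n → Fin r} (h : HasContent μ χ) (j : Fin n) :
    rank χ j < μ.1 (χ j) := by
  rw [← h]
  refine Finset.card_lt_card (Finset.ssubset_iff_of_subset ?_ |>.2 ⟨j, ?_, ?_⟩)
  · intro m hm
    simp only [Finset.mem_filter, Finset.mem_univ, true_and] at hm ⊢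
    exact hm.2
  · simp
  · simp

theorem HasContent.rank_lo_lt {μ : RComp r n} {χ : Fin n → Fin r} (h : HasContent μ χ)
    {i : Fin (n - 1)} (hi' : χ (lo i) = χ (hi i)) : rank χ (lo i) < μ.1 (χ (lo i)) - 1 := by
  have := h.rank_lt (hi i)
  rw [rank_hi hi', ← hi'] at this
  omega

/-- The composition recording how often each label occurs in a word. -/
def content (χ : Fin n → Fin r) : RComp r n :=
  ⟨fun k => (Finset.univ.filter fun j => χ j = k).card, by
    rw [← Finset.card_eq_sum_card_fiberwise (fun _ _ => Finset.mem_coe.2 (Finset.mem_univ _)),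
      Finset.card_univ, Fintype.card_fin]⟩

theorem hasContent_content (χ : Fin n → Fin r) : HasContent (content χ) χ := fun _ => rfl

theorem HasContent.unique {μ ν : RComp r n} {χ : Fin n → Fin r} (h : HasContent μ χ)
    (h' : HasContent ν χ) : μ = ν :=
  Subtype.ext (funext fun k => (h k).symm.trans (h' k))

theorem card_lt_eq {μ : RComp r n} {χ : Fin n → Fin r} (h : HasContent μ χ) (k : Fin r) :
    (Finset.univ.filter fun j => χ j < k).card = ∑ l ∈ Finset.Iio k, μ.1 l := by
  rw [Finset.card_eq_sum_card_fiberwise (f := χ) (t := Finset.Iio k)]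
  · refine Finset.sum_congr rfl fun l hl => ?_
    rw [← h l, Finset.filter_filter]
    congr 1
    ext m
    simp only [Finset.mem_filter, Finset.mem_univ, true_and, and_iff_right_iff_imp]
    rintro rfl
    simpa using hl
  · intro m hm
    simpa using hm

/-- In a sorted word, label and rank determine the position. -/
theorem HasContent.val_eq {μ : RComp r n} {χ : Fin n → Fin r} (h : HasContent μ χ)
    (hm : Monotone χ) (j : Fin n) : (j : ℕ) = ∑ l ∈ Finset.Iio (χ j), μ.1 l + rank χ j := by
  rw [← card_lt_eq h, rank, ← Finset.card_union_of_disjoint]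
  · have : (Finset.univ.filter fun m => χ m < χ j) ∪
        (Finset.univ.filter fun m => m < j ∧ χ m = χ j) = Finset.Iio j := by
      ext m
      simp only [Finset.mem_union, Finset.mem_filter, Finset.mem_univ, true_and, Finset.mem_Iio]
      constructor
      · rintro (h1 | h1)
        · exact lt_of_not_ge fun h2 => absurd (hm h2) (not_le.2 h1)
        · exact h1.1
      · intro h1
        rcases (hm h1.le).lt_or_eq with h2 | h2
        · exact Or.inl h2
        · exact Or.inr ⟨h1, h2⟩
    rw [this, Fin.card_Iio]
  · rw [Finset.disjoint_filter]
    rintro m - h1 ⟨-, h2⟩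
    exact h1.ne h2

end Words

namespace RComp

variable {r n : ℕ} (μ : RComp r n)

theorem pos_lt_pos {k l : Fin r} (h : k < l) (p : Fin (μ.1 k)) (p' : Fin (μ.1 l)) :
    μ.pos k p < μ.pos l p' := by
  have h1 : ∑ m ∈ insert k (Finset.Iio k), μ.1 m ≤ ∑ m ∈ Finset.Iio l, μ.1 m := by
    refine Finset.sum_le_sum_of_subset fun m hm => ?_
    rw [Finset.mem_insert, Finset.mem_Iio] at hm
    rw [Finset.mem_Iio]
    rcases hm with rfl | hm
    · exact h
    · exact hm.trans h
  rw [Finset.sum_insert (by simp)] at h1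
  rw [Fin.lt_def]
  simp only [pos]
  have := p.2
  omega

theorem pos_bijective :
    Function.Bijective (fun x : (Σ k, Fin (μ.1 k)) => μ.pos x.1 x.2) := by
  rw [Fintype.bijective_iff_injective_and_card]
  constructor
  · rintro ⟨k, p⟩ ⟨l, p'⟩ h
    simp only at h
    rcases lt_trichotomy k l with hkl | rfl | hkl
    · exact absurd h (μ.pos_lt_pos hkl p p').ne
    · have : (p : ℕ) = p' := by
        have := congrArg Fin.val h
        simpa [pos] using this
      rw [Fin.ext this]
    · exact absurd h (μ.pos_lt_pos hkl p' p).ne'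
  · simp [Fintype.card_sigma, μ.2]

/-- The pairs (block, position in the block) enumerate all positions. -/
def posEquiv : (Σ k, Fin (μ.1 k)) ≃ Fin n := Equiv.ofBijective _ μ.pos_bijective

/-- The sorted word of content `μ`: position `j` carries the label of its block. -/
def sorted (j : Fin n) : Fin r := (μ.posEquiv.symm j).1

@[simp] theorem sorted_pos (k : Fin r) (p : Fin (μ.1 k)) : μ.sorted (μ.pos k p) = k := by
  have : μ.posEquiv.symm (μ.pos k p) = ⟨k, p⟩ := by
    rw [Equiv.symm_apply_eq]; rfl
  rw [sorted, this]

theorem exists_pos (j : Fin n) : ∃ k p, j = μ.pos k p :=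
  ⟨_, _, (μ.posEquiv.apply_symm_apply j).symm⟩

theorem monotone_sorted : Monotone μ.sorted := by
  intro a b hab
  obtain ⟨k, p, rfl⟩ := μ.exists_pos a
  obtain ⟨l, p', rfl⟩ := μ.exists_pos b
  rw [sorted_pos, sorted_pos]
  by_contra h
  exact absurd hab (not_le.2 (μ.pos_lt_pos (not_le.1 h) p' p))

theorem hasContent_sorted : HasContent μ μ.sorted := by
  intro k
  rw [← Fintype.card_fin (μ.1 k), ← Finset.card_univ]
  symm
  refine Finset.card_bij (fun p _ => μ.pos k p) (by simp) ?_ ?_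
  · intro p _ p' _ h
    have := congrArg Fin.val h
    exact Fin.ext (by simpa [pos] using this)
  · intro j hj
    obtain ⟨l, p, rfl⟩ := μ.exists_pos j
    simp only [Finset.mem_filter, Finset.mem_univ, sorted_pos, true_and] at hj
    subst hj
    exact ⟨p, Finset.mem_univ _, rfl⟩

theorem eq_sorted {χ : Fin n → Fin r} (h : HasContent μ χ) (hm : Monotone χ) : χ = μ.sorted := by
  funext j
  have : j = μ.pos (χ j) ⟨rank χ j, h.rank_lt j⟩ := Fin.ext (h.val_eq hm j)
  conv_rhs => rw [this]
  rw [sorted_pos]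

@[simp] theorem rank_sorted_pos (k : Fin r) (p : Fin (μ.1 k)) :
    rank μ.sorted (μ.pos k p) = p := by
  have := μ.hasContent_sorted.val_eq μ.monotone_sorted (μ.pos k p)
  rw [sorted_pos] at this
  simp only [pos] at this ⊢
  omega

theorem lo_transp (k : Fin r) (p : Fin (μ.1 k - 1)) : lo (μ.transp k p) = μ.pos k (lo p) := rfl

theorem hi_transp (k : Fin r) (p : Fin (μ.1 k - 1)) : hi (μ.transp k p) = μ.pos k (hi p) := rfl

theorem eq_pos_rank (j : Fin n) :
    j = μ.pos (μ.sorted j) ⟨rank μ.sorted j, μ.hasContent_sorted.rank_lt j⟩ :=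
  Fin.ext (μ.hasContent_sorted.val_eq μ.monotone_sorted j)

theorem eq_transp_rank {i : Fin (n - 1)} (h : μ.sorted (lo i) = μ.sorted (hi i)) :
    i = μ.transp (μ.sorted (lo i)) ⟨rank μ.sorted (lo i), μ.hasContent_sorted.rank_lo_lt h⟩ :=
  Fin.ext (μ.hasContent_sorted.val_eq μ.monotone_sorted (lo i))

end RComp

/-! ### Commuting actions of affine Hecke algebras -/

/-- Pairwise commuting actions of the affine Hecke algebras of sizes `μ_1, …, μ_r` on one vector
space, that is, a module over their tensor product. -/
structure HeckeFamily {K : Type u} [Field K] (q : Kˣ) {r n : ℕ} (μ : RComp r n) (N : Type*)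
    [AddCommGroup N] [Module K N] where
  /-- The action of the `k`-th affine Hecke algebra. -/
  φ : ∀ k, Hhat K (μ.1 k) q →ₐ[K] Module.End K N
  comm : ∀ k l, k ≠ l → ∀ a b, Commute (φ k a) (φ l b)

namespace HeckeFamily

variable {K : Type u} [Field K] {q : Kˣ} {r n : ℕ} {μ : RComp r n} {N : Type*}
  [AddCommGroup N] [Module K N] (H : HeckeFamily q μ N)

/-- The operator `T_p` of the `k`-th affine Hecke algebra, zero for `p` out of range. -/
def T (k : Fin r) (p : ℕ) : Module.End K N :=
  if h : p < μ.1 k - 1 then H.φ k (Hhat.T ⟨p, h⟩) else 0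

/-- The operator `Y_p` of the `k`-th affine Hecke algebra, zero for `p` out of range. -/
def Y (k : Fin r) (p : ℕ) : Module.End K N :=
  if h : p < μ.1 k then H.φ k (Hhat.Y ⟨p, h⟩) else 0

/-- The operator `Y_p⁻¹` of the `k`-th affine Hecke algebra, zero for `p` out of range. -/
def Yinv (k : Fin r) (p : ℕ) : Module.End K N :=
  if h : p < μ.1 k then H.φ k (Hhat.Yinv ⟨p, h⟩) else 0

theorem T_fin (k : Fin r) (p : Fin (μ.1 k - 1)) : H.T k p = H.φ k (Hhat.T p) := by
  rw [T, dif_pos p.2]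

theorem Y_fin (k : Fin r) (p : Fin (μ.1 k)) : H.Y k p = H.φ k (Hhat.Y p) := by
  rw [Y, dif_pos p.2]

theorem Yinv_fin (k : Fin r) (p : Fin (μ.1 k)) : H.Yinv k p = H.φ k (Hhat.Yinv p) := by
  rw [Yinv, dif_pos p.2]

theorem commute_T_T_of_ne {k l : Fin r} (h : k ≠ l) (p p' : ℕ) : Commute (H.T k p) (H.T l p') := by
  unfold T
  split_ifs <;> simp [H.comm k l h]

theorem commute_T_Y_of_ne {k l : Fin r} (h : k ≠ l) (p p' : ℕ) : Commute (H.T k p) (H.Y l p') := by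
  unfold T Y
  split_ifs <;> simp [H.comm k l h]

theorem commute_Y_Y (k l : Fin r) (p p' : ℕ) : Commute (H.Y k p) (H.Y l p') := by
  by_cases h : k = l
  · subst h
    unfold Y
    split_ifs <;> simp [(Hhat.commute_Y_Y _ _).map (H.φ k)]
  · unfold Y
    split_ifs <;> simp [H.comm k l h]

theorem T_sq {k : Fin r} {p : ℕ} (h : p < μ.1 k - 1) :
    H.T k p * H.T k p = 1 + ((q : K) - (q : K)⁻¹) • H.T k p := by
  rw [T, dif_pos h, ← map_mul, Hhat.T_sq, map_add, map_one, map_smul]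

theorem T_braid {k : Fin r} {p : ℕ} (h : p + 1 < μ.1 k - 1) :
    H.T k p * H.T k (p + 1) * H.T k p = H.T k (p + 1) * H.T k p * H.T k (p + 1) := by
  rw [T, T, dif_pos h, dif_pos (by omega)]
  simp only [← map_mul]
  rw [Hhat.T_braid rfl]

theorem commute_T_T {k : Fin r} {p p' : ℕ} (h : p + 2 ≤ p' ∨ p' + 2 ≤ p) :
    Commute (H.T k p) (H.T k p') := by
  unfold T
  split_ifs with h1 h2
  · exact (Hhat.commute_T_T h).map (H.φ k)
  all_goals simp

theorem T_Y_T {k : Fin r} {p : ℕ} (h : p < μ.1 k - 1) :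
    H.T k p * H.Y k p * H.T k p = H.Y k (p + 1) := by
  rw [T, Y, Y, dif_pos h, dif_pos (by omega), dif_pos (by omega)]
  simp only [← map_mul]
  congr 1
  exact Hhat.T_Y_T ⟨p, h⟩

theorem commute_T_Y {k : Fin r} {p p' : ℕ} (h₁ : p' ≠ p) (h₂ : p' ≠ p + 1) :
    Commute (H.T k p) (H.Y k p') := by
  unfold T Y
  split_ifs with h3 h4
  · exact (Hhat.commute_T_Y (fun h => h₁ (congrArg Fin.val h))
      (fun h => h₂ (congrArg Fin.val h))).map (H.φ k)
  all_goals simp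

theorem Y_mul_Yinv {k : Fin r} {p : ℕ} (h : p < μ.1 k) : H.Y k p * H.Yinv k p = 1 := by
  rw [Y, Yinv, dif_pos h, dif_pos h, ← map_mul, Hhat.Y_mul_Yinv, map_one]

theorem Yinv_mul_Y {k : Fin r} {p : ℕ} (h : p < μ.1 k) : H.Yinv k p * H.Y k p = 1 := by
  rw [Y, Yinv, dif_pos h, dif_pos h, ← map_mul, Hhat.Yinv_mul_Y, map_one]

end HeckeFamily

/-- An enumeration of the `r`-th roots of unity of `K`, where `r` is invertible. -/
structure UnitRoots (K : Type u) [Field K] (r : ℕ) where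
  /-- The `k`-th root of unity. -/
  z : Fin r → K
  pow : ∀ k, z k ^ r = 1
  inj : Function.Injective z
  ne : (r : K) ≠ 0

namespace UnitRoots

variable {K : Type u} [Field K] {r : ℕ} (Z : UnitRoots K r)

/-- Orthogonality of characters: the scalar by which `e_i` acts on a weight space. -/
theorem sum_eq (a b : Fin r) :
    (r : K)⁻¹ * ∑ s ∈ Finset.range r, Z.z a ^ s * Z.z b ^ (r - s) = if a = b then 1 else 0 := by
  split_ifs with h
  · subst h
    rw [Finset.sum_congr rfl (g := fun _ => (1 : K))]
    · simp [Z.ne]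
    · intro s hs
      rw [← pow_add, Nat.add_sub_cancel' (Finset.mem_range.1 hs).le, Z.pow]
  · have h1 : ∑ s ∈ Finset.range r, Z.z a ^ s * Z.z b ^ (r - s) =
        (∑ s ∈ Finset.range r, Z.z a ^ s * Z.z b ^ (r - 1 - s)) * Z.z b := by
      rw [Finset.sum_mul]
      refine Finset.sum_congr rfl fun s hs => ?_
      rw [mul_assoc, ← pow_succ]
      have := Finset.mem_range.1 hs
      congr 2
      omega
    have h2 := geom_sum₂_mul (Z.z a) (Z.z b) r
    rw [Z.pow, Z.pow, sub_self, mul_eq_zero] at h2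
    rcases h2 with h2 | h2
    · rw [h1, h2, zero_mul, mul_zero]
    · exact absurd (Z.inj (sub_eq_zero.1 h2)) h

end UnitRoots

/-! ### The model of the induced module -/

/-- The words of content `μ`. -/
abbrev Orb {r n : ℕ} (μ : RComp r n) : Type := {χ : Fin n → Fin r // HasContent μ χ}

/-- Exchange two neighbouring letters of a word. -/
def Orb.swp {r n : ℕ} {μ : RComp r n} (χ : Orb μ) (i : Fin (n - 1)) : Orb μ :=
  ⟨χ.1 ∘ sw i, χ.2.comp_perm _⟩

namespace Orb

variable {r n : ℕ} {μ : RComp r n} (χ : Orb μ) (i : Fin (n - 1))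

theorem swp_apply (j : Fin n) : (χ.swp i).1 j = χ.1 (sw i j) := rfl

theorem swp_lo : (χ.swp i).1 (lo i) = χ.1 (hi i) := by
  rw [swp_apply, Equiv.swap_apply_left]

theorem swp_hi : (χ.swp i).1 (hi i) = χ.1 (lo i) := by
  rw [swp_apply, Equiv.swap_apply_right]

theorem swp_of_ne {j : Fin n} (h₁ : (j : ℕ) ≠ i) (h₂ : (j : ℕ) ≠ i + 1) :
    (χ.swp i).1 j = χ.1 j := by
  rw [swp_apply, sw_of_ne h₁ h₂]

theorem swp_swp : (χ.swp i).swp i = χ := by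
  apply Subtype.ext
  funext j
  simp [swp_apply]

theorem swp_comm {i j : Fin (n - 1)} (h : (i : ℕ) + 2 ≤ j ∨ (j : ℕ) + 2 ≤ i) :
    (χ.swp i).swp j = (χ.swp j).swp i := by
  apply Subtype.ext
  funext l
  simp only [swp_apply]
  refine congrArg χ.1 (Fin.ext ?_)
  simp only [val_sw]
  split_ifs <;> omega

theorem swp_braid {i j : Fin (n - 1)} (h : (j : ℕ) = i + 1) :
    ((χ.swp i).swp j).swp i = ((χ.swp j).swp i).swp j := by
  apply Subtype.ext
  funext l
  simp only [swp_apply]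
  refine congrArg χ.1 ?_
  have hl : lo j = hi i := Fin.ext h
  have hpt : lo i ≠ hi j := fun h' => by have := congrArg Fin.val h'; simp at this; omega
  have h1 := Equiv.swap_mul_swap_mul_swap (lo_ne_hi i) hpt
  have h2 := Equiv.swap_mul_swap_mul_swap (hl ▸ (lo_ne_hi j).symm) hpt.symm
  rw [Equiv.swap_comm (hi i) (lo i), Equiv.swap_comm (hi j) (hi i), Equiv.swap_comm (lo i) (hi j),
    ← h1] at h2
  have := Equiv.congr_fun h2 l
  rw [sw, sw, hl]
  exact this

variable {χ i}

theorem rank_swp_sw (h : χ.1 (lo i) ≠ χ.1 (hi i)) (j : Fin n) :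
    rank (χ.swp i).1 (sw i j) = rank χ.1 j := rank_comp_sw h j

theorem rank_swp_lo (h : χ.1 (lo i) ≠ χ.1 (hi i)) :
    rank (χ.swp i).1 (lo i) = rank χ.1 (hi i) := by
  rw [← rank_swp_sw h, Equiv.swap_apply_right]

theorem rank_swp_hi (h : χ.1 (lo i) ≠ χ.1 (hi i)) :
    rank (χ.swp i).1 (hi i) = rank χ.1 (lo i) := by
  rw [← rank_swp_sw h, Equiv.swap_apply_left]

theorem rank_swp_of_ne (h : χ.1 (lo i) ≠ χ.1 (hi i)) {j : Fin n} (h₁ : (j : ℕ) ≠ i)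
    (h₂ : (j : ℕ) ≠ i + 1) : rank (χ.swp i).1 j = rank χ.1 j := by
  rw [← rank_swp_sw h, sw_of_ne h₁ h₂]

end Orb

namespace HeckeFamily

variable {K : Type u} [Field K] {q : Kˣ} {r n : ℕ} {μ : RComp r n} {N : Type*}
  [AddCommGroup N] [Module K N] (H : HeckeFamily q μ N) (Z : UnitRoots K r) (hn : 0 < n)

/-- `g_i` acts by a Hecke operator where the two letters agree and exchanges them otherwise. The
index of the Hecke operator is the rank of the letter, its position among the equal letters. -/
def opG (i : Fin (n - 1)) : Module.End K (Orb μ → N) :=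
  LinearMap.pi fun χ =>
    if χ.1 (lo i) = χ.1 (hi i) then
      H.T (χ.1 (lo i)) (rank χ.1 (lo i)) ∘ₗ LinearMap.proj χ
    else LinearMap.proj (χ.swp i)

variable (N) in
/-- `t_j` acts diagonally, through the `j`-th letter of each word. -/
def opT (μ : RComp r n) (j : Fin n) : Module.End K (Orb μ → N) :=
  LinearMap.pi fun χ => Z.z (χ.1 j) • LinearMap.proj χ

/-- `X_1` acts as the first `Y` of the Hecke algebra of the first letter. -/
def opX : Module.End K (Orb μ → N) :=
  LinearMap.pi fun χ => H.Y (χ.1 ⟨0, hn⟩) 0 ∘ₗ LinearMap.proj χ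

/-- The inverse of `opX`. -/
def opXinv : Module.End K (Orb μ → N) :=
  LinearMap.pi fun χ => H.Yinv (χ.1 ⟨0, hn⟩) 0 ∘ₗ LinearMap.proj χ

theorem opG_eq {i : Fin (n - 1)} {χ : Orb μ} (h : χ.1 (lo i) = χ.1 (hi i)) (f : Orb μ → N) :
    H.opG i f χ = H.T (χ.1 (lo i)) (rank χ.1 (lo i)) (f χ) := by
  simp [opG, h]

theorem opG_ne {i : Fin (n - 1)} {χ : Orb μ} (h : χ.1 (lo i) ≠ χ.1 (hi i)) (f : Orb μ → N) :
    H.opG i f χ = f (χ.swp i) := by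
  simp [opG, h]

theorem opT_apply (j : Fin n) (χ : Orb μ) (f : Orb μ → N) :
    opT N Z μ j f χ = Z.z (χ.1 j) • f χ := by
  simp [opT]

theorem opX_apply (χ : Orb μ) (f : Orb μ → N) :
    H.opX hn f χ = H.Y (χ.1 ⟨0, hn⟩) 0 (f χ) := by
  simp [opX]

theorem opXinv_apply (χ : Orb μ) (f : Orb μ → N) :
    H.opXinv hn f χ = H.Yinv (χ.1 ⟨0, hn⟩) 0 (f χ) := by
  simp [opXinv]

theorem opT_pow_apply (j : Fin n) (s : ℕ) (χ : Orb μ) (f : Orb μ → N) :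
    (opT N Z μ j ^ s) f χ = Z.z (χ.1 j) ^ s • f χ := by
  induction s with
  | zero => simp
  | succ s ih => rw [pow_succ', Module.End.mul_apply, opT_apply, ih, smul_smul, pow_succ']

/-- `e_i` projects onto the words whose letters `i` and `i + 1` agree. -/
theorem opE_apply (i : Fin (n - 1)) (χ : Orb μ) (f : Orb μ → N) :
    ((r : K)⁻¹ • ∑ s ∈ Finset.range r, opT N Z μ (lo i) ^ s * opT N Z μ (hi i) ^ (r - s)) f χ =
      if χ.1 (lo i) = χ.1 (hi i) then f χ else 0 := by
  rw [LinearMap.smul_apply, Pi.smul_apply, LinearMap.sum_apply, Finset.sum_apply]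
  simp only [Module.End.mul_apply, opT_pow_apply, smul_smul]
  rw [← Finset.sum_smul, smul_smul, Z.sum_eq]
  split_ifs <;> simp

theorem mul_apply_comm {A B : Module.End K N} (h : Commute A B) (x : N) : A (B x) = B (A x) :=
  LinearMap.congr_fun h.eq x

theorem opG_comm {i j : Fin (n - 1)} (h : (i : ℕ) + 2 ≤ j) :
    H.opG i * H.opG j = H.opG j * H.opG i := by
  refine LinearMap.ext fun f => funext fun χ => ?_
  simp only [Module.End.mul_apply]
  by_cases hi' : χ.1 (lo i) = χ.1 (hi i) <;> by_cases hj : χ.1 (lo j) = χ.1 (hi j)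
  · rw [opG_eq H hi', opG_eq H hj, opG_eq H hj, opG_eq H hi']
    refine mul_apply_comm ?_ _
    by_cases hk : χ.1 (lo i) = χ.1 (lo j)
    · rw [hk]
      refine H.commute_T_T (Or.inl ?_)
      have h1 := rank_hi hi'
      have h2 : rank χ.1 (hi i) < rank χ.1 (lo j) :=
        rank_lt_rank (Fin.lt_def.2 (by simp; omega)) (hi'.symm.trans hk)
      omega
    · exact H.commute_T_T_of_ne hk _ _
  · have h1 : (χ.swp j).1 (lo i) = χ.1 (lo i) := χ.swp_of_ne _ (by simp; omega) (by simp; omega)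
    have h2 : (χ.swp j).1 (hi i) = χ.1 (hi i) := χ.swp_of_ne _ (by simp; omega) (by simp; omega)
    have h3 : rank (χ.swp j).1 (lo i) = rank χ.1 (lo i) :=
      Orb.rank_swp_of_ne hj (by simp; omega) (by simp; omega)
    rw [opG_eq H hi', opG_ne H hj, opG_ne H hj, opG_eq H (by rw [h1, h2, hi']), h1, h3]
  · have h1 : (χ.swp i).1 (lo j) = χ.1 (lo j) := χ.swp_of_ne _ (by simp; omega) (by simp; omega)
    have h2 : (χ.swp i).1 (hi j) = χ.1 (hi j) := χ.swp_of_ne _ (by simp; omega) (by simp; omega)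
    have h3 : rank (χ.swp i).1 (lo j) = rank χ.1 (lo j) :=
      Orb.rank_swp_of_ne hi' (by simp; omega) (by simp; omega)
    rw [opG_ne H hi', opG_eq H (by rw [h1, h2, hj]), opG_eq H hj, opG_ne H hi', h1, h3]
  · have h1 : (χ.swp i).1 (lo j) = χ.1 (lo j) := χ.swp_of_ne _ (by simp; omega) (by simp; omega)
    have h2 : (χ.swp i).1 (hi j) = χ.1 (hi j) := χ.swp_of_ne _ (by simp; omega) (by simp; omega)
    have h1' : (χ.swp j).1 (lo i) = χ.1 (lo i) := χ.swp_of_ne _ (by simp; omega) (by simp; omega)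
    have h2' : (χ.swp j).1 (hi i) = χ.1 (hi i) := χ.swp_of_ne _ (by simp; omega) (by simp; omega)
    rw [opG_ne H hi', opG_ne H (by rwa [h1, h2]), opG_ne H hj, opG_ne H (by rwa [h1', h2']),
      Orb.swp_comm _ (Or.inl h)]

/-- The braid relation depends on which of the three letters `i, i+1, i+2` agree: it is the one of
the Hecke algebra if all do, the one of the symmetric group if no two do, and an identity between
single Hecke operators if exactly two do. -/
theorem opG_braid {i j : Fin (n - 1)} (h : (j : ℕ) = i + 1) :
    H.opG i * H.opG j * H.opG i = H.opG j * H.opG i * H.opG j := by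
  have hl : lo j = hi i := Fin.ext h
  refine LinearMap.ext fun f => funext fun χ => ?_
  simp only [Module.End.mul_apply]
  have a1 (χ : Orb μ) : (χ.swp i).1 (lo i) = χ.1 (hi i) := χ.swp_lo i
  have a2 (χ : Orb μ) : (χ.swp i).1 (hi i) = χ.1 (lo i) := χ.swp_hi i
  have a3 (χ : Orb μ) : (χ.swp i).1 (hi j) = χ.1 (hi j) :=
    χ.swp_of_ne _ (by simp; omega) (by simp; omega)
  have b1 (χ : Orb μ) : (χ.swp j).1 (lo i) = χ.1 (lo i) :=
    χ.swp_of_ne _ (by simp; omega) (by simp; omega)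
  have b2 (χ : Orb μ) : (χ.swp j).1 (hi i) = χ.1 (hi j) := by rw [← hl]; exact χ.swp_lo j
  have b3 (χ : Orb μ) : (χ.swp j).1 (hi j) = χ.1 (hi i) := by rw [← hl]; exact χ.swp_hi j
  have gie (χ : Orb μ) (F : Orb μ → N) (hχ : χ.1 (lo i) = χ.1 (hi i)) :
    H.opG i F χ = H.T (χ.1 (lo i)) (rank χ.1 (lo i)) (F χ) := opG_eq H hχ F
  have gin (χ : Orb μ) (F : Orb μ → N) (hχ : χ.1 (lo i) ≠ χ.1 (hi i)) :
    H.opG i F χ = F (χ.swp i) := opG_ne H hχ F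
  have gje (χ : Orb μ) (F : Orb μ → N) (hχ : χ.1 (hi i) = χ.1 (hi j)) :
    H.opG j F χ = H.T (χ.1 (hi i)) (rank χ.1 (hi i)) (F χ) := by
    rw [opG_eq H (by rwa [hl]), hl]
  have gjn (χ : Orb μ) (F : Orb μ → N) (hχ : χ.1 (hi i) ≠ χ.1 (hi j)) :
    H.opG j F χ = F (χ.swp j) := opG_ne H (by rwa [hl]) F
  have ra1 (χ : Orb μ) (hχ : χ.1 (lo i) ≠ χ.1 (hi i)) :
    rank (χ.swp i).1 (lo i) = rank χ.1 (hi i) := Orb.rank_swp_lo hχ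
  have ra2 (χ : Orb μ) (hχ : χ.1 (lo i) ≠ χ.1 (hi i)) :
    rank (χ.swp i).1 (hi i) = rank χ.1 (lo i) := Orb.rank_swp_hi hχ
  have rb1 (χ : Orb μ) (hχ : χ.1 (hi i) ≠ χ.1 (hi j)) :
    rank (χ.swp j).1 (lo i) = rank χ.1 (lo i) :=
    Orb.rank_swp_of_ne (by rwa [hl]) (by simp; omega) (by simp; omega)
  have rb2 (χ : Orb μ) (hχ : χ.1 (hi i) ≠ χ.1 (hi j)) :
    rank (χ.swp j).1 (hi i) = rank χ.1 (hi j) := by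
    rw [← hl]; exact Orb.rank_swp_lo (by rwa [hl])
  by_cases h01 : χ.1 (lo i) = χ.1 (hi i)
  · by_cases h12 : χ.1 (hi i) = χ.1 (hi j)
    · rw [gie _ _ h01, gje _ _ h12, gie _ _ h01, gje _ _ h12, gie _ _ h01, gje _ _ h12, ← h01,
        rank_hi h01]
      refine LinearMap.congr_fun (H.T_braid (k := χ.1 (lo i)) (p := rank χ.1 (lo i)) ?_) (f χ)
      have := χ.2.rank_lo_lt (i := j) (by rwa [hl])
      rw [hl, rank_hi h01, ← h01] at this
      exact this
    · have hs : (χ.swp j).1 (lo i) ≠ (χ.swp j).1 (hi i) := by rw [b1, b2, h01]; exact h12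
      rw [gie _ _ h01, gjn _ _ h12, gin _ _ hs, gjn _ _ h12, gin _ _ hs,
        gje _ _ (by rw [a2, a3, b1, b3, h01]), a2, b1, ra2 _ hs, rb1 _ h12]
  · by_cases h12 : χ.1 (hi i) = χ.1 (hi j)
    · have hs : (χ.swp i).1 (hi i) ≠ (χ.swp i).1 (hi j) := by rw [a2, a3, ← h12]; exact h01
      rw [gin _ _ h01, gjn _ _ hs, gie _ _ (by rw [b1, b2, a1, a3, h12]), gje _ _ h12,
        gin _ _ h01, gjn _ _ hs, b1, a1, rb1 _ hs, ra1 _ h01]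
    · by_cases h02 : χ.1 (lo i) = χ.1 (hi j)
      · rw [gin _ _ h01, gje _ _ (by rw [a2, a3, h02]), gin _ _ (by rw [a1, a2]; exact Ne.symm h01),
          gjn _ _ h12, gie _ _ (by rw [b1, b2, h02]),
          gjn _ _ (by rw [b2, b3]; exact Ne.symm h12), Orb.swp_swp, Orb.swp_swp, a2, b1,
          ra2 _ h01, rb1 _ h12]
      · rw [gin _ _ h01, gjn _ _ (by rwa [a2, a3]), gin _ _ (by rwa [b1, b2, a1, a3]),
          gjn _ _ h12, gin _ _ (by rwa [b1, b2]), gjn _ _ (by rwa [a2, a3, b1, b3]),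
          Orb.swp_braid _ h]

/-- The action of the generators on the model. -/
def opGen : YGen n → Module.End K (Orb μ → N)
  | .t j => opT N Z μ j
  | .g i => H.opG i
  | .X => H.opX hn
  | .Xinv => H.opXinv hn

theorem opGen_rel ⦃x y : FreeAlgebra K (YGen n)⦄ (h : YRel K r n q x y) :
    FreeAlgebra.lift K (H.opGen Z hn) x = FreeAlgebra.lift K (H.opGen Z hn) y := by
  cases h with
  | g_comm i j h =>
    simp only [map_mul, FreeAlgebra.lift_ι_apply, opGen]
    rcases h with h | h
    · exact H.opG_comm h
    · exact (H.opG_comm h).symm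
  | g_braid i j h =>
    simp only [map_mul, FreeAlgebra.lift_ι_apply, opGen]
    exact H.opG_braid h
  | t_comm i j =>
    simp only [map_mul, FreeAlgebra.lift_ι_apply, opGen]
    refine LinearMap.ext fun f => funext fun χ => ?_
    simp only [Module.End.mul_apply, opT_apply]
    exact smul_comm _ _ _
  | g_t i j =>
    simp only [map_mul, FreeAlgebra.lift_ι_apply, opGen]
    refine LinearMap.ext fun f => funext fun χ => ?_
    simp only [Module.End.mul_apply, opT_apply]
    by_cases hi' : χ.1 (lo i) = χ.1 (hi i)
    · rw [opG_eq H hi', opG_eq H hi', opT_apply, map_smul]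
      congr 2
      by_cases h1 : j = lo i
      · rw [h1, Equiv.swap_apply_left, hi']
      · by_cases h2 : j = hi i
        · rw [h2, Equiv.swap_apply_right, hi']
        · rw [Equiv.swap_apply_of_ne_of_ne h1 h2]
    · rw [opG_ne H hi', opG_ne H hi', opT_apply, Orb.swp_apply]
  | t_pow j =>
    simp only [map_pow, map_one, FreeAlgebra.lift_ι_apply, opGen]
    refine LinearMap.ext fun f => funext fun χ => ?_
    rw [opT_pow_apply, Z.pow, one_smul, Module.End.one_apply]
  | g_sq i =>
    simp only [fE, map_pow, map_one, map_add, map_smul, map_sum, map_mul, FreeAlgebra.lift_ι_apply,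
      opGen, sq]
    refine LinearMap.ext fun f => funext fun χ => ?_
    rw [Module.End.mul_apply, LinearMap.add_apply, LinearMap.smul_apply (_ - _), Pi.add_apply,
      Pi.smul_apply, Module.End.mul_apply, opE_apply, Module.End.one_apply]
    split_ifs with hi'
    · rw [opG_eq H hi', opG_eq H hi']
      have := LinearMap.congr_fun (H.T_sq (χ.2.rank_lo_lt hi')) (f χ)
      simpa using this
    · rw [opG_ne H hi', opG_ne H (by rw [χ.swp_lo, χ.swp_hi]; exact Ne.symm hi'), χ.swp_swp]
      simp
  | X_Xinv =>
    simp only [map_mul, map_one, FreeAlgebra.lift_ι_apply, opGen]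
    refine LinearMap.ext fun f => funext fun χ => ?_
    rw [Module.End.mul_apply, opX_apply, opXinv_apply]
    have := χ.2.rank_lt ⟨0, hn⟩
    rw [rank_zero] at this
    exact LinearMap.congr_fun (H.Y_mul_Yinv this) (f χ)
  | Xinv_X =>
    simp only [map_mul, map_one, FreeAlgebra.lift_ι_apply, opGen]
    refine LinearMap.ext fun f => funext fun χ => ?_
    rw [Module.End.mul_apply, opXinv_apply, opX_apply]
    have := χ.2.rank_lt ⟨0, hn⟩
    rw [rank_zero] at this
    exact LinearMap.congr_fun (H.Yinv_mul_Y this) (f χ)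
  | g_X_g_X i h =>
    simp only [map_mul, FreeAlgebra.lift_ι_apply, opGen]
    refine LinearMap.ext fun f => funext fun χ => ?_
    have h0 : (⟨0, hn⟩ : Fin n) = lo i := Fin.ext h.symm
    simp only [Module.End.mul_apply]
    by_cases hi' : χ.1 (lo i) = χ.1 (hi i)
    · have hr : rank χ.1 (lo i) = 0 := by rw [← h0, rank_zero]
      have hlt := χ.2.rank_lo_lt hi'
      simp only [opX_apply, opG_eq H hi', h0, hr] at hlt ⊢
      have hY := H.T_Y_T hlt
      have hc := H.commute_Y_Y (χ.1 (lo i)) (χ.1 (lo i)) (0 + 1) 0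
      rw [← hY] at hc
      exact LinearMap.congr_fun hc.eq (f χ)
    · have hi2 : (χ.swp i).1 (lo i) ≠ (χ.swp i).1 (hi i) := by
        rw [χ.swp_lo, χ.swp_hi]; exact Ne.symm hi'
      simp only [opX_apply, opG_ne H hi', opG_ne H hi2, χ.swp_swp, h0, χ.swp_lo]
      exact mul_apply_comm (H.commute_Y_Y _ _ _ _) _
  | g_X i h =>
    simp only [map_mul, FreeAlgebra.lift_ι_apply, opGen]
    refine LinearMap.ext fun f => funext fun χ => ?_
    simp only [Module.End.mul_apply, opX_apply]
    by_cases hi' : χ.1 (lo i) = χ.1 (hi i)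
    · rw [opG_eq H hi', opG_eq H hi', opX_apply]
      refine mul_apply_comm ?_ _
      by_cases hk : χ.1 (lo i) = χ.1 ⟨0, hn⟩
      · have hr := rank_lt_rank (χ := χ.1) (j := ⟨0, hn⟩) (l := lo i)
          (Fin.lt_def.2 (by simp; omega)) hk.symm
        rw [rank_zero] at hr
        rw [hk]
        exact H.commute_T_Y (by omega) (by omega)
      · exact H.commute_T_Y_of_ne hk _ _
    · rw [opG_ne H hi', opG_ne H hi', opX_apply, χ.swp_of_ne i (by simp; omega) (by simp)]
  | t_X j =>
    simp only [map_mul, FreeAlgebra.lift_ι_apply, opGen]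
    refine LinearMap.ext fun f => funext fun χ => ?_
    simp only [Module.End.mul_apply, opT_apply, opX_apply, map_smul]

/-- The action of the affine Yokonuma-Hecke algebra on the functions from the words of content `μ`
to a module over the tensor product of the affine Hecke algebras. -/
def toEnd : Yhat K r n q →ₐ[K] Module.End K (Orb μ → N) := Yhat.lift _ (H.opGen_rel Z hn)

theorem toEnd_t (j : Fin n) : H.toEnd Z hn (Yhat.t j) = opT N Z μ j := by
  rw [Yhat.t, toEnd, Yhat.lift_mk, FreeAlgebra.lift_ι_apply]; rfl

theorem toEnd_g (i : Fin (n - 1)) : H.toEnd Z hn (Yhat.g i) = H.opG i := by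
  rw [Yhat.g, toEnd, Yhat.lift_mk, FreeAlgebra.lift_ι_apply]; rfl

theorem toEnd_X1 : H.toEnd Z hn Yhat.X1v = H.opX hn := by
  rw [Yhat.X1v, Yhat.X1, toEnd, Yhat.lift_mk, FreeAlgebra.lift_ι_apply]; rfl

/-- On the model, `X_j` acts at the word `χ` as the `Y` of the letter and rank of `j`. -/
theorem toEnd_X (j : Fin n) (f : Orb μ → N) (χ : Orb μ) :
    H.toEnd Z hn (Yhat.Xv j) f χ = H.Y (χ.1 j) (rank χ.1 j) (f χ) := by
  induction j using Yhat.pos_induction generalizing f χ with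
  | h0 h0 => rw [Yhat.X_zero, toEnd_X1, opX_apply, rank_zero]
  | hs i ih =>
    rw [Yhat.X_hi, map_mul, map_mul, toEnd_g, Module.End.mul_apply, Module.End.mul_apply]
    by_cases hi' : χ.1 (lo i) = χ.1 (hi i)
    · rw [opG_eq H hi', ih, opG_eq H hi', rank_hi hi', ← hi', ← H.T_Y_T (χ.2.rank_lo_lt hi')]
      rfl
    · rw [opG_ne H hi', ih, opG_ne H (by rw [χ.swp_lo, χ.swp_hi]; exact Ne.symm hi'), χ.swp_swp,
        χ.swp_lo, Orb.rank_swp_lo hi']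

end HeckeFamily

/-! ### Weight spaces -/

section Weight

variable {K : Type u} [Field K] {q : Kˣ} {r n : ℕ} (Z : UnitRoots K r)
  {M : Type*} [AddCommGroup M] [Module K M] [Module (Yhat K r n q) M]
  [IsScalarTower K (Yhat K r n q) M]

variable (q M) in
/-- The vectors on which each `t_j` acts by the root of unity with index `χ_j`. -/
def wt (χ : Fin n → Fin r) : Submodule K M where
  carrier := {x | ∀ j, (Yhat.t j : Yhat K r n q) • x = Z.z (χ j) • x}
  add_mem' hx hy j := by rw [smul_add, hx j, hy j, smul_add]
  zero_mem' j := by rw [smul_zero, smul_zero]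
  smul_mem' c x hx j := by rw [smul_comm, hx j, smul_comm]

variable {Z}

theorem mem_wt {χ : Fin n → Fin r} {x : M} :
    x ∈ wt q Z M χ ↔ ∀ j, (Yhat.t j : Yhat K r n q) • x = Z.z (χ j) • x := Iff.rfl

theorem g_smul_mem_wt {χ : Fin n → Fin r} {x : M} (hx : x ∈ wt q Z M χ) (i : Fin (n - 1)) :
    (Yhat.g i : Yhat K r n q) • x ∈ wt q Z M (χ ∘ sw i) := by
  intro j
  rw [← mul_smul, Yhat.t_g, mul_smul, hx, smul_comm]
  rfl

theorem smul_mem_wt_of_commute {χ : Fin n → Fin r} {x : M} (hx : x ∈ wt q Z M χ)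
    {a : Yhat K r n q} (ha : ∀ j, Commute (Yhat.t j) a) : a • x ∈ wt q Z M χ := by
  intro j
  rw [← mul_smul, (ha j).eq, mul_smul, hx, smul_comm]

theorem X_smul_mem_wt {χ : Fin n → Fin r} {x : M} (hx : x ∈ wt q Z M χ) (j : Fin n) :
    (Yhat.Xv j : Yhat K r n q) • x ∈ wt q Z M χ :=
  smul_mem_wt_of_commute hx fun l => Yhat.commute_t_X l j

theorem t_pow_smul {χ : Fin n → Fin r} {x : M} (hx : x ∈ wt q Z M χ) (j : Fin n) (s : ℕ) :
    (Yhat.t j : Yhat K r n q) ^ s • x = Z.z (χ j) ^ s • x := by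
  induction s with
  | zero => simp
  | succ s ih => rw [pow_succ, mul_smul, hx, smul_comm, ih, smul_smul, pow_succ']

theorem e_smul {χ : Fin n → Fin r} {x : M} (hx : x ∈ wt q Z M χ) (i : Fin (n - 1)) :
    (Yhat.e i : Yhat K r n q) • x = if χ (lo i) = χ (hi i) then x else 0 := by
  have h : (Yhat.e i : Yhat K r n q) • x =
      ((r : K)⁻¹ * ∑ s ∈ Finset.range r, Z.z (χ (lo i)) ^ s * Z.z (χ (hi i)) ^ (r - s)) • x := by
    rw [Yhat.e_eq, smul_assoc, Finset.sum_smul, mul_smul, Finset.sum_smul]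
    congr 1
    refine Finset.sum_congr rfl fun s _ => ?_
    rw [mul_smul, t_pow_smul hx, smul_comm, t_pow_smul hx, smul_smul, mul_comm]
  rw [h, Z.sum_eq]
  split_ifs <;> simp

theorem g_g_smul_of_ne {χ : Fin n → Fin r} {x : M} (hx : x ∈ wt q Z M χ) {i : Fin (n - 1)}
    (h : χ (lo i) ≠ χ (hi i)) :
    (Yhat.g i : Yhat K r n q) • (Yhat.g i : Yhat K r n q) • x = x := by
  rw [← mul_smul, Yhat.g_sq, ← Yhat.g_mul_e, add_smul, one_smul, smul_assoc, mul_smul,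
    e_smul hx, if_neg h, smul_zero, smul_zero, add_zero]

theorem g_g_smul_of_eq {χ : Fin n → Fin r} {x : M} (hx : x ∈ wt q Z M χ) {i : Fin (n - 1)}
    (h : χ (lo i) = χ (hi i)) :
    (Yhat.g i : Yhat K r n q) • (Yhat.g i : Yhat K r n q) • x =
      x + ((q : K) - (q : K)⁻¹) • (Yhat.g i : Yhat K r n q) • x := by
  rw [← mul_smul, Yhat.g_sq, ← Yhat.g_mul_e, add_smul, one_smul, smul_assoc, mul_smul,
    e_smul hx, if_pos h]

theorem X_g_smul {χ : Fin n → Fin r} {x : M} (hx : x ∈ wt q Z M χ) {i : Fin (n - 1)}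
    (h : χ (lo i) ≠ χ (hi i)) (j : Fin n) :
    (Yhat.Xv j : Yhat K r n q) • (Yhat.g i : Yhat K r n q) • x =
      (Yhat.g i : Yhat K r n q) • (Yhat.Xv (sw i j) : Yhat K r n q) • x := by
  by_cases h1 : j = lo i
  · subst h1
    have hy : (Yhat.Xv (lo i) : Yhat K r n q) • (Yhat.g i : Yhat K r n q) • x ∈
        wt q Z M (χ ∘ sw i) := X_smul_mem_wt (g_smul_mem_wt hx i) _
    rw [Equiv.swap_apply_left, Yhat.X_hi, mul_smul, mul_smul, g_g_smul_of_ne hy]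
    simp only [Function.comp_apply, Equiv.swap_apply_left, Equiv.swap_apply_right]
    exact h.symm
  · by_cases h2 : j = hi i
    · subst h2
      rw [Equiv.swap_apply_right, Yhat.X_hi, mul_smul, mul_smul, g_g_smul_of_ne hx h]
    · rw [Equiv.swap_apply_of_ne_of_ne h1 h2, ← mul_smul, ← (Yhat.commute_g_X h1 h2).eq, mul_smul]

end Weight

/-! ### Sorting elements -/

section Sorting

variable {K : Type u} [Field K] {q : Kˣ} {r n : ℕ}

open Classical in
variable (K q) in
/-- A product of `g`'s that carries the weight space of the sorted word to that of `χ`: the product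
along a chain of descents leading from `χ` to the sorted word. -/
def sorter (χ : Fin n → Fin r) : Yhat K r n q :=
  if h : ∃ i : Fin (n - 1), χ (hi i) < χ (lo i) then
    Yhat.g h.choose * sorter (χ ∘ sw h.choose)
  else 1
termination_by height χ
decreasing_by exact height_comp_sw h.choose_spec

theorem sorter_of_monotone {χ : Fin n → Fin r} (h : Monotone χ) : sorter K q χ = 1 := by
  rw [sorter, dif_neg]
  rintro ⟨i, hi'⟩
  exact absurd (h (lo_lt_hi i).le) (not_le.2 hi')

/-- Any descent may be removed first: neighbouring descents are compared by the braid relation. -/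
theorem sorter_eq {χ : Fin n → Fin r} {i : Fin (n - 1)} (h : χ (hi i) < χ (lo i)) :
    sorter K q χ = Yhat.g i * sorter K q (χ ∘ sw i) := by
  induction hN : height χ using Nat.strong_induction_on generalizing χ i with
  | _ N ih =>
    subst hN
    have ih' : ∀ {χ' : Fin n → Fin r} {l : Fin (n - 1)}, height χ' < height χ →
        χ' (hi l) < χ' (lo l) → sorter K q χ' = Yhat.g l * sorter K q (χ' ∘ sw l) :=
      fun h1 h2 => ih _ h1 h2 rfl
    clear ih
    have far : ∀ i j : Fin (n - 1), χ (hi i) < χ (lo i) → χ (hi j) < χ (lo j) →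
        (i : ℕ) + 2 ≤ j → (Yhat.g i * sorter K q (χ ∘ sw i) : Yhat K r n q) =
          Yhat.g j * sorter K q (χ ∘ sw j) := by
      intro i j hi' hj h
      have e1 : sw i (lo j) = lo j := sw_of_ne (by simp; omega) (by simp; omega)
      have e2 : sw i (hi j) = hi j := sw_of_ne (by simp; omega) (by simp; omega)
      have e3 : sw j (lo i) = lo i := sw_of_ne (by simp; omega) (by simp; omega)
      have e4 : sw j (hi i) = hi i := sw_of_ne (by simp; omega) (by simp; omega)
      have hc : (χ ∘ sw i) ∘ sw j = (χ ∘ sw j) ∘ sw i := by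
        have := Orb.swp_comm ⟨χ, hasContent_content χ⟩ (Or.inl h)
        exact congrArg Subtype.val this
      rw [ih' (l := j) (height_comp_sw hi') (by simpa [e1, e2] using hj),
        ih' (l := i) (height_comp_sw hj) (by simpa [e3, e4] using hi'), hc, ← mul_assoc,
        ← mul_assoc, (Yhat.commute_g_g (Or.inl h)).eq]
    have near : ∀ i j : Fin (n - 1), χ (hi i) < χ (lo i) → χ (hi j) < χ (lo j) →
        (j : ℕ) = i + 1 → (Yhat.g i * sorter K q (χ ∘ sw i) : Yhat K r n q) =
          Yhat.g j * sorter K q (χ ∘ sw j) := by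
      intro i j hi' hj h
      have hl : lo j = hi i := Fin.ext h
      have a1 : sw i (hi i) = lo i := Equiv.swap_apply_right _ _
      have a2 : sw i (lo i) = hi i := Equiv.swap_apply_left _ _
      have a3 : sw i (hi j) = hi j := sw_of_ne (by simp; omega) (by simp; omega)
      have b1 : sw j (hi j) = hi i := by rw [← hl]; exact Equiv.swap_apply_right _ _
      have b2 : sw j (hi i) = hi j := by rw [← hl]; exact Equiv.swap_apply_left _ _
      have b3 : sw j (lo i) = lo i := sw_of_ne (by simp; omega) (by simp; omega)
      have hc : ((χ ∘ sw i) ∘ sw j) ∘ sw i = ((χ ∘ sw j) ∘ sw i) ∘ sw j :=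
        congrArg Subtype.val (Orb.swp_braid ⟨χ, hasContent_content χ⟩ h)
      rw [hl] at hj
      have c1 : (χ ∘ sw i) (hi j) < (χ ∘ sw i) (lo j) := by
        simp only [Function.comp_apply, hl, a1, a3]; exact hj.trans hi'
      have c2 : ((χ ∘ sw i) ∘ sw j) (hi i) < ((χ ∘ sw i) ∘ sw j) (lo i) := by
        simp only [Function.comp_apply, b2, b3, a2, a3]; exact hj
      have d1 : (χ ∘ sw j) (hi i) < (χ ∘ sw j) (lo i) := by
        simp only [Function.comp_apply, b2, b3]; exact hj.trans hi'
      have d2 : ((χ ∘ sw j) ∘ sw i) (hi j) < ((χ ∘ sw j) ∘ sw i) (lo j) := by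
        simp only [Function.comp_apply, hl, a1, a3, b1, b3]; exact hi'
      have hj' : χ (hi j) < χ (lo j) := by rwa [hl]
      rw [ih' (l := j) (height_comp_sw hi') c1,
        ih' (l := i) ((height_comp_sw c1).trans (height_comp_sw hi')) c2,
        ih' (l := i) (height_comp_sw hj') d1,
        ih' (l := j) ((height_comp_sw d1).trans (height_comp_sw hj')) d2, hc]
      simp only [← mul_assoc]
      rw [Yhat.g_braid h]
    have hex : ∃ i : Fin (n - 1), χ (hi i) < χ (lo i) := ⟨i, h⟩
    rw [sorter, dif_pos hex]
    have hj := hex.choose_spec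
    generalize hex.choose = j at hj
    rcases lt_trichotomy (i : ℕ) j with hij | hij | hij
    · rcases Nat.lt_or_ge ((i : ℕ) + 1) j with h' | h'
      · exact (far i j h hj h').symm
      · exact (near i j h hj (by omega)).symm
    · rw [show i = j from Fin.ext hij]
    · rcases Nat.lt_or_ge ((j : ℕ) + 1) i with h' | h'
      · exact far j i hj h h'
      · exact near j i hj h (by omega)

end Sorting

/-! ### The universal property of the model -/

instance {r n : ℕ} (μ : RComp r n) : Fintype (Orb μ) := Fintype.ofFinite _

/-- The sorted word as a word of content `μ`. -/
def RComp.sortedOrb {r n : ℕ} (μ : RComp r n) : Orb μ := ⟨μ.sorted, μ.hasContent_sorted⟩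

section Compat

variable {K : Type u} [Field K] {q : Kˣ} {r n : ℕ} {μ : RComp r n} {N : Type*}
  [AddCommGroup N] [Module K N]
  {M : Type*} [AddCommGroup M] [Module K M] [Module (Yhat K r n q) M]
  [IsScalarTower K (Yhat K r n q) M]

/-- A linear map into a module over the affine Yokonuma-Hecke algebra is compatible with the Hecke
actions when it lands in the weight space of the sorted word and carries the Hecke generators to
the generators of the parabolic subalgebra. -/
structure IsCompat (Z : UnitRoots K r) (H : HeckeFamily q μ N) (f : N →ₗ[K] M) : Prop where
  mem_wt : ∀ x, f x ∈ wt q Z M μ.sorted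
  g_smul : ∀ k (p : Fin (μ.1 k - 1)) x,
    (Yhat.g (μ.transp k p) : Yhat K r n q) • f x = f (H.T k p x)
  X_smul : ∀ k (p : Fin (μ.1 k)) x,
    (Yhat.Xv (μ.pos k p) : Yhat K r n q) • f x = f (H.Y k p x)

namespace IsCompat

variable {Z : UnitRoots K r} {H : HeckeFamily q μ N} {f : N →ₗ[K] M} (hf : IsCompat Z H f)

include hf

theorem sorter_smul_mem (χ : Orb μ) (x : N) : sorter K q χ.1 • f x ∈ wt q Z M χ.1 := by
  obtain ⟨χ, hχ⟩ := χ
  induction χ using sort_induction with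
  | h0 χ h =>
    have := μ.eq_sorted hχ h
    subst this
    simp only [sorter_of_monotone h, one_smul]
    exact hf.mem_wt x
  | hs χ i h ih =>
    have := g_smul_mem_wt (ih (hχ.comp_perm _)) i
    simp only [sorter_eq h, mul_smul]
    convert! this using 2
    funext j
    simp

theorem X_smul_sorter (χ : Orb μ) (j : Fin n) (x : N) :
    (Yhat.Xv j : Yhat K r n q) • sorter K q χ.1 • f x =
      sorter K q χ.1 • f (H.Y (χ.1 j) (rank χ.1 j) x) := by
  obtain ⟨χ, hχ⟩ := χ
  induction χ using sort_induction generalizing j with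
  | h0 χ h =>
    simp only [sorter_of_monotone h, one_smul]
    rw [μ.eq_sorted hχ h]
    conv_lhs => rw [μ.eq_pos_rank j]
    exact hf.X_smul _ _ _
  | hs χ i h ih =>
    have hχ' := hχ.comp_perm (sw i)
    have hy := hf.sorter_smul_mem ⟨_, hχ'⟩ x
    simp only [sorter_eq h, mul_smul]
    rw [X_g_smul hy (by simpa using h.ne), ih (hχ := hχ'), rank_comp_sw h.ne']
    simp

/-- The stabiliser of the word acts through the Hecke operators. A generator next to a descent is
moved past the two transpositions that bring its letters to the other side of the descent, by the
braid relation. -/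
theorem g_smul_sorter_of_eq (χ : Orb μ) {i : Fin (n - 1)} (h : χ.1 (lo i) = χ.1 (hi i)) (x : N) :
    (Yhat.g i : Yhat K r n q) • sorter K q χ.1 • f x =
      sorter K q χ.1 • f (H.T (χ.1 (lo i)) (rank χ.1 (lo i)) x) := by
  induction hN : height χ.1 using Nat.strong_induction_on generalizing χ i with
  | _ N ih =>
    subst hN
    have ih' : ∀ {χ' : Orb μ} {l : Fin (n - 1)}, height χ'.1 < height χ.1 →
        χ'.1 (lo l) = χ'.1 (hi l) → (Yhat.g l : Yhat K r n q) • sorter K q χ'.1 • f x =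
          sorter K q χ'.1 • f (H.T (χ'.1 (lo l)) (rank χ'.1 (lo l)) x) :=
      fun h1 h2 => ih _ h1 _ h2 rfl
    clear ih
    by_cases hd : ∃ j : Fin (n - 1), χ.1 (hi j) < χ.1 (lo j)
    · obtain ⟨j, hj⟩ := hd
      have hlt : height (χ.swp j).1 < height χ.1 := height_comp_sw hj
      have hs : sorter K q χ.1 = Yhat.g j * sorter K q (χ.swp j).1 := sorter_eq hj
      have hij : (i : ℕ) ≠ j := by
        intro h'
        rw [Fin.ext h'] at h
        exact hj.ne' h
      by_cases hfar : (i : ℕ) + 2 ≤ j ∨ (j : ℕ) + 2 ≤ i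
      · have e1 : (χ.swp j).1 (lo i) = χ.1 (lo i) :=
          χ.swp_of_ne _ (by simp; omega) (by simp; omega)
        have e2 : (χ.swp j).1 (hi i) = χ.1 (hi i) :=
          χ.swp_of_ne _ (by simp; omega) (by simp; omega)
        have e3 : rank (χ.swp j).1 (lo i) = rank χ.1 (lo i) :=
          Orb.rank_swp_of_ne hj.ne' (by simp; omega) (by simp; omega)
        rw [hs, mul_smul, mul_smul, ← mul_smul, (Yhat.commute_g_g hfar).eq, mul_smul,
          ih' hlt (by rw [e1, e2, h]), e1, e3]
      · rcases Nat.lt_or_ge (i : ℕ) j with hlt' | hlt'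
        · have hji : (j : ℕ) = i + 1 := by omega
          have hl : lo j = hi i := Fin.ext hji
          have e1 : (χ.swp j).1 (lo i) = χ.1 (lo i) :=
            χ.swp_of_ne _ (by simp; omega) (by simp; omega)
          have e2 : (χ.swp j).1 (hi i) = χ.1 (hi j) := by rw [← hl, χ.swp_lo]
          have e3 : (χ.swp j).1 (hi j) = χ.1 (hi i) := by rw [← hl, χ.swp_hi]
          have e4 : rank (χ.swp j).1 (lo i) = rank χ.1 (lo i) :=
            Orb.rank_swp_of_ne hj.ne' (by simp; omega) (by simp; omega)
          have hd2 : (χ.swp j).1 (hi i) < (χ.swp j).1 (lo i) := by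
            rw [e1, e2, h, ← hl]; exact hj
          have hlt2 : height ((χ.swp j).swp i).1 < height χ.1 := (height_comp_sw hd2).trans hlt
          have hs2 : sorter K q (χ.swp j).1 = Yhat.g i * sorter K q ((χ.swp j).swp i).1 :=
            sorter_eq hd2
          have f1 : ((χ.swp j).swp i).1 (lo j) = χ.1 (lo i) := by rw [hl, Orb.swp_hi, e1]
          have f2 : ((χ.swp j).swp i).1 (hi j) = χ.1 (lo i) := by
            rw [Orb.swp_of_ne _ _ (by simp; omega) (by simp; omega), e3, h]
          have f3 : rank ((χ.swp j).swp i).1 (lo j) = rank χ.1 (lo i) := by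
            rw [hl, Orb.rank_swp_hi hd2.ne', e4]
          have := ih' (l := j) hlt2 (by rw [f1, f2])
          rw [f1, f3] at this
          rw [hs, hs2]
          simp only [mul_smul]
          rw [← this]
          simp only [← mul_smul, ← mul_assoc]
          rw [Yhat.g_braid hji]
        · have hji : (i : ℕ) = j + 1 := by omega
          have hl : lo i = hi j := Fin.ext hji
          have e1 : (χ.swp j).1 (lo j) = χ.1 (lo i) := by rw [hl, χ.swp_lo]
          have e2 : (χ.swp j).1 (lo i) = χ.1 (lo j) := by rw [hl, χ.swp_hi]
          have e3 : (χ.swp j).1 (hi i) = χ.1 (hi i) :=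
            χ.swp_of_ne _ (by simp; omega) (by simp; omega)
          have e4 : rank (χ.swp j).1 (lo j) = rank χ.1 (lo i) := by
            rw [hl, Orb.rank_swp_lo hj.ne']
          have hd2 : (χ.swp j).1 (hi i) < (χ.swp j).1 (lo i) := by
            rw [e2, e3, ← h, hl]; exact hj
          have hlt2 : height ((χ.swp j).swp i).1 < height χ.1 := (height_comp_sw hd2).trans hlt
          have hs2 : sorter K q (χ.swp j).1 = Yhat.g i * sorter K q ((χ.swp j).swp i).1 :=
            sorter_eq hd2
          have f1 : ((χ.swp j).swp i).1 (lo j) = χ.1 (lo i) := by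
            rw [Orb.swp_of_ne _ _ (by simp; omega) (by simp; omega), e1]
          have f2 : ((χ.swp j).swp i).1 (hi j) = χ.1 (lo i) := by
            rw [← hl, Orb.swp_lo, e3, h]
          have f3 : rank ((χ.swp j).swp i).1 (lo j) = rank χ.1 (lo i) := by
            rw [Orb.rank_swp_of_ne hd2.ne' (by simp; omega) (by simp; omega), e4]
          have := ih' (l := j) hlt2 (by rw [f1, f2])
          rw [f1, f3] at this
          rw [hs, hs2]
          simp only [mul_smul]
          rw [← this]
          simp only [← mul_smul, ← mul_assoc]
          rw [Yhat.g_braid hji]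
    · push Not at hd
      have hm := monotone_of_no_descent hd
      simp only [sorter_of_monotone hm, one_smul]
      rw [μ.eq_sorted χ.2 hm] at h ⊢
      conv_lhs => rw [μ.eq_transp_rank h]
      exact hf.g_smul _ _ _

theorem g_smul_sorter_of_ne (χ : Orb μ) {i : Fin (n - 1)} (h : χ.1 (lo i) ≠ χ.1 (hi i)) (x : N) :
    (Yhat.g i : Yhat K r n q) • sorter K q χ.1 • f x = sorter K q (χ.swp i).1 • f x := by
  rcases lt_or_gt_of_ne h with h' | h'
  · have h2 : (χ.swp i).1 (hi i) < (χ.swp i).1 (lo i) := by rwa [χ.swp_lo, χ.swp_hi]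
    have h3 := sorter_eq (K := K) (q := q) h2
    rw [show (χ.swp i).1 ∘ sw i = χ.1 from congrArg Subtype.val (χ.swp_swp i)] at h3
    rw [h3, mul_smul]
  · have h3 : sorter K q χ.1 = Yhat.g i * sorter K q (χ.swp i).1 := sorter_eq h'
    rw [h3, mul_smul, g_g_smul_of_ne (hf.sorter_smul_mem _ x)]
    rw [χ.swp_lo, χ.swp_hi]
    exact h.symm

end IsCompat

end Compat

/-! ### The model as a module -/

/-- The functions from the words of content `μ` to `N`, as a module over the affine
Yokonuma-Hecke algebra. It turns out to be the module induced from `N`. -/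
def FMod {K : Type u} [Field K] {q : Kˣ} {r n : ℕ} {μ : RComp r n} {N : Type*}
    [AddCommGroup N] [Module K N] (_Z : UnitRoots K r) (_hn : 0 < n) (_H : HeckeFamily q μ N) :
    Type _ := Orb μ → N

namespace FMod

variable {K : Type u} [Field K] {q : Kˣ} {r n : ℕ} {μ : RComp r n} {N : Type*}
  [AddCommGroup N] [Module K N] (Z : UnitRoots K r) (hn : 0 < n) (H : HeckeFamily q μ N)

instance : AddCommGroup (FMod Z hn H) := inferInstanceAs (AddCommGroup (Orb μ → N))

instance : Module K (FMod Z hn H) := inferInstanceAs (Module K (Orb μ → N))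

instance : Module (Yhat K r n q) (FMod Z hn H) :=
  Module.compHom (Orb μ → N) (H.toEnd Z hn).toRingHom

instance : IsScalarTower K (Yhat K r n q) (FMod Z hn H) :=
  ⟨fun c a x => LinearMap.congr_fun (map_smul (H.toEnd Z hn) c a) x⟩

/-- Evaluation at a word. -/
def ev (χ : Orb μ) : FMod Z hn H →ₗ[K] N := LinearMap.proj (φ := fun _ : Orb μ => N) χ

/-- The functions supported at one word. -/
def single (χ : Orb μ) : N →ₗ[K] FMod Z hn H := LinearMap.single K (fun _ : Orb μ => N) χ

variable {Z hn H}

theorem ext {f f' : FMod Z hn H} (h : ∀ χ, ev Z hn H χ f = ev Z hn H χ f') : f = f' :=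
  funext h

theorem ev_single_same (χ : Orb μ) (x : N) : ev Z hn H χ (single Z hn H χ x) = x :=
  Pi.single_eq_same (M := fun _ : Orb μ => N) χ x

theorem ev_single_of_ne {χ χ' : Orb μ} (h : χ' ≠ χ) (x : N) :
    ev Z hn H χ' (single Z hn H χ x) = 0 :=
  Pi.single_eq_of_ne (M := fun _ : Orb μ => N) h x

theorem sum_single (f : FMod Z hn H) : ∑ χ, single Z hn H χ (ev Z hn H χ f) = f :=
  Finset.univ_sum_single (M := fun _ : Orb μ => N) f

theorem smul_def (a : Yhat K r n q) (f : FMod Z hn H) :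
    (a • f : FMod Z hn H) = H.toEnd Z hn a f := rfl

theorem ev_g_of_eq {i : Fin (n - 1)} {χ : Orb μ} (h : χ.1 (lo i) = χ.1 (hi i))
    (f : FMod Z hn H) : ev Z hn H χ ((Yhat.g i : Yhat K r n q) • f) =
      H.T (χ.1 (lo i)) (rank χ.1 (lo i)) (ev Z hn H χ f) := by
  rw [smul_def, H.toEnd_g]
  exact H.opG_eq h f

theorem ev_g_of_ne {i : Fin (n - 1)} {χ : Orb μ} (h : χ.1 (lo i) ≠ χ.1 (hi i))
    (f : FMod Z hn H) : ev Z hn H χ ((Yhat.g i : Yhat K r n q) • f) = ev Z hn H (χ.swp i) f := by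
  rw [smul_def, H.toEnd_g]
  exact H.opG_ne h f

theorem ev_t (j : Fin n) (χ : Orb μ) (f : FMod Z hn H) :
    ev Z hn H χ ((Yhat.t j : Yhat K r n q) • f) = Z.z (χ.1 j) • ev Z hn H χ f := by
  rw [smul_def, H.toEnd_t]
  exact HeckeFamily.opT_apply Z j χ f

theorem ev_X (j : Fin n) (χ : Orb μ) (f : FMod Z hn H) :
    ev Z hn H χ ((Yhat.Xv j : Yhat K r n q) • f) =
      H.Y (χ.1 j) (rank χ.1 j) (ev Z hn H χ f) :=
  H.toEnd_X Z hn j f χ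

theorem eq_single {χ : Orb μ} {f : FMod Z hn H} (h : ∀ χ', χ' ≠ χ → ev Z hn H χ' f = 0) :
    f = single Z hn H χ (ev Z hn H χ f) := by
  refine ext fun χ' => ?_
  by_cases h' : χ' = χ
  · rw [h', ev_single_same]
  · rw [h χ' h', ev_single_of_ne h']

theorem single_mem_wt (χ : Orb μ) (x : N) :
    single Z hn H χ x ∈ wt q Z (FMod Z hn H) χ.1 := by
  intro j
  refine ext fun χ' => ?_
  rw [ev_t, map_smul]
  by_cases h : χ' = χ
  · rw [h]
  · rw [ev_single_of_ne h, smul_zero, smul_zero]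

/-- The weight of a function determines its support. -/
theorem ev_eq_zero_of_mem_wt {χ : Fin n → Fin r} {f : FMod Z hn H}
    (hf : f ∈ wt q Z (FMod Z hn H) χ) {χ' : Orb μ} (h : χ'.1 ≠ χ) : ev Z hn H χ' f = 0 := by
  obtain ⟨j, hj⟩ := Function.ne_iff.1 h
  have h1 := congrArg (ev Z hn H χ') (hf j)
  rw [ev_t, map_smul, ← sub_eq_zero, ← sub_smul, smul_eq_zero] at h1
  exact h1.resolve_left fun h2 => hj (Z.inj (sub_eq_zero.1 h2))

theorem hasContent_of_mem_wt {χ : Fin n → Fin r} {f : FMod Z hn H}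
    (hf : f ∈ wt q Z (FMod Z hn H) χ) (h0 : f ≠ 0) : HasContent μ χ := by
  by_contra h
  refine h0 (ext fun χ' => ?_)
  rw [map_zero]
  exact ev_eq_zero_of_mem_wt hf fun h' => h (h' ▸ χ'.2)

theorem eq_single_of_mem_wt {χ : Orb μ} {f : FMod Z hn H}
    (hf : f ∈ wt q Z (FMod Z hn H) χ.1) : f = single Z hn H χ (ev Z hn H χ f) :=
  eq_single fun _ h => ev_eq_zero_of_mem_wt hf fun h' => h (Subtype.ext h')

variable (Z hn H) in
/-- The inclusion of `N` as the functions supported at the sorted word. -/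
def incl : N →ₗ[K] FMod Z hn H := single Z hn H μ.sortedOrb

theorem incl_isCompat : IsCompat Z H (incl Z hn H) where
  mem_wt x := single_mem_wt μ.sortedOrb x
  g_smul k p x := by
    have h0 : μ.sortedOrb.1 (lo (μ.transp k p)) = k := by
      rw [μ.lo_transp]; exact μ.sorted_pos _ _
    have h1 : μ.sortedOrb.1 (hi (μ.transp k p)) = k := by
      rw [μ.hi_transp]; exact μ.sorted_pos _ _
    have h2 : rank μ.sortedOrb.1 (lo (μ.transp k p)) = p := by
      rw [μ.lo_transp]; exact μ.rank_sorted_pos _ _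
    have hw := g_smul_mem_wt (single_mem_wt (Z := Z) (hn := hn) (H := H) μ.sortedOrb x)
      (μ.transp k p)
    have hc : μ.sortedOrb.1 ∘ sw (μ.transp k p) = μ.sortedOrb.1 := by
      funext j
      by_cases h3 : j = lo (μ.transp k p)
      · rw [h3, Function.comp_apply, Equiv.swap_apply_left, h0, h1]
      · by_cases h4 : j = hi (μ.transp k p)
        · rw [h4, Function.comp_apply, Equiv.swap_apply_right, h0, h1]
        · rw [Function.comp_apply, Equiv.swap_apply_of_ne_of_ne h3 h4]
    rw [hc] at hw
    rw [incl, eq_single_of_mem_wt hw, ev_g_of_eq (h0.trans h1.symm), ev_single_same, h2, h0]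
  X_smul k p x := by
    have hw := X_smul_mem_wt (single_mem_wt (Z := Z) (hn := hn) (H := H) μ.sortedOrb x) (μ.pos k p)
    rw [incl, eq_single_of_mem_wt hw, ev_X, ev_single_same]
    congr 2
    · congr 1
      · exact μ.sorted_pos _ _
      · exact μ.rank_sorted_pos _ _

/-- The model is generated by the functions supported at the sorted word. -/
theorem sorter_smul_incl (χ : Orb μ) (x : N) :
    sorter K q χ.1 • incl Z hn H x = single Z hn H χ x := by
  obtain ⟨χ, hχ⟩ := χ
  induction χ using sort_induction with
  | h0 χ h =>
    have := μ.eq_sorted hχ h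
    subst this
    simp only [sorter_of_monotone h, one_smul]
    rfl
  | hs χ i h ih =>
    have hχ' := hχ.comp_perm (sw i)
    simp only [sorter_eq h, mul_smul, ih hχ']
    refine ext fun χ' => ?_
    have hw := g_smul_mem_wt (single_mem_wt (Z := Z) (hn := hn) (H := H) ⟨_, hχ'⟩ x) i
    have hc : (⟨χ ∘ sw i, hχ'⟩ : Orb μ).1 ∘ sw i = χ := by funext j; simp
    rw [hc] at hw
    by_cases h' : χ' = ⟨χ, hχ⟩
    · subst h'
      rw [ev_g_of_ne h.ne', ev_single_same]
      exact ev_single_same _ _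
    · rw [ev_single_of_ne h', ev_eq_zero_of_mem_wt hw fun h'' => h' (Subtype.ext h'')]

variable {M : Type*} [AddCommGroup M] [Module K M] [Module (Yhat K r n q) M]
  [IsScalarTower K (Yhat K r n q) M] {f : N →ₗ[K] M}

variable (Z hn H f) in
/-- The linear map underlying the extension of a compatible map. -/
def extendₗ : FMod Z hn H →ₗ[K] M :=
  ∑ χ, Algebra.lsmul K K M (sorter K q χ.1) ∘ₗ f ∘ₗ ev Z hn H χ

theorem extendₗ_apply (F : FMod Z hn H) :
    extendₗ Z hn H f F = ∑ χ : Orb μ, sorter K q χ.1 • f (ev Z hn H χ F) := by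
  simp [extendₗ]

/-- Linearity holds because the sorting elements intertwine the generators with the Hecke
operators in the same way as the model does. -/
theorem extendₗ_smul (hf : IsCompat Z H f) (a : Yhat K r n q) (F : FMod Z hn H) :
    extendₗ Z hn H f (a • F) = a • extendₗ Z hn H f F := by
  have hX (F : FMod Z hn H) : extendₗ Z hn H f ((Yhat.X1v : Yhat K r n q) • F) =
      (Yhat.X1v : Yhat K r n q) • extendₗ Z hn H f F := by
    rw [extendₗ_apply, extendₗ_apply, Finset.smul_sum, ← Yhat.X_zero hn]
    refine Finset.sum_congr rfl fun χ _ => ?_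
    rw [ev_X, hf.X_smul_sorter]
  induction a using Yhat.induction generalizing F with
  | halg c => rw [algebraMap_smul, algebraMap_smul, map_smul]
  | ht j =>
    rw [extendₗ_apply, extendₗ_apply, Finset.smul_sum]
    refine Finset.sum_congr rfl fun χ _ => ?_
    rw [ev_t, hf.sorter_smul_mem, map_smul, smul_comm]
  | hg i =>
    -- `g_i` sends the summand of `χ` to that of the word with letters `i, i + 1` exchanged
    let σ : Equiv.Perm (Orb μ) := Function.Involutive.toPerm (fun χ => χ.swp i) fun χ => χ.swp_swp i
    rw [extendₗ_apply, extendₗ_apply, Finset.smul_sum, ← Equiv.sum_comp σ]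
    refine Finset.sum_congr rfl fun χ _ => ?_
    change sorter K q (χ.swp i).1 • f (ev Z hn H (χ.swp i) _) = _
    by_cases h : χ.1 (lo i) = χ.1 (hi i)
    · have hc : χ.swp i = χ := by
        apply Subtype.ext
        funext j
        by_cases h1 : j = lo i
        · rw [h1, χ.swp_lo, h]
        · by_cases h2 : j = hi i
          · rw [h2, χ.swp_hi, h]
          · rw [Orb.swp_apply, Equiv.swap_apply_of_ne_of_ne h1 h2]
      rw [hc, ev_g_of_eq h, hf.g_smul_sorter_of_eq χ h]
    · rw [hf.g_smul_sorter_of_ne χ h, ev_g_of_ne (by rw [χ.swp_lo, χ.swp_hi]; exact Ne.symm h),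
        χ.swp_swp]
  | hX => exact hX F
  | hXi =>
    rw [← one_smul (Yhat K r n q) (extendₗ Z hn H f _), ← Units.inv_mul Yhat.X1, mul_smul, ← hX,
      ← mul_smul, Units.mul_inv, one_smul]
  | hadd a b ha hb => rw [add_smul, add_smul, map_add, ha, hb]
  | hmul a b ha hb => rw [mul_smul, mul_smul, ha, hb]

variable (Z hn H f) in
/-- The extension of a compatible map to the model. -/
def extend (hf : IsCompat Z H f) : FMod Z hn H →ₗ[Yhat K r n q] M :=
  { extendₗ Z hn H f with map_smul' := fun a F => extendₗ_smul hf a F }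

theorem extend_incl (hf : IsCompat Z H f) (x : N) :
    extend Z hn H f hf (incl Z hn H x) = f x := by
  change extendₗ Z hn H f _ = _
  rw [extendₗ_apply, Finset.sum_eq_single μ.sortedOrb]
  · rw [incl, ev_single_same, RComp.sortedOrb, sorter_of_monotone μ.monotone_sorted, one_smul]
  · intro χ _ h
    rw [incl, ev_single_of_ne h, map_zero, smul_zero]
  · intro h
    exact absurd (Finset.mem_univ _) h

theorem hom_ext {M : Type*} [AddCommGroup M] [Module (Yhat K r n q) M]
    {A B : FMod Z hn H →ₗ[Yhat K r n q] M}
    (h : ∀ x, A (incl Z hn H x) = B (incl Z hn H x)) : A = B := by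
  ext F
  rw [← sum_single F, map_sum, map_sum]
  refine Finset.sum_congr rfl fun χ _ => ?_
  rw [← sorter_smul_incl, map_smul, map_smul, h]

theorem incl_injective : Function.Injective (incl Z hn H) := fun x y h => by
  rw [← ev_single_same (Z := Z) (hn := hn) (H := H) μ.sortedOrb x,
    ← ev_single_same (Z := Z) (hn := hn) (H := H) μ.sortedOrb y]
  exact congrArg _ h

theorem mem_wt_sorted_iff {F : FMod Z hn H} :
    F ∈ wt q Z (FMod Z hn H) μ.sorted ↔ ∃ x, incl Z hn H x = F :=
  ⟨fun h => ⟨_, (eq_single_of_mem_wt (χ := μ.sortedOrb) h).symm⟩,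
    fun ⟨x, hx⟩ => hx ▸ single_mem_wt μ.sortedOrb x⟩

end FMod

namespace HeckeFamily

variable {K : Type u} [Field K] {q : Kˣ} {r n : ℕ} {μ : RComp r n} {N : Type*}
  [AddCommGroup N] [Module K N] (H : HeckeFamily q μ N)

/-- The operators by which the generators of the parabolic subalgebra act. -/
def parGen (Z : UnitRoots K r) : PGen μ → Module.End K N
  | .t k _ => Z.z k • 1
  | .g k p => H.T k p
  | .X k p => H.Y k p
  | .Xinv k p => H.Yinv k p

variable {H} {M : Type*} [AddCommGroup M] [Module K M] [Module (Yhat K r n q) M]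
  [IsScalarTower K (Yhat K r n q) M] {Z : UnitRoots K r} {f : N →ₗ[K] M}

theorem _root_.AffineYokonuma.IsCompat.Xinv_smul (hf : IsCompat Z H f) (k : Fin r)
    (p : Fin (μ.1 k)) (x : N) :
    (((Yhat.X (μ.pos k p))⁻¹ : (Yhat K r n q)ˣ) : Yhat K r n q) • f x = f (H.Yinv k p x) := by
  have h := hf.X_smul k p (H.Yinv k p x)
  rw [show H.Y k p (H.Yinv k p x) = x from LinearMap.congr_fun (H.Y_mul_Yinv p.2) x] at h
  rw [← h, ← mul_smul, Units.inv_mul, one_smul]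

theorem _root_.AffineYokonuma.IsCompat.parGen_smul (hf : IsCompat Z H f) (y : PGen μ) (x : N) :
    y.val K q • f x = f (H.parGen Z y x) := by
  cases y with
  | t k p =>
    have := hf.mem_wt x (μ.pos k p)
    rw [μ.sorted_pos] at this
    simpa [PGen.val, parGen] using this
  | g k p => exact hf.g_smul k p x
  | X k p => exact hf.X_smul k p x
  | Xinv k p => exact hf.Xinv_smul k p x

theorem isCompat_of_parGen (h : ∀ (y : PGen μ) (x : N), y.val K q • f x = f (H.parGen Z y x)) :
    IsCompat Z H f where
  mem_wt x j := by
    obtain ⟨k, p, rfl⟩ := μ.exists_pos j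
    simpa [PGen.val, parGen] using h (.t k p) x
  g_smul k p x := h (.g k p) x
  X_smul k p x := h (.X k p) x

/-- An action of the parabolic subalgebra is the one given by a Hecke family. -/
def IsParAct (Z : UnitRoots K r) (H : HeckeFamily q μ N)
    (ρ : Ypar K q μ →ₐ[K] Module.End K N) : Prop :=
  ∀ y : PGen μ, ρ (y.toPar K q) = H.parGen Z y

theorem IsParAct.smul {ρ : Ypar K q μ →ₐ[K] Module.End K N} (hρ : IsParAct Z H ρ)
    (hf : IsCompat Z H f) (a : Ypar K q μ) (x : N) : (a : Yhat K r n q) • f x = f (ρ a x) := by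
  obtain ⟨a, ha⟩ := a
  induction ha using Algebra.adjoin_induction generalizing x with
  | mem a ha =>
    obtain ⟨y, rfl⟩ := ha
    have := hρ y
    simp only [PGen.toPar] at this
    rw [this]
    exact hf.parGen_smul y x
  | algebraMap c =>
    have : (⟨algebraMap K _ c, Subalgebra.algebraMap_mem _ c⟩ : Ypar K q μ) =
      algebraMap K _ c := rfl
    rw [this, AlgHom.commutes, Module.algebraMap_end_apply, map_smul]
    exact algebraMap_smul _ _ _
  | add a b ha hb iha ihb =>
    have : (⟨a + b, Subalgebra.add_mem _ ha hb⟩ : Ypar K q μ) = ⟨a, ha⟩ + ⟨b, hb⟩ := rfl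
    simp only [this, map_add, LinearMap.add_apply, ← iha, ← ihb, add_smul]
  | mul a b ha hb iha ihb =>
    have : (⟨a * b, Subalgebra.mul_mem _ ha hb⟩ : Ypar K q μ) = ⟨a, ha⟩ * ⟨b, hb⟩ := rfl
    simp only [this, map_mul, Module.End.mul_apply, ← iha, ← ihb, mul_smul]

theorem exists_smul_incl (hn : 0 < n) (a : Ypar K q μ) (x : N) :
    ∃ y, (a : Yhat K r n q) • FMod.incl Z hn H x = FMod.incl Z hn H y := by
  obtain ⟨a, ha⟩ := a
  induction ha using Algebra.adjoin_induction generalizing x with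
  | mem a ha =>
    obtain ⟨y, rfl⟩ := ha
    exact ⟨_, FMod.incl_isCompat.parGen_smul y x⟩
  | algebraMap c => exact ⟨c • x, by rw [algebraMap_smul, map_smul]⟩
  | add a b ha hb iha ihb =>
    obtain ⟨y, hy⟩ := iha x
    obtain ⟨z, hz⟩ := ihb x
    exact ⟨y + z, by rw [map_add, ← hy, ← hz]; exact add_smul _ _ _⟩
  | mul a b ha hb iha ihb =>
    obtain ⟨y, hy⟩ := ihb x
    obtain ⟨z, hz⟩ := iha y
    exact ⟨z, by rw [← hz, ← hy]; exact mul_smul _ _ _⟩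

variable (Z H) in
/-- The action of the parabolic subalgebra given by a Hecke family, read off from the functions
supported at the sorted word in the model. -/
def parAct (hn : 0 < n) : Ypar K q μ →ₐ[K] Module.End K N :=
  AlgHom.ofLinearMap
    { toFun := fun a => FMod.ev Z hn H μ.sortedOrb ∘ₗ
        Algebra.lsmul K K (FMod Z hn H) (a : Yhat K r n q) ∘ₗ FMod.incl Z hn H
      map_add' := fun a b => by ext x; simp
      map_smul' := fun c a => by ext x; simp }
    (by ext x; simp [FMod.incl, FMod.ev_single_same])
    (fun a b => by
      ext x
      obtain ⟨y, hy⟩ := exists_smul_incl (Z := Z) (H := H) hn b x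
      simp only [LinearMap.coe_mk, AddHom.coe_mk, LinearMap.comp_apply, Algebra.lsmul_coe,
        MulMemClass.coe_mul, mul_smul, hy, Module.End.mul_apply]
      rw [FMod.incl, FMod.ev_single_same])

theorem incl_parAct (hn : 0 < n) (a : Ypar K q μ) (x : N) :
    FMod.incl Z hn H (H.parAct Z hn a x) = (a : Yhat K r n q) • FMod.incl Z hn H x := by
  obtain ⟨y, hy⟩ := exists_smul_incl (Z := Z) (H := H) hn a x
  have : H.parAct Z hn a x = FMod.ev Z hn H μ.sortedOrb ((a : Yhat K r n q) • FMod.incl Z hn H x) :=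
    rfl
  rw [this, hy]
  congr 1
  exact FMod.ev_single_same _ _

theorem isParAct_parAct (hn : 0 < n) : IsParAct Z H (H.parAct Z hn) := by
  intro y
  ext x
  apply FMod.incl_injective (Z := Z) (hn := hn) (H := H)
  rw [incl_parAct]
  exact FMod.incl_isCompat.parGen_smul y x

theorem IsParAct.unique {ρ ρ' : Ypar K q μ →ₐ[K] Module.End K N} (h : IsParAct Z H ρ)
    (h' : IsParAct Z H ρ') : ρ = ρ' := by
  refine AlgHom.adjoin_ext ?_
  rintro _ ⟨y, rfl⟩
  exact (h y).trans (h' y).symm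

/-! ### The induced module -/

/-- The canonical map from the inducing module to the induced module. -/
def toInd (ρ : Ypar K q μ →ₐ[K] Module.End K N) :
    N →ₗ[K] Ind (K := K) (B := Yhat K r n q) ρ :=
  ((indRel ρ).mkQ.restrictScalars K) ∘ₗ TensorProduct.mk K (Yhat K r n q) N 1

theorem smul_toInd (ρ : Ypar K q μ →ₐ[K] Module.End K N) (a : Ypar K q μ) (x : N) :
    (a : Yhat K r n q) • toInd ρ x = toInd ρ (ρ a x) := by
  change (indRel ρ).mkQ ((a : Yhat K r n q) • ((1 : Yhat K r n q) ⊗ₜ[K] x)) =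
    (indRel ρ).mkQ ((1 : Yhat K r n q) ⊗ₜ[K] ρ a x)
  rw [← sub_eq_zero, ← map_sub, Submodule.mkQ_apply, Submodule.Quotient.mk_eq_zero]
  refine Submodule.subset_span ⟨1, a, x, ?_⟩
  rw [TensorProduct.smul_tmul', smul_eq_mul, mul_one, one_mul]

theorem toInd_isCompat {ρ : Ypar K q μ →ₐ[K] Module.End K N} (hρ : IsParAct Z H ρ) :
    IsCompat Z H (toInd ρ) :=
  isCompat_of_parGen fun y x => by
    rw [← hρ y]
    exact smul_toInd ρ (y.toPar K q) x

/-- The map from the induced module to the model. -/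
def indToFMod {ρ : Ypar K q μ →ₐ[K] Module.End K N} (hρ : IsParAct Z H ρ) (hn : 0 < n) :
    Ind (K := K) (B := Yhat K r n q) ρ →ₗ[Yhat K r n q] FMod Z hn H :=
  (indRel ρ).liftQ
    (TensorProduct.AlgebraTensorModule.lift
      (LinearMap.toSpanSingleton (Yhat K r n q) (N →ₗ[K] FMod Z hn H) (FMod.incl Z hn H)))
    (by
      refine Submodule.span_le.2 ?_
      rintro _ ⟨b, a, x, rfl⟩
      simp [mul_smul, hρ.smul FMod.incl_isCompat])

theorem indToFMod_toInd {ρ : Ypar K q μ →ₐ[K] Module.End K N} (hρ : IsParAct Z H ρ) (hn : 0 < n)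
    (x : N) : indToFMod hρ hn (toInd ρ x) = FMod.incl Z hn H x := by
  refine (TensorProduct.AlgebraTensorModule.lift_tmul
    (LinearMap.toSpanSingleton (Yhat K r n q) (N →ₗ[K] FMod Z hn H) (FMod.incl Z hn H))
    (1 : Yhat K r n q) x).trans ?_
  simp

/-- The model is the induced module. -/
def indEquiv {ρ : Ypar K q μ →ₐ[K] Module.End K N} (hρ : IsParAct Z H ρ) (hn : 0 < n) :
    Ind (K := K) (B := Yhat K r n q) ρ ≃ₗ[Yhat K r n q] FMod Z hn H :=
  LinearEquiv.ofLinearMap (indToFMod hρ hn) (FMod.extend Z hn H _ (toInd_isCompat hρ))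
    (FMod.hom_ext fun x => by
      rw [LinearMap.comp_apply, FMod.extend_incl, indToFMod_toInd, LinearMap.id_apply])
    (by
      refine Submodule.linearMap_qext _ ?_
      refine TensorProduct.AlgebraTensorModule.ext fun b x => ?_
      have : (b ⊗ₜ[K] x : Yhat K r n q ⊗[K] N) = b • ((1 : Yhat K r n q) ⊗ₜ[K] x) := by
        rw [TensorProduct.smul_tmul', smul_eq_mul, mul_one]
      rw [this, map_smul, map_smul]
      congr 1
      change FMod.extend Z hn H _ (toInd_isCompat hρ) (indToFMod hρ hn (toInd ρ x)) = toInd ρ x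
      rw [indToFMod_toInd, FMod.extend_incl])

end HeckeFamily

/-! ### Weight vectors in submodules -/

namespace UnitRoots

variable {K : Type u} [Field K] {r : ℕ} (Z : UnitRoots K r)

theorem prod_X_sub_C : ∏ k, (Polynomial.X - Polynomial.C (Z.z k)) =
    (Polynomial.X ^ r - 1 : Polynomial K) := by
  classical
  have hr : r ≠ 0 := fun h => Z.ne (by rw [h, Nat.cast_zero])
  have h1 : (∏ k, (Polynomial.X - Polynomial.C (Z.z k))).Monic :=
    Polynomial.monic_prod_of_monic _ _ fun k _ => Polynomial.monic_X_sub_C _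
  have h2 : (Polynomial.X ^ r - 1 : Polynomial K).Monic := by
    simpa using Polynomial.monic_X_pow_sub_C (1 : K) hr
  have d1 : (∏ k, (Polynomial.X - Polynomial.C (Z.z k))).natDegree = r := by
    rw [Polynomial.natDegree_prod_of_monic _ _ fun k _ => Polynomial.monic_X_sub_C _]
    simp
  have d2 : (Polynomial.X ^ r - 1 : Polynomial K).natDegree = r := by
    simpa using Polynomial.natDegree_X_pow_sub_C (n := r) (r := (1 : K))
  refine Polynomial.eq_of_degree_sub_lt_of_eval_finset_eq (Finset.univ.image Z.z) ?_ ?_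
  · rw [Finset.card_image_of_injective _ Z.inj, Finset.card_univ, Fintype.card_fin]
    have hd : (∏ k, (Polynomial.X - Polynomial.C (Z.z k))).degree =
        (Polynomial.X ^ r - 1 : Polynomial K).degree := by
      rw [Polynomial.degree_eq_natDegree h1.ne_zero, Polynomial.degree_eq_natDegree h2.ne_zero,
        d1, d2]
    have := Polynomial.degree_sub_lt_left hd h1.ne_zero (by rw [h1.leadingCoeff, h2.leadingCoeff])
    rwa [Polynomial.degree_eq_natDegree h1.ne_zero, d1] at this
  · intro x hx
    obtain ⟨k, -, rfl⟩ := Finset.mem_image.1 hx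
    rw [Polynomial.eval_prod, Finset.prod_eq_zero (Finset.mem_univ k) (by simp)]
    simp [Z.pow]

/-- An operator whose `r`-th power is one has an eigenvector in every nonzero invariant
subspace. -/
theorem exists_eigenvector {V : Type*} [AddCommGroup V] [Module K V] (A : Module.End K V)
    (hA : A ^ r = 1) (U : Submodule K V) (hU : ∀ x ∈ U, A x ∈ U) (h0 : ∃ x ∈ U, x ≠ 0) :
    ∃ k, ∃ x ∈ U, x ≠ 0 ∧ A x = Z.z k • x := by
  by_contra hc
  push Not at hc
  obtain ⟨x, hx, hx0⟩ := h0
  have key : ∀ s : Finset (Fin r),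
      Polynomial.aeval A (∏ k ∈ s, (Polynomial.X - Polynomial.C (Z.z k))) x ∈ U ∧
      Polynomial.aeval A (∏ k ∈ s, (Polynomial.X - Polynomial.C (Z.z k))) x ≠ 0 := by
    intro s
    induction s using Finset.induction_on with
    | empty => simpa using ⟨hx, hx0⟩
    | insert k s hk ih =>
      rw [Finset.prod_insert hk, map_mul, Module.End.mul_apply]
      generalize Polynomial.aeval A (∏ k ∈ s, (Polynomial.X - Polynomial.C (Z.z k))) x = y at ih
      have hy : Polynomial.aeval A (Polynomial.X - Polynomial.C (Z.z k)) y = A y - Z.z k • y := by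
        simp
      rw [hy]
      exact ⟨U.sub_mem (hU _ ih.1) (U.smul_mem _ ih.1),
        fun h => hc k y ih.1 ih.2 (sub_eq_zero.1 h)⟩
  refine (key Finset.univ).2 ?_
  rw [Z.prod_X_sub_C]
  simp [hA]

end UnitRoots

section

variable {K : Type u} [Field K] {q : Kˣ} {r n : ℕ} (Z : UnitRoots K r)
  {M : Type*} [AddCommGroup M] [Module K M] [Module (Yhat K r n q) M]
  [IsScalarTower K (Yhat K r n q) M]

/-- Every nonzero submodule contains a nonzero weight vector. -/
theorem exists_mem_wt {W : Submodule (Yhat K r n q) M} (hW : W ≠ ⊥) :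
    ∃ χ : Fin n → Fin r, ∃ x ∈ W, x ≠ 0 ∧ x ∈ wt q Z M χ := by
  -- diagonalize the commuting operators `t_j` one after the other
  have key : ∀ m ≤ n, ∃ χ : Fin n → Fin r, ∃ x ∈ W, x ≠ 0 ∧
      ∀ j : Fin n, (j : ℕ) < m → (Yhat.t j : Yhat K r n q) • x = Z.z (χ j) • x := by
    intro m
    induction m with
    | zero =>
      intro _
      obtain ⟨x, hx, hx0⟩ := (Submodule.ne_bot_iff W).1 hW
      have hr : 0 < r := Nat.pos_of_ne_zero fun h => Z.ne (by rw [h, Nat.cast_zero])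
      exact ⟨fun _ => ⟨0, hr⟩, x, hx, hx0, fun j hj => absurd hj (Nat.not_lt_zero _)⟩
    | succ m ih =>
      intro hm
      obtain ⟨χ, x, hx, hx0, hχ⟩ := ih (by omega)
      let U : Submodule K M :=
        { carrier := {y | y ∈ W ∧ ∀ j : Fin n, (j : ℕ) < m →
            (Yhat.t j : Yhat K r n q) • y = Z.z (χ j) • y}
          add_mem' := fun ha hb => ⟨W.add_mem ha.1 hb.1, fun j hj => by
            rw [smul_add, ha.2 j hj, hb.2 j hj, smul_add]⟩
          zero_mem' := ⟨W.zero_mem, fun j hj => by rw [smul_zero, smul_zero]⟩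
          smul_mem' := fun c y hy => ⟨W.smul_of_tower_mem c hy.1, fun j hj => by
            rw [smul_comm, hy.2 j hj, smul_comm]⟩ }
      obtain ⟨k, y, hy, hy0, hk⟩ := Z.exists_eigenvector
        (Algebra.lsmul K K M (Yhat.t ⟨m, by omega⟩ : Yhat K r n q))
        (by rw [← map_pow, Yhat.t_pow, map_one]) U
        (fun y hy => ⟨W.smul_mem _ hy.1, fun j hj => by
          rw [Algebra.lsmul_coe, ← mul_smul, Yhat.t_comm, mul_smul, hy.2 j hj, smul_comm]⟩)
        ⟨x, ⟨hx, hχ⟩, hx0⟩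
      refine ⟨Function.update χ ⟨m, by omega⟩ k, y, hy.1, hy0, fun j hj => ?_⟩
      by_cases hjm : j = ⟨m, by omega⟩
      · rw [hjm, Function.update_self]
        exact hk
      · rw [Function.update_of_ne hjm]
        exact hy.2 j (by
          have : (j : ℕ) ≠ m := fun h => hjm (Fin.ext h)
          omega)
  obtain ⟨χ, x, hx, hx0, h⟩ := key n le_rfl
  exact ⟨χ, x, hx, hx0, fun j => h j j.2⟩

/-- The invertible `g`'s move a weight vector to the weight of the sorted word. -/
theorem exists_mem_wt_sorted {W : Submodule (Yhat K r n q) M} {μ : RComp r n} {χ : Fin n → Fin r}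
    (hχ : HasContent μ χ) (h : ∃ x ∈ W, x ≠ 0 ∧ x ∈ wt q Z M χ) :
    ∃ x ∈ W, x ≠ 0 ∧ x ∈ wt q Z M μ.sorted := by
  induction χ using sort_induction with
  | h0 χ hm => rwa [← μ.eq_sorted hχ hm]
  | hs χ i hi' ih =>
    refine ih (hχ.comp_perm _) ?_
    obtain ⟨x, hx, hx0, hxw⟩ := h
    refine ⟨(Yhat.g i : Yhat K r n q) • x, W.smul_mem _ hx, fun h => hx0 ?_, g_smul_mem_wt hxw i⟩
    rw [← one_smul (Yhat K r n q) x, ← Units.inv_mul (Yhat.gUnit i), mul_smul]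
    change _ • (Yhat.g i : Yhat K r n q) • x = 0
    rw [h, smul_zero]

end

/-! ### Simple modules -/

namespace HeckeFamily

variable {K : Type u} [Field K] {q : Kˣ} {r n : ℕ} {μ : RComp r n} {N : Type*}
  [AddCommGroup N] [Module K N] (H : HeckeFamily q μ N)

/-- A subspace is invariant under the Hecke actions. -/
def Stable (U : Submodule K N) : Prop := ∀ k a, ∀ x ∈ U, H.φ k a x ∈ U

/-- The space is simple as a module over the tensor product of the affine Hecke algebras. -/
def Irred : Prop := Nontrivial N ∧ ∀ U : Submodule K N, H.Stable U → U = ⊥ ∨ U = ⊤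

variable {H}

theorem stable_of_gen {U : Submodule K N}
    (hT : ∀ k (p : Fin (μ.1 k - 1)), ∀ x ∈ U, H.T k p x ∈ U)
    (hY : ∀ k (p : Fin (μ.1 k)), ∀ x ∈ U, H.Y k p x ∈ U)
    (hYi : ∀ k (p : Fin (μ.1 k)), ∀ x ∈ U, H.Yinv k p x ∈ U) : H.Stable U := by
  intro k a
  induction a using Hhat.induction with
  | halg c =>
    intro x hx
    rw [AlgHom.commutes, Module.algebraMap_end_apply]
    exact U.smul_mem _ hx
  | hT p => intro x hx; rw [← T_fin]; exact hT k p x hx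
  | hY p => intro x hx; rw [← Y_fin]; exact hY k p x hx
  | hYi p => intro x hx; rw [← Yinv_fin]; exact hYi k p x hx
  | hadd a b ha hb =>
    intro x hx
    rw [map_add, LinearMap.add_apply]
    exact U.add_mem (ha x hx) (hb x hx)
  | hmul a b ha hb =>
    intro x hx
    rw [map_mul, Module.End.mul_apply]
    exact ha _ (hb x hx)

theorem Stable.T_mem {U : Submodule K N} (hU : H.Stable U) (k : Fin r) (p : ℕ) {x : N}
    (hx : x ∈ U) : H.T k p x ∈ U := by
  unfold T
  split_ifs
  · exact hU k _ x hx
  · exact U.zero_mem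

theorem Stable.Y_mem {U : Submodule K N} (hU : H.Stable U) (k : Fin r) (p : ℕ) {x : N}
    (hx : x ∈ U) : H.Y k p x ∈ U := by
  unfold Y
  split_ifs
  · exact hU k _ x hx
  · exact U.zero_mem

theorem Stable.Yinv_mem {U : Submodule K N} (hU : H.Stable U) (k : Fin r) (p : ℕ) {x : N}
    (hx : x ∈ U) : H.Yinv k p x ∈ U := by
  unfold Yinv
  split_ifs
  · exact hU k _ x hx
  · exact U.zero_mem

variable {Z : UnitRoots K r} {hn : 0 < n}

/-- A nonzero submodule of the model meets the sorted weight space, which is `N`, in a nonzero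
stable subspace, and `N` generates the model. -/
theorem isSimpleModule_fMod (hH : H.Irred) : IsSimpleModule (Yhat K r n q) (FMod Z hn H) := by
  obtain ⟨hN, hU⟩ := hH
  have : Nontrivial (FMod Z hn H) := (FMod.incl_injective (Z := Z) (hn := hn) (H := H)).nontrivial
  rw [isSimpleModule_iff]
  refine { eq_bot_or_eq_top := fun W => ?_ }
  by_cases hW : W = ⊥
  · exact Or.inl hW
  right
  obtain ⟨χ, x, hx, hx0, hxw⟩ := exists_mem_wt Z hW
  obtain ⟨y, hy, hy0, hyw⟩ := exists_mem_wt_sorted Z (FMod.hasContent_of_mem_wt hxw hx0)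
    ⟨x, hx, hx0, hxw⟩
  obtain ⟨y, rfl⟩ := FMod.mem_wt_sorted_iff.1 hyw
  let U : Submodule K N := (W.restrictScalars K).comap (FMod.incl Z hn H)
  have hc : IsCompat Z H (FMod.incl Z hn H) := FMod.incl_isCompat
  have hst : H.Stable U := by
    refine stable_of_gen ?_ ?_ ?_
    · intro k p x hx
      change FMod.incl Z hn H _ ∈ W
      rw [← hc.g_smul]
      exact W.smul_mem _ hx
    · intro k p x hx
      change FMod.incl Z hn H _ ∈ W
      rw [← hc.X_smul]
      exact W.smul_mem _ hx
    · intro k p x hx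
      change FMod.incl Z hn H _ ∈ W
      rw [← hc.Xinv_smul]
      exact W.smul_mem _ hx
  have hUt : U = ⊤ := by
    refine (hU U hst).resolve_left fun h => hy0 ?_
    have : y ∈ U := hy
    rw [h, Submodule.mem_bot] at this
    rw [this, map_zero]
  rw [eq_top_iff]
  intro F _
  rw [← FMod.sum_single F]
  refine W.sum_mem fun χ _ => ?_
  rw [← FMod.sorter_smul_incl]
  refine W.smul_mem _ ?_
  have : FMod.ev Z hn H χ F ∈ U := hUt ▸ Submodule.mem_top
  exact this

theorem irred_of_isSimpleModule_fMod (hS : IsSimpleModule (Yhat K r n q) (FMod Z hn H)) :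
    H.Irred := by
  have hnt : Nontrivial (FMod Z hn H) := IsSimpleModule.nontrivial (Yhat K r n q) _
  constructor
  · by_contra h
    rw [not_nontrivial_iff_subsingleton] at h
    exact not_subsingleton (FMod Z hn H) ⟨fun a b => FMod.ext fun χ => Subsingleton.elim _ _⟩
  · intro U hU
    -- the functions with values in a stable subspace form a submodule
    let W : Submodule (Yhat K r n q) (FMod Z hn H) :=
      { carrier := {F | ∀ χ, FMod.ev Z hn H χ F ∈ U}
        add_mem' := fun ha hb χ => by rw [map_add]; exact U.add_mem (ha χ) (hb χ)
        zero_mem' := fun χ => by rw [map_zero]; exact U.zero_mem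
        smul_mem' := by
          intro a
          induction a using Yhat.induction with
          | halg c =>
            intro F hF χ
            rw [algebraMap_smul, map_smul]
            exact U.smul_mem _ (hF χ)
          | ht j =>
            intro F hF χ
            rw [FMod.ev_t]
            exact U.smul_mem _ (hF χ)
          | hg i =>
            intro F hF χ
            by_cases h : χ.1 (lo i) = χ.1 (hi i)
            · rw [FMod.ev_g_of_eq h]
              exact hU.T_mem _ _ (hF χ)
            · rw [FMod.ev_g_of_ne h]
              exact hF _
          | hX =>
            intro F hF χ
            rw [← Yhat.X_zero hn, FMod.ev_X]
            exact hU.Y_mem _ _ (hF χ)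
          | hXi =>
            intro F hF χ
            have h1 := FMod.ev_X (Z := Z) (hn := hn) (H := H) ⟨0, hn⟩ χ
              (((Yhat.X1⁻¹ : (Yhat K r n q)ˣ) : Yhat K r n q) • F)
            rw [Yhat.X_zero, ← mul_smul, Units.mul_inv, one_smul] at h1
            have h2 := hU.Yinv_mem (χ.1 ⟨0, hn⟩) (rank χ.1 ⟨0, hn⟩) (hF χ)
            rw [h1] at h2
            rwa [← Module.End.mul_apply, H.Yinv_mul_Y (χ.2.rank_lt _), Module.End.one_apply] at h2
          | hadd a b ha hb =>
            intro F hF χ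
            rw [add_smul, map_add]
            exact U.add_mem (ha hF χ) (hb hF χ)
          | hmul a b ha hb =>
            intro F hF
            rw [mul_smul]
            exact ha (hb hF) }
    rcases hS.eq_bot_or_eq_top W with h | h
    · left
      rw [eq_bot_iff]
      intro x hx
      have : FMod.incl Z hn H x ∈ W := by
        intro χ
        by_cases hχ : χ = μ.sortedOrb
        · rw [hχ, FMod.incl, FMod.ev_single_same]
          exact hx
        · rw [FMod.incl, FMod.ev_single_of_ne hχ]
          exact U.zero_mem
      rw [h, Submodule.mem_bot] at this
      rw [Submodule.mem_bot]
      exact FMod.incl_injective (Z := Z) (hn := hn) (H := H) (this.trans (map_zero _).symm)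
    · right
      rw [eq_top_iff]
      intro x _
      have h1 : FMod.incl Z hn H x ∈ W := h ▸ Submodule.mem_top
      have h2 := h1 μ.sortedOrb
      rwa [FMod.incl, FMod.ev_single_same] at h2

/-! ### Isomorphisms -/

variable {N' : Type*} [AddCommGroup N'] [Module K N']

/-- Isomorphism of Hecke families. -/
def Iso (H : HeckeFamily q μ N) (H' : HeckeFamily q μ N') : Prop :=
  ∃ e : N ≃ₗ[K] N', ∀ k a x, e (H.φ k a x) = H'.φ k a (e x)

theorem Iso.symm {H : HeckeFamily q μ N} {H' : HeckeFamily q μ N'} (h : Iso H H') : Iso H' H := by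
  obtain ⟨e, he⟩ := h
  refine ⟨e.symm, fun k a x => ?_⟩
  rw [e.symm_apply_eq, he, e.apply_symm_apply]

theorem isCompat_incl_comp {H : HeckeFamily q μ N} {H' : HeckeFamily q μ N'} (e : N →ₗ[K] N')
    (he : ∀ k a x, e (H.φ k a x) = H'.φ k a (e x)) : IsCompat Z H (FMod.incl Z hn H' ∘ₗ e) where
  mem_wt x := FMod.incl_isCompat.mem_wt (e x)
  g_smul k p x := by
    rw [LinearMap.comp_apply, LinearMap.comp_apply, FMod.incl_isCompat.g_smul, T_fin, T_fin, he]
  X_smul k p x := by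
    rw [LinearMap.comp_apply, LinearMap.comp_apply, FMod.incl_isCompat.X_smul, Y_fin, Y_fin, he]

theorem Iso.fMod {H : HeckeFamily q μ N} {H' : HeckeFamily q μ N'} (h : Iso H H') :
    Nonempty (FMod Z hn H ≃ₗ[Yhat K r n q] FMod Z hn H') := by
  obtain ⟨e, he⟩ := h
  have he' : ∀ k a x, e.symm (H'.φ k a x) = H.φ k a (e.symm x) := fun k a x => by
    rw [e.symm_apply_eq, he, e.apply_symm_apply]
  refine ⟨LinearEquiv.ofLinearMap
    (FMod.extend Z hn H _ (isCompat_incl_comp (hn := hn) e.toLinearMap he))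
    (FMod.extend Z hn H' _ (isCompat_incl_comp (hn := hn) e.symm.toLinearMap he')) ?_ ?_⟩
  · refine FMod.hom_ext fun x => ?_
    rw [LinearMap.comp_apply, FMod.extend_incl, LinearMap.comp_apply, FMod.extend_incl]
    simp
  · refine FMod.hom_ext fun x => ?_
    rw [LinearMap.comp_apply, FMod.extend_incl, LinearMap.comp_apply, FMod.extend_incl]
    simp

theorem map_mem_wt {M M' : Type*} [AddCommGroup M] [Module K M] [Module (Yhat K r n q) M]
    [IsScalarTower K (Yhat K r n q) M] [AddCommGroup M'] [Module K M'] [Module (Yhat K r n q) M']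
    [IsScalarTower K (Yhat K r n q) M'] (E : M →ₗ[Yhat K r n q] M') {χ : Fin n → Fin r} {x : M}
    (hx : x ∈ wt q Z M χ) : E x ∈ wt q Z M' χ := fun j => by
  rw [← map_smul, hx j]
  exact (E.restrictScalars K).map_smul _ _

/-- All weights of the model have content `μ`. -/
theorem content_eq_of_equiv {ν : RComp r n} {H : HeckeFamily q μ N} {H' : HeckeFamily q ν N'}
    [Nontrivial N] (E : FMod Z hn H ≃ₗ[Yhat K r n q] FMod Z hn H') : μ = ν := by
  obtain ⟨x, hx⟩ := exists_ne (0 : N)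
  have h1 := map_mem_wt E.toLinearMap (FMod.incl_isCompat (Z := Z) (hn := hn) (H := H) |>.mem_wt x)
  refine μ.hasContent_sorted.unique (FMod.hasContent_of_mem_wt h1 fun h => hx ?_)
  have h2 : FMod.incl Z hn H x = 0 := E.injective (h.trans (map_zero E).symm)
  exact FMod.incl_injective (Z := Z) (hn := hn) (H := H) (h2.trans (map_zero _).symm)

/-- Homomorphisms between models preserve the sorted weight space. -/
theorem incl_ev_map_incl {H : HeckeFamily q μ N} {H' : HeckeFamily q μ N'}
    (E : FMod Z hn H →ₗ[Yhat K r n q] FMod Z hn H') (x : N) :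
    FMod.incl Z hn H' (FMod.ev Z hn H' μ.sortedOrb (E (FMod.incl Z hn H x))) =
      E (FMod.incl Z hn H x) :=
  (FMod.eq_single_of_mem_wt (χ := μ.sortedOrb) (map_mem_wt E (FMod.incl_isCompat.mem_wt x))).symm

theorem Iso.of_fMod {H : HeckeFamily q μ N} {H' : HeckeFamily q μ N'}
    (E : FMod Z hn H ≃ₗ[Yhat K r n q] FMod Z hn H') : Iso H H' := by
  let e : N →ₗ[K] N' :=
    FMod.ev Z hn H' μ.sortedOrb ∘ₗ E.toLinearMap.restrictScalars K ∘ₗ FMod.incl Z hn H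
  let e' : N' →ₗ[K] N :=
    FMod.ev Z hn H μ.sortedOrb ∘ₗ E.symm.toLinearMap.restrictScalars K ∘ₗ FMod.incl Z hn H'
  have he (x) : FMod.incl Z hn H' (e x) = E (FMod.incl Z hn H x) :=
    incl_ev_map_incl E.toLinearMap x
  have he' (x) : FMod.incl Z hn H (e' x) = E.symm (FMod.incl Z hn H' x) :=
    incl_ev_map_incl E.symm.toLinearMap x
  have hi : Function.Injective (FMod.incl Z hn H) := FMod.incl_injective
  have hi' : Function.Injective (FMod.incl Z hn H') := FMod.incl_injective
  have hc : IsCompat Z H (FMod.incl Z hn H) := FMod.incl_isCompat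
  have hc' : IsCompat Z H' (FMod.incl Z hn H') := FMod.incl_isCompat
  refine ⟨LinearEquiv.ofLinearMap e e' ?_ ?_, ?_⟩
  · ext x
    apply hi'
    rw [LinearMap.comp_apply, he, he', E.apply_symm_apply, LinearMap.id_apply]
  · ext x
    apply hi
    rw [LinearMap.comp_apply, he', he, E.symm_apply_apply, LinearMap.id_apply]
  · intro k a
    change ∀ x, e (H.φ k a x) = H'.φ k a (e x)
    induction a using Hhat.induction with
    | halg c =>
      intro x
      rw [AlgHom.commutes, AlgHom.commutes, Module.algebraMap_end_apply,
        Module.algebraMap_end_apply, map_smul]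
    | hT p =>
      intro x
      apply hi'
      rw [he, ← T_fin, ← T_fin, ← hc.g_smul, ← hc'.g_smul, map_smul, he]
    | hY p =>
      intro x
      apply hi'
      rw [he, ← Y_fin, ← Y_fin, ← hc.X_smul, ← hc'.X_smul, map_smul, he]
    | hYi p =>
      intro x
      apply hi'
      rw [he, ← Yinv_fin, ← Yinv_fin, ← hc.Xinv_smul, ← hc'.Xinv_smul, map_smul, he]
    | hadd a b ha hb =>
      intro x
      rw [map_add, map_add, LinearMap.add_apply, LinearMap.add_apply, map_add, ha, hb]
    | hmul a b ha hb =>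
      intro x
      rw [map_mul, map_mul, Module.End.mul_apply, Module.End.mul_apply, ha, hb]

end HeckeFamily

/-! ### The Hecke actions on a weight space -/

section

variable {K : Type u} [Field K] {q : Kˣ} {r n : ℕ} {μ : RComp r n}

variable (K q) in
/-- The generators of the parabolic subalgebra that play the role of the generators of the `k`-th
affine Hecke algebra. -/
def hgen (μ : RComp r n) (k : Fin r) : HGen (μ.1 k) → Yhat K r n q
  | .T p => Yhat.g (μ.transp k p)
  | .Y p => Yhat.Xv (μ.pos k p)
  | .Yinv p => ((Yhat.X (μ.pos k p))⁻¹ : (Yhat K r n q)ˣ)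

theorem transp_add_two_le {k l : Fin r} (h : k < l) (p : Fin (μ.1 k - 1)) (p' : Fin (μ.1 l - 1)) :
    (μ.transp k p : ℕ) + 2 ≤ μ.transp l p' := by
  have := μ.pos_lt_pos h (hi p) (lo p')
  rw [← RComp.hi_transp, ← RComp.lo_transp, Fin.lt_def, val_hi, val_lo] at this
  omega

theorem pos_ne_pos {k l : Fin r} (h : k ≠ l) (p : Fin (μ.1 k)) (p' : Fin (μ.1 l)) :
    μ.pos k p ≠ μ.pos l p' := by
  intro h'
  have := congrArg μ.sorted h'
  simp only [RComp.sorted_pos] at this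
  exact h this

theorem pos_injective (k : Fin r) : Function.Injective (μ.pos k) := fun p p' h => by
  have := congrArg (rank μ.sorted) h
  simp only [RComp.rank_sorted_pos] at this
  exact Fin.ext this

theorem commute_hgen {k l : Fin r} (h : k ≠ l) (y : HGen (μ.1 k)) (y' : HGen (μ.1 l)) :
    Commute (hgen K q μ k y) (hgen K q μ l y') := by
  have gX {k l : Fin r} (h : k ≠ l) (p : Fin (μ.1 k - 1)) (p' : Fin (μ.1 l)) :
      Commute (Yhat.g (μ.transp k p) : Yhat K r n q) (Yhat.Xv (μ.pos l p')) := by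
    refine Yhat.commute_g_X ?_ ?_
    · rw [RComp.lo_transp]; exact pos_ne_pos h.symm _ _
    · rw [RComp.hi_transp]; exact pos_ne_pos h.symm _ _
  cases y with
  | T p =>
    cases y' with
    | T p' =>
      refine Yhat.commute_g_g ?_
      rcases lt_or_gt_of_ne h with h | h
      · exact Or.inl (transp_add_two_le h p p')
      · exact Or.inr (transp_add_two_le h p' p)
    | Y p' => exact gX h p p'
    | Yinv p' => exact (gX h p p').units_inv_right
  | Y p =>
    cases y' with
    | T p' => exact (gX h.symm p' p).symm
    | Y p' => exact Yhat.commute_X_X _ _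
    | Yinv p' => exact (Yhat.commute_X_X _ _).units_inv_right
  | Yinv p =>
    cases y' with
    | T p' => exact (gX h.symm p' p).symm.units_inv_left
    | Y p' => exact (Yhat.commute_X_X _ _).units_inv_left
    | Yinv p' => exact (Yhat.commute_X_X _ _).units_inv_left.units_inv_right

variable {Z : UnitRoots K r} {M : Type*} [AddCommGroup M] [Module K M] [Module (Yhat K r n q) M]
  [IsScalarTower K (Yhat K r n q) M]

theorem sorted_comp_sw_transp (k : Fin r) (p : Fin (μ.1 k - 1)) :
    μ.sorted ∘ sw (μ.transp k p) = μ.sorted := by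
  have h : μ.sorted (lo (μ.transp k p)) = μ.sorted (hi (μ.transp k p)) := by
    rw [μ.lo_transp, μ.hi_transp, μ.sorted_pos, μ.sorted_pos]
  funext j
  by_cases h3 : j = lo (μ.transp k p)
  · rw [h3, Function.comp_apply, Equiv.swap_apply_left, h]
  · by_cases h4 : j = hi (μ.transp k p)
    · rw [h4, Function.comp_apply, Equiv.swap_apply_right, h]
    · rw [Function.comp_apply, Equiv.swap_apply_of_ne_of_ne h3 h4]

theorem hgen_smul_mem (k : Fin r) (y : HGen (μ.1 k)) {x : M} (hx : x ∈ wt q Z M μ.sorted) :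
    hgen K q μ k y • x ∈ wt q Z M μ.sorted := by
  cases y with
  | T p =>
    have := g_smul_mem_wt hx (μ.transp k p)
    rwa [sorted_comp_sw_transp] at this
  | Y p => exact X_smul_mem_wt hx _
  | Yinv p => exact smul_mem_wt_of_commute hx fun j => (Yhat.commute_t_X j _).units_inv_right

variable (q Z M μ) in
/-- The operators of the Hecke generators on the weight space of the sorted word. -/
def wtOp (k : Fin r) (y : HGen (μ.1 k)) : Module.End K (wt q Z M μ.sorted) :=
  (Algebra.lsmul K K M (hgen K q μ k y)).restrict fun _ hx => hgen_smul_mem k y hx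

theorem coe_wtOp (k : Fin r) (y : HGen (μ.1 k)) (x : wt q Z M μ.sorted) :
    (wtOp q μ Z M k y x : M) = hgen K q μ k y • (x : M) := rfl

theorem wtOp_rel (k : Fin r) ⦃a b : FreeAlgebra K (HGen (μ.1 k))⦄ (h : HRel K (μ.1 k) q a b) :
    FreeAlgebra.lift K (wtOp q μ Z M k) a = FreeAlgebra.lift K (wtOp q μ Z M k) b := by
  refine LinearMap.ext fun x => Subtype.ext ?_
  cases h with
  | quad i =>
    have h : μ.sorted (lo (μ.transp k i)) = μ.sorted (hi (μ.transp k i)) := by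
      rw [μ.lo_transp, μ.hi_transp, μ.sorted_pos, μ.sorted_pos]
    have hg := g_g_smul_of_eq x.2 h
    simp only [map_mul, map_sub, map_add, map_zero, FreeAlgebra.lift_ι_apply, AlgHom.commutes,
      Module.End.mul_apply, LinearMap.sub_apply, LinearMap.add_apply,
      Module.algebraMap_end_apply, AddSubgroupClass.coe_sub, Submodule.coe_add, coe_wtOp, hgen,
      Submodule.coe_smul, LinearMap.zero_apply, Submodule.coe_zero, hg]
    rw [smul_smul, mul_inv_cancel₀ q.ne_zero, one_smul, sub_smul,
      smul_comm (Yhat.g _) ((q : K)⁻¹) (x : M)]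
    abel
  | braid i j h =>
    simp only [map_mul, FreeAlgebra.lift_ι_apply, Module.End.mul_apply, coe_wtOp, hgen]
    simp only [← mul_smul, ← mul_assoc]
    rw [Yhat.g_braid]
    simp only [RComp.transp, h]
    omega
  | T_comm i j h =>
    simp only [map_mul, FreeAlgebra.lift_ι_apply, Module.End.mul_apply, coe_wtOp, hgen]
    rw [← mul_smul, ← mul_smul, (Yhat.commute_g_g (K := K) (r := r) (q := q) _).eq]
    simp only [RComp.transp]
    omega
  | Y_Yinv j =>
    simp only [map_mul, map_one, FreeAlgebra.lift_ι_apply, Module.End.mul_apply, coe_wtOp, hgen]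
    rw [← mul_smul, Units.mul_inv, one_smul, Module.End.one_apply]
  | Yinv_Y j =>
    simp only [map_mul, map_one, FreeAlgebra.lift_ι_apply, Module.End.mul_apply, coe_wtOp, hgen]
    rw [← mul_smul, Units.inv_mul, one_smul, Module.End.one_apply]
  | Y_comm i j =>
    simp only [map_mul, FreeAlgebra.lift_ι_apply, Module.End.mul_apply, coe_wtOp, hgen]
    rw [← mul_smul, ← mul_smul, (Yhat.commute_X_X _ _).eq]
  | T_Y_T i =>
    simp only [map_mul, FreeAlgebra.lift_ι_apply, Module.End.mul_apply, coe_wtOp, hgen]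
    rw [← RComp.lo_transp, ← RComp.hi_transp, Yhat.X_hi, mul_smul, mul_smul]
  | T_Y i j h₁ h₂ =>
    simp only [map_mul, FreeAlgebra.lift_ι_apply, Module.End.mul_apply, coe_wtOp, hgen]
    rw [← mul_smul, ← mul_smul, (Yhat.commute_g_X (K := K) (r := r) (q := q) _ _).eq]
    · rw [RComp.lo_transp]; exact fun h => h₁ (pos_injective k h)
    · rw [RComp.hi_transp]; exact fun h => h₂ (pos_injective k h)

namespace HeckeFamily

/-- If two families of Hecke generators commute, so do the Hecke algebras. -/
theorem commute_of_gen {B : Type*} [Ring B] [Algebra K B] {m m' : ℕ}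
    (φ : Hhat K m q →ₐ[K] B) (φ' : Hhat K m' q →ₐ[K] B)
    (h : ∀ y y', Commute (φ (Hhat.mk K m q (FreeAlgebra.ι K y)))
      (φ' (Hhat.mk K m' q (FreeAlgebra.ι K y')))) (a b) : Commute (φ a) (φ' b) := by
  obtain ⟨a, rfl⟩ := Hhat.mk_surjective a
  obtain ⟨b, rfl⟩ := Hhat.mk_surjective b
  induction a using FreeAlgebra.induction with
  | grade0 c => rw [AlgHom.commutes, AlgHom.commutes]; exact Algebra.commute_algebraMap_left _ _
  | grade1 y =>
    induction b using FreeAlgebra.induction with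
    | grade0 c => rw [AlgHom.commutes, AlgHom.commutes]; exact Algebra.commute_algebraMap_right _ _
    | grade1 y' => exact h y y'
    | mul a b ha hb => rw [map_mul, map_mul]; exact ha.mul_right hb
    | add a b ha hb => rw [map_add, map_add]; exact ha.add_right hb
  | mul a b ha hb => rw [map_mul, map_mul]; exact ha.mul_left hb
  | add a b ha hb => rw [map_add, map_add]; exact ha.add_left hb

variable (q Z M μ) in
/-- The Hecke actions on the weight space of the sorted word. -/
def ofWt : HeckeFamily q μ (wt q Z M μ.sorted) where
  φ k := Hhat.lift (wtOp q μ Z M k) (wtOp_rel k)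
  comm k l h := commute_of_gen _ _ fun y y' => by
    rw [Hhat.lift_mk, Hhat.lift_mk, FreeAlgebra.lift_ι_apply, FreeAlgebra.lift_ι_apply]
    refine LinearMap.ext fun x => Subtype.ext ?_
    simp only [Module.End.mul_apply, coe_wtOp]
    rw [← mul_smul, ← mul_smul, (commute_hgen h y y').eq]

theorem subtype_isCompat : IsCompat Z (ofWt q μ Z M) (wt q Z M μ.sorted).subtype where
  mem_wt x := x.2
  g_smul k p x := by
    rw [T_fin, Hhat.T]
    change _ = ((Hhat.lift (wtOp q μ Z M k) (wtOp_rel k) _ x : wt q Z M μ.sorted) : M)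
    rw [Hhat.lift_mk, FreeAlgebra.lift_ι_apply]
    rfl
  X_smul k p x := by
    rw [Y_fin, Hhat.Y]
    change _ = ((Hhat.lift (wtOp q μ Z M k) (wtOp_rel k) _ x : wt q Z M μ.sorted) : M)
    rw [Hhat.lift_mk, FreeAlgebra.lift_ι_apply]
    rfl

/-- Every simple module is the model built on one of its weight spaces. -/
theorem exists_equiv_fMod (hn : 0 < n) (Z : UnitRoots K r) [IsSimpleModule (Yhat K r n q) M] :
    ∃ μ : RComp r n, (ofWt q μ Z M).Irred ∧
      Nonempty (FMod Z hn (ofWt q μ Z M) ≃ₗ[Yhat K r n q] M) := by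
  have hnt : Nontrivial M := IsSimpleModule.nontrivial (Yhat K r n q) M
  obtain ⟨χ, x, hx, hx0, hxw⟩ := exists_mem_wt (q := q) Z (W := (⊤ : Submodule (Yhat K r n q) M))
    top_ne_bot
  obtain ⟨y, hy, hy0, hyw⟩ := exists_mem_wt_sorted Z (hasContent_content χ) ⟨x, hx, hx0, hxw⟩
  set μ := content χ
  let E := FMod.extend Z hn (ofWt q μ Z M) _ subtype_isCompat
  have hE : ∀ z, E (FMod.incl Z hn _ z) = z := fun z => FMod.extend_incl _ z
  have hs : Function.Surjective E := by
    rw [← LinearMap.range_eq_top]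
    refine (eq_bot_or_eq_top _).resolve_left fun h => hy0 ?_
    have : E (FMod.incl Z hn _ ⟨y, hyw⟩) ∈ LinearMap.range E := ⟨_, rfl⟩
    rwa [h, Submodule.mem_bot, hE] at this
  have hi : Function.Injective E := by
    rw [← LinearMap.ker_eq_bot]
    by_contra h
    obtain ⟨χ', z, hz, hz0, hzw⟩ := exists_mem_wt Z h
    obtain ⟨z', hz', hz0', hzw'⟩ := exists_mem_wt_sorted Z (FMod.hasContent_of_mem_wt hzw hz0)
      ⟨z, hz, hz0, hzw⟩
    obtain ⟨z', rfl⟩ := FMod.mem_wt_sorted_iff.1 hzw'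
    rw [LinearMap.mem_ker, hE] at hz'
    refine hz0' ?_
    rw [show z' = 0 from Subtype.ext hz', map_zero]
  let e := LinearEquiv.ofBijective E ⟨hi, hs⟩
  exact ⟨μ, irred_of_isSimpleModule_fMod (Z := Z) (hn := hn) (IsSimpleModule.congr e), ⟨e⟩⟩

end HeckeFamily

end

/-! ### Finite-dimensionality of simple modules -/

/-- If an algebra is spanned by finitely many elements over a finitely generated commutative
subalgebra `P` acting from the left, then its simple modules are finite-dimensional. Such a module
is finitely generated over `P`, so it has a quotient `Q` that is simple over `P`, and `Q` is
finite-dimensional by the Nullstellensatz; finitely many translates of the quotient map embed the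
module into a power of `Q`. -/
theorem finite_of_isSimpleModule {K P B M : Type*} [Field K] [CommRing P] [Algebra K P]
    [Algebra.FiniteType K P] [Ring B] [Algebra K B] [AddCommGroup M] [Module K M] [Module B M]
    [IsScalarTower K B M] [IsSimpleModule B M] (φ : P →ₐ[K] B) (F : Submodule K B) (hF : F.FG)
    (h : ∀ b : B, b ∈ Submodule.span K {x | ∃ p, ∃ f ∈ F, x = φ p * f}) :
    Module.Finite K M := by
  letI : Module P M := Module.compHom M φ.toRingHom
  have hP (p : P) (x : M) : p • x = φ p • x := rfl
  have : IsScalarTower K P M := ⟨fun c p x => by rw [hP, hP, map_smul, smul_assoc]⟩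
  have hnt : Nontrivial M := IsSimpleModule.nontrivial B M
  obtain ⟨v, hv⟩ := exists_ne (0 : M)
  have : Module.Finite K F := Module.Finite.iff_fg.2 hF
  have : Module.Finite P M := by
    obtain ⟨s, hs⟩ := hF
    classical
    refine ⟨⟨s.image fun f => f • v, ?_⟩⟩
    rw [eq_top_iff]
    rintro x -
    obtain ⟨b, rfl⟩ := IsSimpleModule.toSpanSingleton_surjective B hv x
    rw [LinearMap.toSpanSingleton_apply]
    have hf : ∀ f ∈ F, f • v ∈ Submodule.span P (↑(s.image fun f => f • v) : Set M) := by
      intro f hf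
      rw [← hs] at hf
      induction hf using Submodule.span_induction with
      | mem f hf => exact Submodule.subset_span (by simpa using ⟨f, hf, rfl⟩)
      | zero => rw [zero_smul]; exact Submodule.zero_mem _
      | add a b _ _ ha hb => rw [add_smul]; exact Submodule.add_mem _ ha hb
      | smul c a _ ha => rw [smul_assoc]; exact Submodule.smul_of_tower_mem _ c ha
    induction h b using Submodule.span_induction with
    | mem b hb =>
      obtain ⟨p, f, hf', rfl⟩ := hb
      rw [mul_smul, ← hP]
      exact Submodule.smul_mem _ _ (hf f hf')
    | zero => rw [zero_smul]; exact Submodule.zero_mem _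
    | add a b _ _ ha hb => rw [add_smul]; exact Submodule.add_mem _ ha hb
    | smul c a _ ha => rw [smul_assoc]; exact Submodule.smul_of_tower_mem _ c ha
  obtain ⟨W, hW, -⟩ := (eq_top_or_exists_le_coatom (⊥ : Submodule P M)).resolve_left bot_ne_top
  have hQ : IsSimpleModule P (M ⧸ W) := isSimpleModule_iff_isCoatom.2 hW
  have hQf : Module.Finite K (M ⧸ W) := by
    obtain ⟨I, hI, ⟨e⟩⟩ := isSimpleModule_iff_quot_maximal.1 hQ
    letI := Ideal.Quotient.field I
    have : Module.Finite K (P ⧸ I) := finite_of_finite_type_of_isJacobsonRing K (P ⧸ I)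
    exact Module.Finite.equiv (e.restrictScalars K).symm
  let π : M →ₗ[K] M ⧸ W := W.mkQ.restrictScalars K
  have hπ (p : P) (x : M) : π (φ p • x) = p • π x := W.mkQ.map_smul p x
  let Ψ : M →ₗ[K] F →ₗ[K] M ⧸ W :=
    { toFun := fun x =>
        { toFun := fun f => π ((f : B) • x)
          map_add' := fun f g => by simp [add_smul]
          map_smul' := fun c f => by simp }
      map_add' := fun x y => by ext f; simp
      map_smul' := fun c x => by ext f; simp [smul_comm (f : B) c x] }
  have key : ∀ x, Ψ x = 0 → ∀ b : B, π (b • x) = 0 := by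
    intro x hx b
    induction h b using Submodule.span_induction with
    | mem b hb =>
      obtain ⟨p, f, hf, rfl⟩ := hb
      have : π (f • x) = 0 := LinearMap.congr_fun hx ⟨f, hf⟩
      rw [mul_smul, hπ, this, smul_zero]
    | zero => rw [zero_smul, map_zero]
    | add a b _ _ ha hb => rw [add_smul, map_add, ha, hb, add_zero]
    | smul c a _ ha => rw [smul_assoc, map_smul, ha, smul_zero]
  refine Module.Finite.of_injective Ψ ?_
  rw [← LinearMap.ker_eq_bot]
  let U : Submodule B M :=
    { carrier := {x | ∀ b : B, π (b • x) = 0}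
      add_mem' := fun ha hb b => by rw [smul_add, map_add, ha, hb, add_zero]
      zero_mem' := fun b => by rw [smul_zero, map_zero]
      smul_mem' := fun a x hx b => by rw [← mul_smul]; exact hx _ }
  have hU : U = ⊥ := by
    refine (eq_bot_or_eq_top U).resolve_right fun hU => hW.1 ?_
    rw [eq_top_iff]
    intro x _
    have hx : x ∈ U := hU ▸ Submodule.mem_top
    have := hx 1
    rw [one_smul] at this
    exact (Submodule.Quotient.mk_eq_zero W).1 this
  rw [eq_bot_iff]
  intro x hx
  have : x ∈ U := key x hx
  rwa [hU] at this

namespace Yhat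

variable {K : Type u} [Field K] {r n : ℕ} {q : Kˣ}

variable (K r n q) in
/-- The subalgebra generated by the `t_j` and the `g_i` with `i < k`. -/
def finSub (k : ℕ) : Subalgebra K (Yhat K r n q) :=
  Algebra.adjoin K (Set.range t ∪ {x | ∃ i : Fin (n - 1), (i : ℕ) < k ∧ x = g i})

theorem t_mem_finSub (j : Fin n) (k : ℕ) : t j ∈ finSub K r n q k :=
  Algebra.subset_adjoin (Or.inl ⟨j, rfl⟩)

theorem g_mem_finSub {i : Fin (n - 1)} {k : ℕ} (h : (i : ℕ) < k) : g i ∈ finSub K r n q k :=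
  Algebra.subset_adjoin (Or.inr ⟨i, h, rfl⟩)

theorem finSub_mono {k l : ℕ} (h : k ≤ l) : finSub K r n q k ≤ finSub K r n q l :=
  Algebra.adjoin_mono (Set.union_subset_union_right _ fun _ ⟨i, hi', hx⟩ => ⟨i, hi'.trans_le h, hx⟩)

theorem finSub_induction {k : ℕ} {P : Yhat K r n q → Prop} (ht : ∀ j, P (t j))
    (hg : ∀ i : Fin (n - 1), (i : ℕ) < k → P (g i)) (halg : ∀ c : K, P (algebraMap K _ c))
    (hadd : ∀ a b, P a → P b → P (a + b)) (hmul : ∀ a b, P a → P b → P (a * b))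
    {a : Yhat K r n q} (ha : a ∈ finSub K r n q k) : P a := by
  induction ha using Algebra.adjoin_induction with
  | mem x hx =>
    rcases hx with ⟨j, rfl⟩ | ⟨i, hi', rfl⟩
    · exact ht j
    · exact hg i hi'
  | algebraMap c => exact halg c
  | add a b _ _ ha hb => exact hadd a b ha hb
  | mul a b _ _ ha hb => exact hmul a b ha hb

theorem e_mem_finSub (i : Fin (n - 1)) (k : ℕ) : e i ∈ finSub K r n q k := by
  rw [e_eq]
  exact Subalgebra.smul_mem _ (Subalgebra.sum_mem _ fun s _ => Subalgebra.mul_mem _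
    (Subalgebra.pow_mem _ (t_mem_finSub _ _) _) (Subalgebra.pow_mem _ (t_mem_finSub _ _) _)) _

/-- `g_i` moves past the subalgebra generated by the `t`'s and the distant `g`'s. -/
theorem exists_g_mul {i : Fin (n - 1)} {a : Yhat K r n q} (ha : a ∈ finSub K r n q (i - 1)) :
    ∃ a' ∈ finSub K r n q (i - 1), g i * a = a' * g i := by
  refine finSub_induction (P := fun a => ∃ a' ∈ finSub K r n q (i - 1), g i * a = a' * g i)
    ?_ ?_ ?_ ?_ ?_ ha
  · exact fun j => ⟨_, t_mem_finSub _ _, g_t i j⟩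
  · exact fun j hj => ⟨_, g_mem_finSub hj, (commute_g_g (Or.inr (by omega))).eq⟩
  · exact fun c => ⟨_, Subalgebra.algebraMap_mem _ c, (Algebra.commutes c (g i)).symm⟩
  · rintro a b ⟨a', ha', ha⟩ ⟨b', hb', hb⟩
    exact ⟨a' + b', Subalgebra.add_mem _ ha' hb', by rw [mul_add, add_mul, ha, hb]⟩
  · rintro a b ⟨a', ha', ha⟩ ⟨b', hb', hb⟩
    exact ⟨a' * b', Subalgebra.mul_mem _ ha' hb', by rw [← mul_assoc, ha, mul_assoc, hb, mul_assoc]⟩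

theorem exists_mul_g {i : Fin (n - 1)} {a : Yhat K r n q} (ha : a ∈ finSub K r n q (i - 1)) :
    ∃ a' ∈ finSub K r n q (i - 1), a * g i = g i * a' := by
  refine finSub_induction (P := fun a => ∃ a' ∈ finSub K r n q (i - 1), a * g i = g i * a')
    ?_ ?_ ?_ ?_ ?_ ha
  · exact fun j => ⟨_, t_mem_finSub _ _, t_g i j⟩
  · exact fun j hj => ⟨_, g_mem_finSub hj, (commute_g_g (Or.inl (by omega))).eq⟩
  · exact fun c => ⟨_, Subalgebra.algebraMap_mem _ c, Algebra.commutes c (g i)⟩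
  · rintro a b ⟨a', ha', ha⟩ ⟨b', hb', hb⟩
    exact ⟨a' + b', Subalgebra.add_mem _ ha' hb', by rw [mul_add, add_mul, ha, hb]⟩
  · rintro a b ⟨a', ha', ha⟩ ⟨b', hb', hb⟩
    exact ⟨a' * b', Subalgebra.mul_mem _ ha' hb', by rw [mul_assoc, hb, ← mul_assoc, ha, mul_assoc]⟩

variable (K r n q) in
/-- The span of the products `a g_i b` where `a` and `b` involve only the `t`'s and the `g`'s with
smaller index. -/
def midSpan (i : Fin (n - 1)) : Submodule K (Yhat K r n q) :=
  Submodule.span K {x | ∃ a ∈ finSub K r n q i, ∃ b ∈ finSub K r n q i, x = a * g i * b}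

theorem mul_mem_midSpan {i : Fin (n - 1)} {a b : Yhat K r n q} (ha : a ∈ finSub K r n q i)
    (hb : b ∈ finSub K r n q i) : a * g i * b ∈ midSpan K r n q i :=
  Submodule.subset_span ⟨a, ha, b, hb, rfl⟩

/-- The last `g` is needed at most once in a product, as in the symmetric group: two occurrences
are brought together and reduced by the braid and quadratic relations. -/
theorem finSub_succ_le (i : Fin (n - 1)) :
    Subalgebra.toSubmodule (finSub K r n q (i + 1)) ≤
      Subalgebra.toSubmodule (finSub K r n q i) ⊔ midSpan K r n q i := by
  obtain ⟨k, hk⟩ := i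
  induction k using Nat.strong_induction_on with
  | _ k ih =>
    set i : Fin (n - 1) := ⟨k, hk⟩
    set S := Subalgebra.toSubmodule (finSub K r n q k) ⊔ midSpan K r n q i
    have hS1 {a : Yhat K r n q} (ha : a ∈ finSub K r n q k) : a ∈ S := Submodule.mem_sup_left ha
    have hS2 {a b : Yhat K r n q} (ha : a ∈ finSub K r n q k) (hb : b ∈ finSub K r n q k) :
        a * g i * b ∈ S := Submodule.mem_sup_right (mul_mem_midSpan (i := i) ha hb)
    have hone : (1 : Yhat K r n q) ∈ finSub K r n q k := Subalgebra.one_mem _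
    have hleft {a s : Yhat K r n q} (ha : a ∈ finSub K r n q k) (hs : s ∈ S) : a * s ∈ S := by
      obtain ⟨c, hc, d, hd, rfl⟩ := Submodule.mem_sup.1 hs
      rw [mul_add]
      refine S.add_mem (hS1 (Subalgebra.mul_mem _ ha hc)) ?_
      induction hd using Submodule.span_induction with
      | mem d hd =>
        obtain ⟨x, hx, y, hy, rfl⟩ := hd
        rw [← mul_assoc, ← mul_assoc]
        exact hS2 (Subalgebra.mul_mem _ ha hx) hy
      | zero => rw [mul_zero]; exact S.zero_mem
      | add x y hx' hy' hx hy =>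
        rw [mul_add]
        exact S.add_mem (hx (S.add_mem (Submodule.mem_sup_left hc) (Submodule.mem_sup_right hx')))
          (hy (S.add_mem (Submodule.mem_sup_left hc) (Submodule.mem_sup_right hy')))
      | smul c' x hx' hx =>
        rw [mul_smul_comm]
        exact S.smul_mem _
          (hx (S.add_mem (Submodule.mem_sup_left hc) (Submodule.mem_sup_right hx')))
    have hright {s b : Yhat K r n q} (hs : s ∈ S) (hb : b ∈ finSub K r n q k) : s * b ∈ S := by
      obtain ⟨c, hc, d, hd, rfl⟩ := Submodule.mem_sup.1 hs
      rw [add_mul]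
      refine S.add_mem (hS1 (Subalgebra.mul_mem _ hc hb)) ?_
      clear hs
      induction hd using Submodule.span_induction with
      | mem d hd =>
        obtain ⟨x, hx, y, hy, rfl⟩ := hd
        rw [mul_assoc]
        exact hS2 hx (Subalgebra.mul_mem _ hy hb)
      | zero => rw [zero_mul]; exact S.zero_mem
      | add x y hx' hy' hx hy => rw [add_mul]; exact S.add_mem hx hy
      | smul c' x hx' hx => rw [smul_mul_assoc]; exact S.smul_mem _ hx
    have hgg : g i * g i ∈ S := by
      rw [g_sq]
      refine S.add_mem (hS1 hone) (S.smul_mem _ ?_)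
      have := hS2 (e_mem_finSub i k) hone
      rwa [mul_one] at this
    have hg1 : g i ∈ S := by
      have := hS2 hone hone
      rwa [one_mul, mul_one] at this
    -- `g_i` commutes with the lower `g`'s except the neighbour `g_{i-1}`
    have hlow : ∀ c ∈ finSub K r n q (k - 1), g i * c * g i ∈ S := by
      intro c hc
      obtain ⟨c', hc', h⟩ := exists_g_mul (i := i) hc
      rw [h, mul_assoc]
      exact hleft (finSub_mono (Nat.sub_le _ _) hc') hgg
    -- by induction `g_{i-1}` occurs at most once in `c`, so the braid relation applies
    have hmid : ∀ c ∈ finSub K r n q k, g i * c * g i ∈ S := by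
      intro c hc
      rcases Nat.eq_zero_or_pos k with h0 | h0
      · exact hlow c (by rwa [h0] at hc ⊢)
      · have hk1 : k - 1 < n - 1 := by omega
        have hc' := ih (k - 1) (by omega) hk1 (show c ∈ finSub K r n q (k - 1 + 1) by
          rwa [Nat.sub_add_cancel h0])
        clear hc
        obtain ⟨c, hc, d, hd, rfl⟩ := Submodule.mem_sup.1 hc'
        rw [mul_add, add_mul]
        refine S.add_mem (hlow c hc) ?_
        clear hc'
        induction hd using Submodule.span_induction with
        | mem d hd =>
          obtain ⟨x, hx, y, hy, rfl⟩ := hd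
          obtain ⟨x', hx', h1⟩ := exists_g_mul (i := i) hx
          obtain ⟨y', hy', h2⟩ := exists_mul_g (i := i) hy
          have hb := g_braid (K := K) (r := r) (q := q) (i := ⟨k - 1, hk1⟩) (j := i)
            (show k = k - 1 + 1 by omega)
          have : g i * (x * g ⟨k - 1, hk1⟩ * y) * g i =
              (x' * g ⟨k - 1, hk1⟩) * g i * (g ⟨k - 1, hk1⟩ * y') := by
            calc g i * (x * g ⟨k - 1, hk1⟩ * y) * g i
                = (g i * x) * g ⟨k - 1, hk1⟩ * (y * g i) := by simp only [mul_assoc]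
              _ = x' * (g i * g ⟨k - 1, hk1⟩ * g i) * y' := by
                  rw [h1, h2]; simp only [mul_assoc]
              _ = _ := by rw [← hb]; simp only [mul_assoc]
          rw [this]
          have hgk : g ⟨k - 1, hk1⟩ ∈ finSub K r n q k :=
            g_mem_finSub (show k - 1 < k by omega)
          exact hS2 (Subalgebra.mul_mem _ (finSub_mono (Nat.sub_le _ _) hx') hgk)
            (Subalgebra.mul_mem _ hgk (finSub_mono (Nat.sub_le _ _) hy'))
        | zero => rw [mul_zero, zero_mul]; exact S.zero_mem
        | add x y _ _ hx hy => rw [mul_add, add_mul]; exact S.add_mem hx hy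
        | smul c' x _ hx => rw [mul_smul_comm, smul_mul_assoc]; exact S.smul_mem _ hx
    have hg : ∀ s ∈ S, s * g i ∈ S := by
      intro s hs
      obtain ⟨c, hc, d, hd, rfl⟩ := Submodule.mem_sup.1 hs
      rw [add_mul]
      refine S.add_mem (hleft hc hg1) ?_
      clear hs
      induction hd using Submodule.span_induction with
      | mem d hd =>
        obtain ⟨x, hx, y, hy, rfl⟩ := hd
        rw [mul_assoc, mul_assoc, ← mul_assoc (g i)]
        exact hleft hx (hmid y hy)
      | zero => rw [zero_mul]; exact S.zero_mem
      | add x y _ _ hx hy => rw [add_mul]; exact S.add_mem hx hy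
      | smul c' x _ hx => rw [smul_mul_assoc]; exact S.smul_mem _ hx
    intro a ha
    have hmain : ∀ s ∈ S, s * a ∈ S := by
      refine finSub_induction (k := k + 1) (P := fun a => ∀ s ∈ S, s * a ∈ S) ?_ ?_ ?_ ?_ ?_ ha
      · exact fun j s hs => hright hs (t_mem_finSub j k)
      · intro j hj s hs
        rcases Nat.lt_succ_iff_lt_or_eq.1 hj with h | h
        · exact hright hs (g_mem_finSub h)
        · rw [show j = i from Fin.ext h]
          exact hg s hs
      · intro c s hs
        exact hright hs (Subalgebra.algebraMap_mem _ c)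
      · intro a b ha hb s hs
        rw [mul_add]
        exact S.add_mem (ha s hs) (hb s hs)
      · intro a b ha hb s hs
        rw [← mul_assoc]
        exact hb _ (ha s hs)
    have := hmain 1 (hS1 hone)
    rwa [one_mul] at this

open scoped IsMulCommutative in
theorem finite_finSub_zero (hr : r ≠ 0) : Module.Finite K (finSub K r n q 0) := by
  have h0 : finSub K r n q 0 = Algebra.adjoin K (Set.range (t : Fin n → Yhat K r n q)) := by
    rw [finSub]
    congr 1
    simp
  rw [h0]
  have hc : IsMulCommutative (Algebra.adjoin K (Set.range (t : Fin n → Yhat K r n q))) := by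
    refine Algebra.isMulCommutative_adjoin K ?_
    rintro _ ⟨i, rfl⟩ _ ⟨j, rfl⟩
    exact t_comm i j
  have hfg := fg_adjoin_of_finite (R := K)
    (A := Algebra.adjoin K (Set.range (t : Fin n → Yhat K r n q)))
    (s := ((↑) : Algebra.adjoin K (Set.range (t : Fin n → Yhat K r n q)) → Yhat K r n q) ⁻¹'
      Set.range t)
    ((Set.finite_range t).preimage Subtype.val_injective.injOn) (by
      rintro ⟨x, hx⟩ ⟨j, hj⟩
      refine ⟨Polynomial.X ^ r - 1, ?_, ?_⟩
      · simpa using Polynomial.monic_X_pow_sub_C (1 : K) hr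
      · have : (⟨x, hx⟩ : Algebra.adjoin K (Set.range (t : Fin n → Yhat K r n q))) ^ r = 1 := by
          apply Subtype.ext
          change x ^ r = 1
          rw [← show t j = x from hj, t_pow]
        simp [this])
  rw [Algebra.adjoin_adjoin_coe_preimage] at hfg
  exact ⟨hfg⟩

theorem finite_finSub (hr : r ≠ 0) (k : ℕ) : Module.Finite K (finSub K r n q k) := by
  induction k with
  | zero => exact finite_finSub_zero hr
  | succ k ih =>
    by_cases hk : k < n - 1
    · have h1 := finSub_succ_le (K := K) (r := r) (q := q) ⟨k, hk⟩
      have h2 : (Subalgebra.toSubmodule (finSub K r n q k)).FG := Module.Finite.iff_fg.1 ih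
      have h3 : midSpan K r n q ⟨k, hk⟩ ≤
          Subalgebra.toSubmodule (finSub K r n q k) * Submodule.span K {g ⟨k, hk⟩} *
            Subalgebra.toSubmodule (finSub K r n q k) := by
        refine Submodule.span_le.2 ?_
        rintro _ ⟨a, ha, b, hb, rfl⟩
        exact Submodule.mul_mem_mul (Submodule.mul_mem_mul ha
          (Submodule.mem_span_singleton_self _)) hb
      have h4 := (h2.sup ((h2.mul (Submodule.fg_span_singleton (R := K)
        (g ⟨k, hk⟩ : Yhat K r n q))).mul h2))
      have := Module.Finite.iff_fg.2 h4
      exact Submodule.finiteDimensional_of_le (h1.trans (sup_le_sup_left h3 _))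
    · have : finSub K r n q (k + 1) ≤ finSub K r n q k := by
        refine Algebra.adjoin_mono (Set.union_subset_union_right _ ?_)
        rintro _ ⟨i, -, rfl⟩
        exact ⟨i, by omega, rfl⟩
      exact Submodule.finiteDimensional_of_le
        (S₁ := Subalgebra.toSubmodule (finSub K r n q (k + 1)))
        (S₂ := Subalgebra.toSubmodule (finSub K r n q k)) this

end Yhat

/-! ### The commutative subalgebra generated by the `t_j` and `X_j` -/

namespace Yhat

variable {K : Type u} [Field K] {r n : ℕ} {q : Kˣ}

/-- The element `X_j⁻¹`. -/
abbrev Xinvv (j : Fin n) : Yhat K r n q := ((X j)⁻¹ : (Yhat K r n q)ˣ)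

variable (K r n q) in
/-- The commutative subalgebra generated by the `t_j` and the `X_j^{±1}`. -/
def diagSub : Subalgebra K (Yhat K r n q) :=
  Algebra.adjoin K (Set.range t ∪ (Set.range Xv ∪ Set.range Xinvv))

theorem t_mem_diagSub (j : Fin n) : t j ∈ diagSub K r n q :=
  Algebra.subset_adjoin (Or.inl ⟨j, rfl⟩)

theorem X_mem_diagSub (j : Fin n) : Xv j ∈ diagSub K r n q :=
  Algebra.subset_adjoin (Or.inr (Or.inl ⟨j, rfl⟩))

theorem Xinv_mem_diagSub (j : Fin n) : Xinvv j ∈ diagSub K r n q :=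
  Algebra.subset_adjoin (Or.inr (Or.inr ⟨j, rfl⟩))

theorem e_mem_diagSub (i : Fin (n - 1)) : e i ∈ diagSub K r n q := by
  rw [e_eq]
  exact Subalgebra.smul_mem _ (Subalgebra.sum_mem _ fun s _ => Subalgebra.mul_mem _
    (Subalgebra.pow_mem _ (t_mem_diagSub _) _) (Subalgebra.pow_mem _ (t_mem_diagSub _) _)) _

instance isMulCommutative_diagSub : IsMulCommutative (diagSub K r n q) := by
  refine Algebra.isMulCommutative_adjoin K ?_
  rintro _ (⟨i, rfl⟩ | ⟨i, rfl⟩ | ⟨i, rfl⟩) _ (⟨j, rfl⟩ | ⟨j, rfl⟩ | ⟨j, rfl⟩)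
  · exact t_comm i j
  · exact (commute_t_X i j).eq
  · exact (commute_t_X i j).units_inv_right.eq
  · exact (commute_t_X j i).eq.symm
  · exact (commute_X_X i j).eq
  · exact (commute_X_X i j).units_inv_right.eq
  · exact (commute_t_X j i).units_inv_right.eq.symm
  · exact (commute_X_X i j).units_inv_left.eq
  · exact (commute_X_X i j).units_inv_left.units_inv_right.eq

/-- The Bernstein-type relation: `g_i` moves past the commutative subalgebra up to lower terms. -/
theorem exists_g_mul_diag (i : Fin (n - 1)) {p : Yhat K r n q} (hp : p ∈ diagSub K r n q) :
    ∃ a ∈ diagSub K r n q, ∃ b ∈ diagSub K r n q, g i * p = a * g i + b := by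
  have heX {c : K} {y : Yhat K r n q} (hy : y ∈ diagSub K r n q) :
      c • (e i * y) ∈ diagSub K r n q :=
    Subalgebra.smul_mem _ (Subalgebra.mul_mem _ (e_mem_diagSub i) hy) _
  have hsq (y : Yhat K r n q) : g i * (g i * y) =
      y + ((q : K) - (q : K)⁻¹) • (e i * (g i * y)) := by
    rw [← mul_assoc, g_sq, add_mul, one_mul, smul_mul_assoc, mul_assoc]
  have hg : (g i : Yhat K r n q) - ((q : K) - (q : K)⁻¹) • e i =
      (((gUnit i)⁻¹ : (Yhat K r n q)ˣ) : Yhat K r n q) := rfl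
  have hXinv : (Xinvv (lo i) : Yhat K r n q) = g i * Xinvv (hi i) * g i := by
    have : X (lo i) = (gUnit i)⁻¹ * X (hi i) * (gUnit i : (Yhat K r n q)ˣ)⁻¹ := by
      have h : (X (hi i) : (Yhat K r n q)ˣ) = gUnit i * X (lo i) * gUnit i := rfl
      rw [h]
      group
    have h2 : ((X (lo i))⁻¹ : (Yhat K r n q)ˣ) = gUnit i * (X (hi i))⁻¹ * gUnit i := by
      rw [this]
      group
    exact congrArg Units.val h2
  induction hp using Algebra.adjoin_induction with
  | mem x hx =>
    rcases hx with ⟨j, rfl⟩ | ⟨j, rfl⟩ | ⟨j, rfl⟩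
    · exact ⟨_, t_mem_diagSub _, 0, Subalgebra.zero_mem _, by rw [add_zero, g_t]⟩
    · by_cases h1 : j = lo i
      · subst h1
        refine ⟨Xv (hi i), X_mem_diagSub _, -(((q : K) - (q : K)⁻¹) • (Xv (hi i) * e i)), ?_, ?_⟩
        · exact Subalgebra.neg_mem _ (Subalgebra.smul_mem _
            (Subalgebra.mul_mem _ (X_mem_diagSub _) (e_mem_diagSub i)) _)
        · rw [← mul_smul_comm, ← sub_eq_add_neg, ← mul_sub, hg, X_hi]
          exact (Units.mul_inv_cancel_right (g i * Xv (lo i)) (gUnit i)).symm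
      · by_cases h2 : j = hi i
        · subst h2
          refine ⟨Xv (lo i), X_mem_diagSub _, ((q : K) - (q : K)⁻¹) • (e i * Xv (hi i)),
            heX (X_mem_diagSub (hi i)), ?_⟩
          conv_lhs => rw [X_hi, mul_assoc, hsq]
          rw [X_hi]
          simp only [mul_assoc]
        · exact ⟨_, X_mem_diagSub j, 0, Subalgebra.zero_mem _, by
            rw [add_zero, (commute_g_X h1 h2).eq]⟩
    · by_cases h1 : j = lo i
      · subst h1
        refine ⟨Xinvv (hi i), Xinv_mem_diagSub _, ((q : K) - (q : K)⁻¹) • (e i * Xinvv (lo i)),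
          heX (Xinv_mem_diagSub (lo i)), ?_⟩
        conv_lhs => rw [hXinv, mul_assoc, hsq]
        rw [hXinv]
        simp only [mul_assoc]
      · by_cases h2 : j = hi i
        · subst h2
          refine ⟨Xinvv (lo i), Xinv_mem_diagSub _,
            -(((q : K) - (q : K)⁻¹) • (Xinvv (lo i) * e i)), ?_, ?_⟩
          · exact Subalgebra.neg_mem _ (Subalgebra.smul_mem _
              (Subalgebra.mul_mem _ (Xinv_mem_diagSub _) (e_mem_diagSub i)) _)
          · rw [← mul_smul_comm, ← sub_eq_add_neg, ← mul_sub, hg, hXinv]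
            exact (Units.mul_inv_cancel_right (g i * Xinvv (hi i)) (gUnit i)).symm
        · exact ⟨_, Xinv_mem_diagSub j, 0, Subalgebra.zero_mem _, by
            rw [add_zero, (commute_g_X h1 h2).units_inv_right.eq]⟩
  | algebraMap c =>
    exact ⟨_, Subalgebra.algebraMap_mem _ c, 0, Subalgebra.zero_mem _, by
      rw [add_zero, Algebra.commutes]⟩
  | add x y _ _ hx hy =>
    obtain ⟨a, ha, b, hb, h1⟩ := hx
    obtain ⟨a', ha', b', hb', h2⟩ := hy
    refine ⟨a + a', Subalgebra.add_mem _ ha ha', b + b', Subalgebra.add_mem _ hb hb', ?_⟩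
    rw [mul_add, h1, h2, add_mul]
    abel
  | mul x y _ hy' hx hy =>
    obtain ⟨a, ha, b, hb, h1⟩ := hx
    obtain ⟨a', ha', b', hb', h2⟩ := hy
    refine ⟨a * a', Subalgebra.mul_mem _ ha ha', a * b' + b * y,
      Subalgebra.add_mem _ (Subalgebra.mul_mem _ ha hb') (Subalgebra.mul_mem _ hb hy'), ?_⟩
    rw [← mul_assoc, h1, add_mul, mul_assoc a, h2, mul_add]
    simp only [mul_assoc]
    abel

variable (K r n q) in
/-- The products of an element of the commutative subalgebra and one of the subalgebra generated
by the `t`'s and `g`'s. -/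
def diagFin : Submodule K (Yhat K r n q) :=
  Submodule.span K {x | ∃ p ∈ diagSub K r n q, ∃ f ∈ finSub K r n q (n - 1), x = p * f}

/-- The span of the products is a left ideal, by the Bernstein-type relation. -/
theorem mul_mem_diagFin (hn : 0 < n) (a : Yhat K r n q) :
    ∀ w ∈ diagFin K r n q, a * w ∈ diagFin K r n q := by
  have hp : ∀ p ∈ diagSub K r n q, ∀ w ∈ diagFin K r n q, p * w ∈ diagFin K r n q := by
    intro p hp w hw
    induction hw using Submodule.span_induction with
    | mem w hw =>
      obtain ⟨p', hp', f, hf, rfl⟩ := hw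
      rw [← mul_assoc]
      exact Submodule.subset_span ⟨_, Subalgebra.mul_mem _ hp hp', f, hf, rfl⟩
    | zero => rw [mul_zero]; exact Submodule.zero_mem _
    | add x y _ _ hx hy => rw [mul_add]; exact Submodule.add_mem _ hx hy
    | smul c x _ hx => rw [mul_smul_comm]; exact Submodule.smul_mem _ _ hx
  induction a using Yhat.induction with
  | halg c =>
    intro w hw
    rw [← Algebra.smul_def]
    exact Submodule.smul_mem _ _ hw
  | ht j => exact hp _ (t_mem_diagSub j)
  | hX =>
    rw [← X_zero hn]
    exact hp _ (X_mem_diagSub _)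
  | hXi =>
    exact hp _ (Xinv_mem_diagSub ⟨0, hn⟩)
  | hg i =>
    intro w hw
    induction hw using Submodule.span_induction with
    | mem w hw =>
      obtain ⟨p, hp', f, hf, rfl⟩ := hw
      obtain ⟨a, ha, b, hb, h⟩ := exists_g_mul_diag i hp'
      rw [← mul_assoc, h, add_mul, mul_assoc]
      exact Submodule.add_mem _
        (Submodule.subset_span ⟨a, ha, _, Subalgebra.mul_mem _ (g_mem_finSub i.2) hf, rfl⟩)
        (Submodule.subset_span ⟨b, hb, f, hf, rfl⟩)
    | zero => rw [mul_zero]; exact Submodule.zero_mem _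
    | add x y _ _ hx hy => rw [mul_add]; exact Submodule.add_mem _ hx hy
    | smul c x _ hx => rw [mul_smul_comm]; exact Submodule.smul_mem _ _ hx
  | hadd a b ha hb =>
    intro w hw
    rw [add_mul]
    exact Submodule.add_mem _ (ha w hw) (hb w hw)
  | hmul a b ha hb =>
    intro w hw
    rw [mul_assoc]
    exact ha _ (hb w hw)

theorem diagFin_eq_top (hn : 0 < n) : diagFin K r n q = ⊤ := by
  rw [eq_top_iff]
  intro a _
  rw [← mul_one a]
  exact mul_mem_diagFin hn a 1 (Submodule.subset_span
    ⟨1, Subalgebra.one_mem _, 1, Subalgebra.one_mem _, (mul_one 1).symm⟩)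

instance finiteType_diagSub : Algebra.FiniteType K (diagSub K r n q) := by
  refine (Subalgebra.fg_iff_finiteType _).1 (Subalgebra.fg_def.2 ⟨_, ?_, rfl⟩)
  exact (Set.finite_range _).union ((Set.finite_range _).union (Set.finite_range _))

open scoped IsMulCommutative in
/-- Simple modules over a quotient of the affine Yokonuma-Hecke algebra are finite-dimensional. -/
theorem finite_of_surjective (hr : r ≠ 0) (hn : 0 < n) {B : Type*} [Ring B] [Algebra K B]
    (f : Yhat K r n q →ₐ[K] B) (hf : Function.Surjective f) {M : Type*} [AddCommGroup M]
    [Module K M] [Module B M] [IsScalarTower K B M] [IsSimpleModule B M] : Module.Finite K M := by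
  have hfin : (Subalgebra.toSubmodule (finSub K r n q (n - 1))).FG :=
    have := finite_finSub (K := K) (n := n) (q := q) hr (n - 1)
    Module.Finite.iff_fg.1 this
  refine finite_of_isSimpleModule (P := diagSub K r n q) (f.comp (diagSub K r n q).val) _
    (hfin.map f.toLinearMap) fun b => ?_
  obtain ⟨a, rfl⟩ := hf b
  have ha : a ∈ diagFin K r n q := by
    rw [diagFin_eq_top hn]
    exact Submodule.mem_top
  have := Submodule.mem_map_of_mem (f := f.toLinearMap) ha
  rw [diagFin, Submodule.map_span] at this
  refine Submodule.span_mono ?_ this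
  rintro _ ⟨_, ⟨p, hp, y, hy, rfl⟩, rfl⟩
  exact ⟨⟨p, hp⟩, f y, Submodule.mem_map_of_mem (f := f.toLinearMap) hy, map_mul f p y⟩

end Yhat

namespace Hhat

variable {K : Type u} [Field K] {m : ℕ} {q : Kˣ}

/-- Where the surjection of the affine Yokonuma-Hecke algebra with `r = 1` onto the affine Hecke
algebra sends the generators. -/
def ofYGen (hm : 0 < m) : YGen m → Hhat K m q
  | .t _ => 1
  | .g i => T i
  | .X => Y ⟨0, hm⟩
  | .Xinv => Yinv ⟨0, hm⟩

theorem ofYGen_rel (hm : 0 < m) ⦃x y : FreeAlgebra K (YGen m)⦄ (h : YRel K 1 m q x y) :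
    FreeAlgebra.lift K (ofYGen (K := K) (q := q) hm) x = FreeAlgebra.lift K (ofYGen hm) y := by
  have hgX {i : Fin (m - 1)} (h : 1 ≤ (i : ℕ)) : Commute (T i : Hhat K m q) (Y ⟨0, hm⟩) := by
    refine commute_T_Y ?_ ?_ <;> intro h' <;> have := congrArg Fin.val h' <;>
      simp [lo, hi] at this <;> omega
  cases h with
  | g_comm i j h => simpa [ofYGen] using (commute_T_T h).eq
  | g_braid i j h => simpa [ofYGen] using T_braid h
  | t_comm i j => simp [ofYGen]
  | g_t i j => simp [ofYGen]
  | t_pow j => simp [ofYGen]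
  | g_sq i => simp [ofYGen, fE, sq, T_sq]
  | X_Xinv => simpa [ofYGen] using Y_mul_Yinv _
  | Xinv_X => simpa [ofYGen] using Yinv_mul_Y _
  | g_X_g_X i h =>
    have h0 : (⟨0, hm⟩ : Fin m) = lo i := Fin.ext h.symm
    simp only [map_mul, FreeAlgebra.lift_ι_apply, ofYGen]
    rw [h0, T_Y_T, mul_assoc, mul_assoc, ← mul_assoc (T i), T_Y_T]
    exact commute_Y_Y _ _
  | g_X i h => simpa [ofYGen] using (hgX h).eq
  | t_X j => simp [ofYGen]

/-- The surjection of the affine Yokonuma-Hecke algebra with `r = 1` onto the affine Hecke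
algebra. -/
def ofYhat (hm : 0 < m) : Yhat K 1 m q →ₐ[K] Hhat K m q := Yhat.lift (ofYGen hm) (ofYGen_rel hm)

/-- The `Y_j` and their inverses are reached by `Y_{i+1} = T_i Y_i T_i`, as `T_i` is invertible. -/
theorem ofYhat_surjective (hm : 0 < m) : Function.Surjective (ofYhat (K := K) (q := q) hm) := by
  rw [← AlgHom.range_eq_top, eq_top_iff]
  have hT (i : Fin (m - 1)) : (T i : Hhat K m q) ∈ (ofYhat (K := K) (q := q) hm).range :=
    ⟨Yhat.g i, by simp [Yhat.g, ofYhat, Yhat.lift_mk, ofYGen]⟩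
  have hTi (i : Fin (m - 1)) : ∃ b ∈ (ofYhat (K := K) (q := q) hm).range,
      b * (T i : Hhat K m q) = 1 ∧ T i * b = 1 :=
    ⟨T i - algebraMap K _ ((q : K) - (q : K)⁻¹), Subalgebra.sub_mem _ (hT i)
      (Subalgebra.algebraMap_mem _ _), by
        rw [sub_mul, T_sq, ← Algebra.smul_def, add_sub_cancel_right], by
        rw [mul_sub, T_sq, ← Algebra.commutes, ← Algebra.smul_def, add_sub_cancel_right]⟩
  have hY : ∀ (p : ℕ) (hp : p < m), (Y ⟨p, hp⟩ : Hhat K m q) ∈ (ofYhat (K := K) (q := q) hm).range ∧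
      (Yinv ⟨p, hp⟩ : Hhat K m q) ∈ (ofYhat (K := K) (q := q) hm).range := by
    intro p
    induction p with
    | zero =>
      exact fun _ => ⟨⟨Yhat.mk K 1 m q (fX K m), by simp [ofYhat, Yhat.lift_mk, ofYGen]⟩,
        ⟨Yhat.mk K 1 m q (fXinv K m), by simp [ofYhat, Yhat.lift_mk, ofYGen]⟩⟩
    | succ p ih =>
      intro hp
      obtain ⟨h1, h2⟩ := ih (by omega)
      let i : Fin (m - 1) := ⟨p, by omega⟩
      have hi' : (⟨p + 1, hp⟩ : Fin m) = hi i := rfl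
      have hlo : (⟨p, by omega⟩ : Fin m) = lo i := rfl
      rw [hlo] at h1 h2
      rw [hi']
      refine ⟨T_Y_T (q := q) i ▸ Subalgebra.mul_mem _ (Subalgebra.mul_mem _ (hT i) h1) (hT i), ?_⟩
      obtain ⟨b, hb, hb1, hb2⟩ := hTi i
      -- `T_i⁻¹ Y_i⁻¹ T_i⁻¹` is a left inverse of `Y_{i+1} = T_i Y_i T_i`
      have h3 : b * Yinv (lo i) * b * Y (hi i) = 1 := by
        rw [← T_Y_T]
        calc b * Yinv (lo i) * b * (T i * Y (lo i) * T i)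
            = b * Yinv (lo i) * (b * T i) * Y (lo i) * T i := by simp only [mul_assoc]
          _ = b * (Yinv (lo i) * Y (lo i)) * T i := by
              rw [hb1]; simp only [mul_assoc, mul_one]
          _ = 1 := by rw [Yinv_mul_Y, mul_one, hb1]
      rw [← left_inv_eq_right_inv h3 (Y_mul_Yinv (hi i))]
      exact Subalgebra.mul_mem _ (Subalgebra.mul_mem _ hb h2) hb
  rintro a -
  induction a using Hhat.induction with
  | halg c => exact Subalgebra.algebraMap_mem _ c
  | hT i => exact hT i
  | hY j => exact (hY j j.2).1
  | hYi j => exact (hY j j.2).2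
  | hadd a b ha hb => exact Subalgebra.add_mem _ ha hb
  | hmul a b ha hb => exact Subalgebra.mul_mem _ ha hb

variable (m q) in
/-- Simple modules over the affine Hecke algebra are finite-dimensional. -/
theorem finite_of_isSimpleModule {M : Type*} [AddCommGroup M]
    [Module K M] [Module (Hhat K m q) M] [IsScalarTower K (Hhat K m q) M]
    [IsSimpleModule (Hhat K m q) M] : Module.Finite K M := by
  rcases Nat.eq_zero_or_pos m with rfl | hm
  · refine AffineYokonuma.finite_of_isSimpleModule (B := Hhat K 0 q) (Algebra.ofId K (Hhat K 0 q))
      (Submodule.span K {1}) (Submodule.fg_span_singleton 1) fun a => ?_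
    have ha : ∃ c : K, a = algebraMap K _ c := by
      induction a using Hhat.induction with
      | halg c => exact ⟨c, rfl⟩
      | hT i => exact i.elim0
      | hY j => exact j.elim0
      | hYi j => exact j.elim0
      | hadd a b ha hb =>
        obtain ⟨c, rfl⟩ := ha
        obtain ⟨d, rfl⟩ := hb
        exact ⟨c + d, (map_add _ c d).symm⟩
      | hmul a b ha hb =>
        obtain ⟨c, rfl⟩ := ha
        obtain ⟨d, rfl⟩ := hb
        exact ⟨c * d, (map_mul _ c d).symm⟩
    obtain ⟨c, rfl⟩ := ha
    exact Submodule.subset_span ⟨c, 1, Submodule.mem_span_singleton_self 1, (mul_one _).symm⟩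
  · exact Yhat.finite_of_surjective (K := K) (q := q) one_ne_zero hm (ofYhat hm)
      (ofYhat_surjective hm)

end Hhat

/-! ### Simple modules and their annihilators -/

section

variable (K : Type*) [Field K] [IsAlgClosed K] {A : Type*} [Ring A] [Algebra K A]
  (L : Type*) [AddCommGroup L] [Module K L] [Module A L] [IsScalarTower K A L]
  [IsSimpleModule A L] [Module.Finite K L]

/-- Burnside's theorem: an algebra acts on a finite-dimensional simple module by all
endomorphisms. -/
theorem lsmul_surjective : Function.Surjective (Algebra.lsmul K K L : A →ₐ[K] Module.End K L) := by
  intro f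
  -- by Schur's lemma `f` commutes with all endomorphisms, so the density theorem applies
  obtain ⟨s, hs⟩ := Module.Finite.fg_top (R := K) (M := L)
  let F : Module.End (Module.End A L) L :=
    { toFun := f
      map_add' := map_add f
      map_smul' := fun g x => by
        obtain ⟨c, rfl⟩ := (IsSimpleModule.algebraMap_end_bijective_of_isAlgClosed K).2 g
        simp }
  obtain ⟨a, ha⟩ := jacobson_density F s
  refine ⟨a, LinearMap.ext_on hs fun x hx => ?_⟩
  exact (ha x hx).symm

/-- Simple modules with the same annihilator are isomorphic: an element acting on one of them as a
projection onto a line has, in its image on the other, a vector with the same annihilator. -/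
theorem nonempty_equiv_of_annihilator (K : Type*) [Field K] [IsAlgClosed K] {A : Type*} [Ring A]
    [Algebra K A] {L : Type*} [AddCommGroup L] [Module K L] [Module A L] [IsScalarTower K A L]
    [IsSimpleModule A L] [Module.Finite K L] {L' : Type*} [AddCommGroup L'] [Module A L']
    [IsSimpleModule A L'] (h : ∀ a : A, (∀ x : L, a • x = 0) ↔ ∀ x : L', a • x = 0) :
    Nonempty (L ≃ₗ[A] L') := by
  have hnt : Nontrivial L := IsSimpleModule.nontrivial A L
  obtain ⟨v, hv⟩ := exists_ne (0 : L)
  obtain ⟨ξ, hξ⟩ := Module.Projective.exists_dual_eq_one K hv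
  -- `a` acts on `L` as a projection onto the line through `v`
  obtain ⟨a, ha⟩ := lsmul_surjective K L (A := A) (ξ.smulRight v)
  have ha' (x : L) : a • x = ξ x • v := LinearMap.congr_fun ha x
  have hav : ¬ ∀ x : L', a • x = 0 := fun h' => hv <| by
    have := (h a).2 h' v
    rwa [ha', hξ, one_smul] at this
  push Not at hav
  obtain ⟨x', hx'⟩ := hav
  have hker : LinearMap.ker (LinearMap.toSpanSingleton A L v) ≤
      LinearMap.ker (LinearMap.toSpanSingleton A L' (a • x')) := by
    intro b hb
    rw [LinearMap.mem_ker, LinearMap.toSpanSingleton_apply] at hb ⊢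
    rw [← mul_smul]
    refine (h (b * a)).1 (fun x => ?_) x'
    rw [mul_smul, ha', smul_algebra_smul_comm, hb, smul_zero]
  let f : L →ₗ[A] L' := Submodule.liftQ _ _ hker ∘ₗ (LinearMap.quotKerEquivOfSurjective _
    (IsSimpleModule.toSpanSingleton_surjective A hv)).symm.toLinearMap
  refine ⟨LinearEquiv.ofBijective f (LinearMap.bijective_of_ne_zero fun hf => hx' ?_)⟩
  have : f (LinearMap.quotKerEquivOfSurjective _
      (IsSimpleModule.toSpanSingleton_surjective A hv) (Submodule.Quotient.mk 1)) = 0 := by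
    rw [hf, LinearMap.zero_apply]
  simpa [f, -LinearMap.quotKerEquivOfSurjective_apply_mk] using this

end

/-! ### Tensor products of vector spaces -/

section

variable {K : Type u} [Field K] {ι : Type} [DecidableEq ι] {W : ι → Type v}
  [∀ i, AddCommGroup (W i)] [∀ i, Module K (W i)]

theorem onFactor_tprod (k : ι) (f : Module.End K (W k)) (x : ∀ i, W i) :
    onFactor K k f (PiTensorProduct.tprod K x) =
      PiTensorProduct.tprod K (Function.update x k (f (x k))) := by
  rw [onFactor, PiTensorProduct.map_tprod]
  congr 1
  funext i
  by_cases h : i = k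
  · subst h; simp
  · simp [h]

variable (K W) in
/-- The action of the endomorphisms of one factor as a homomorphism of algebras. -/
def onFactorHom (k : ι) : Module.End K (W k) →ₐ[K] Module.End K (⨂[K] i, W i) :=
  AlgHom.ofLinearMap
    { toFun := onFactor K k
      map_add' := fun f g => PiTensorProduct.map_update_add _ k f g
      map_smul' := fun c f => PiTensorProduct.map_update_smul _ k c f }
    (by
      refine PiTensorProduct.ext (MultilinearMap.ext fun x => ?_)
      change onFactor K k (1 : Module.End K (W k)) (PiTensorProduct.tprod K x) =
        PiTensorProduct.tprod K x
      simp [onFactor_tprod])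
    (fun f g => by
      refine PiTensorProduct.ext (MultilinearMap.ext fun x => ?_)
      change onFactor K k (f * g) (PiTensorProduct.tprod K x) =
        onFactor K k f (onFactor K k g (PiTensorProduct.tprod K x))
      simp [onFactor_tprod])

theorem commute_onFactor {k l : ι} (h : k ≠ l) (f : Module.End K (W k)) (g : Module.End K (W l)) :
    Commute (onFactor K k f) (onFactor K l g) := by
  refine PiTensorProduct.ext (MultilinearMap.ext fun x => ?_)
  simp [onFactor_tprod, h, h.symm, Function.update_comm h]

variable [Fintype ι]

/-- A subspace stable under the endomorphisms of the single factors is stable under all tensor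
products of endomorphisms. -/
theorem map_mem_of_onFactor_mem {U : Submodule K (⨂[K] i, W i)}
    (hU : ∀ k (f : Module.End K (W k)), ∀ x ∈ U, onFactor K k f x ∈ U)
    (F : ∀ i, Module.End K (W i)) {x : ⨂[K] i, W i} (hx : x ∈ U) :
    PiTensorProduct.map F x ∈ U := by
  have h : ∀ s : Finset ι,
      PiTensorProduct.map (fun i => if i ∈ s then F i else LinearMap.id) x ∈ U := by
    intro s
    induction s using Finset.induction_on with
    | empty => simpa using hx
    | insert k s hk ih =>
      have := hU k (F k) _ ih
      rw [onFactor, ← LinearMap.comp_apply, ← PiTensorProduct.map_comp] at this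
      convert this using 2
      congr 1
      funext i
      by_cases h : i = k
      · subst h; simp [hk]
      · simp [h]
  simpa using h Finset.univ

omit [DecidableEq ι] in
theorem tprod_ne_zero {x : ∀ i, W i} (hx : ∀ i, x i ≠ 0) : PiTensorProduct.tprod K x ≠ 0 := by
  choose ξ hξ using fun i => Module.Projective.exists_dual_ne_zero K (hx i)
  intro h
  have := PiTensorProduct.dualDistrib_apply ξ x
  rw [h, map_zero] at this
  exact Finset.prod_ne_zero_iff.2 (fun i _ => hξ i) this.symm

/-- The tensor product is a simple module over the tensor product of the endomorphism algebras:
a nonzero element is sent to every pure tensor by a tensor product of operators of rank one. -/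
theorem eq_bot_or_eq_top_of_onFactor_mem {U : Submodule K (⨂[K] i, W i)}
    (hU : ∀ k (f : Module.End K (W k)), ∀ x ∈ U, onFactor K k f x ∈ U) : U = ⊥ ∨ U = ⊤ := by
  refine or_iff_not_imp_left.2 fun h => ?_
  obtain ⟨x, hx, hx0⟩ := (Submodule.ne_bot_iff U).1 h
  let b (i) := Module.Basis.ofVectorSpace K (W i)
  obtain ⟨p, hp⟩ : ∃ p, (Basis.piTensorProduct b).repr x p ≠ 0 := by
    by_contra! h'
    exact hx0 ((Basis.piTensorProduct b).repr.map_eq_zero_iff.1 (Finsupp.ext h'))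
  rw [eq_top_iff, ← PiTensorProduct.span_tprod_eq_top, Submodule.span_le]
  rintro _ ⟨w, rfl⟩
  -- the rank-one operators `ξ_i(·) w_i`, for coordinates `ξ_i`, take `x` to a multiple of `⨂ w_i`
  have key : PiTensorProduct.map (fun i => ((b i).coord (p i)).smulRight (w i)) =
      ((Finsupp.lapply p ∘ₗ (Basis.piTensorProduct b).repr.toLinearMap).smulRight
        (PiTensorProduct.tprod K w)) := by
    refine PiTensorProduct.ext (MultilinearMap.ext fun y => ?_)
    simp [Basis.piTensorProduct_repr_tprod_apply, MultilinearMap.map_smul_univ]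
  have := map_mem_of_onFactor_mem hU (fun i => ((b i).coord (p i)).smulRight (w i)) hx
  rw [key] at this
  exact (U.smul_mem_iff hp).1 this

end

/-! ### Simple modules over the tensor product of the affine Hecke algebras -/

namespace HeckeFamily

variable {K : Type u} [Field K] {q : Kˣ} {r n : ℕ} {μ : RComp r n}

theorem Iso.trans {N N' N'' : Type*} [AddCommGroup N] [Module K N] [AddCommGroup N']
    [Module K N'] [AddCommGroup N''] [Module K N''] {H : HeckeFamily q μ N}
    {H' : HeckeFamily q μ N'} {H'' : HeckeFamily q μ N''} (h : Iso H H') (h' : Iso H' H'') :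
    Iso H H'' := by
  obtain ⟨e, he⟩ := h
  obtain ⟨e', he'⟩ := h'
  exact ⟨e.trans e', fun k a x => by
    rw [LinearEquiv.trans_apply, LinearEquiv.trans_apply, he, he']⟩

theorem Iso.irred {N N' : Type*} [AddCommGroup N] [Module K N] [AddCommGroup N'] [Module K N']
    {H : HeckeFamily q μ N} {H' : HeckeFamily q μ N'} (h : Iso H H') (hH : H.Irred) : H'.Irred := by
  obtain ⟨e, he⟩ := h
  have := hH.1
  refine ⟨e.symm.toEquiv.nontrivial, fun U hU => ?_⟩
  have hc : U = (U.comap e.toLinearMap).map e.toLinearMap :=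
    (Submodule.map_comap_eq_of_surjective e.surjective U).symm
  rw [hc]
  refine (hH.2 (U.comap e.toLinearMap) fun k a x hx => ?_).imp (fun h => ?_) fun h => ?_
  · have := hU k a _ hx
    rwa [LinearEquiv.coe_coe, ← he] at this
  · rw [h, Submodule.map_bot]
  · rw [h, Submodule.map_top, LinearEquiv.range]

/-- Schur's lemma. -/
theorem Iso.of_ne_zero {N N' : Type*} [AddCommGroup N] [Module K N] [AddCommGroup N']
    [Module K N'] {H : HeckeFamily q μ N} {H' : HeckeFamily q μ N'} (hH : H.Irred) (hH' : H'.Irred)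
    (e : N →ₗ[K] N') (he : ∀ k a x, e (H.φ k a x) = H'.φ k a (e x)) (h0 : e ≠ 0) : Iso H H' := by
  have hk : LinearMap.ker e = ⊥ := by
    refine (hH.2 _ fun k a x hx => ?_).resolve_right fun h => h0 (LinearMap.ker_eq_top.1 h)
    rw [LinearMap.mem_ker] at hx ⊢
    rw [he, hx, map_zero]
  have hr : LinearMap.range e = ⊤ := by
    refine (hH'.2 _ ?_).resolve_left fun h => h0 (LinearMap.range_eq_bot.1 h)
    rintro k a _ ⟨x, rfl⟩
    exact ⟨_, he k a x⟩
  exact ⟨LinearEquiv.ofBijective e ⟨LinearMap.ker_eq_bot.1 hk, LinearMap.range_eq_top.1 hr⟩, he⟩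

section Tensor

variable {W : Fin r → Type v} [∀ k, AddCommGroup (W k)] [∀ k, Module K (W k)]
  {W' : Fin r → Type w} [∀ k, AddCommGroup (W' k)] [∀ k, Module K (W' k)]

/-- The external tensor product of modules over the affine Hecke algebras. -/
def tensor (ψ : ∀ k, Hhat K (μ.1 k) q →ₐ[K] Module.End K (W k)) :
    HeckeFamily q μ (⨂[K] k, W k) where
  φ k := (onFactorHom K W k).comp (ψ k)
  comm _ _ h _ _ := commute_onFactor h _ _

variable {ψ : ∀ k, Hhat K (μ.1 k) q →ₐ[K] Module.End K (W k)}
  {ψ' : ∀ k, Hhat K (μ.1 k) q →ₐ[K] Module.End K (W' k)}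

theorem tensor_φ (k : Fin r) (a : Hhat K (μ.1 k) q) : (tensor ψ).φ k a = onFactor K k (ψ k a) := rfl

theorem irred_tensor [∀ k, Nontrivial (W k)] (hψ : ∀ k, Function.Surjective (ψ k)) :
    (tensor ψ).Irred := by
  refine ⟨?_, fun U hU => eq_bot_or_eq_top_of_onFactor_mem fun k f x hx => ?_⟩
  · choose w hw using fun k => exists_ne (0 : W k)
    exact ⟨_, 0, tprod_ne_zero hw⟩
  · obtain ⟨a, rfl⟩ := hψ k f
    exact hU k a x hx

theorem tensor_φ_eq_zero_iff [∀ k, Nontrivial (W k)] {k : Fin r} {a : Hhat K (μ.1 k) q} :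
    (tensor ψ).φ k a = 0 ↔ ψ k a = 0 := by
  constructor
  · intro h
    by_contra h0
    obtain ⟨x, hx⟩ : ∃ x, ψ k a x ≠ 0 := by
      by_contra! h'
      exact h0 (LinearMap.ext h')
    choose w hw using fun k => exists_ne (0 : W k)
    refine tprod_ne_zero (K := K) (x := Function.update w k (ψ k a x)) (fun i => ?_) ?_
    · by_cases hi : i = k
      · subst hi; simpa using hx
      · simpa [hi] using hw i
    · have := LinearMap.congr_fun h (PiTensorProduct.tprod K (Function.update w k x))
      simpa [tensor_φ, onFactor_tprod] using this
  · intro h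
    rw [tensor, AlgHom.comp_apply, h, map_zero]

theorem iso_tensor (e : ∀ k, W k ≃ₗ[K] W' k) (he : ∀ k a x, e k (ψ k a x) = ψ' k a (e k x)) :
    Iso (tensor ψ) (tensor ψ') := by
  refine ⟨PiTensorProduct.congr e, fun k a x => ?_⟩
  rw [← LinearEquiv.coe_coe, ← LinearMap.comp_apply, ← LinearMap.comp_apply]
  congr 1
  refine PiTensorProduct.ext (MultilinearMap.ext fun y => ?_)
  simp only [LinearMap.compMultilinearMap_apply, LinearMap.comp_apply, LinearEquiv.coe_coe,
    tensor_φ, onFactor_tprod, PiTensorProduct.congr_tprod]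
  congr 1
  funext i
  by_cases hi : i = k
  · subst hi; simp [he]
  · simp [hi]

end Tensor

section Factor

variable {N : Type*} [AddCommGroup N] [Module K N] (H : HeckeFamily q μ N)

/-- There is a nonzero vector that is annihilated by maximal left ideals of all the affine Hecke
algebras. For one more index, it is found in a simple submodule of the vectors that satisfy the
previous conditions; these are stable as the actions commute. -/
theorem exists_isCoatom_annihilator [Module.Finite K N] [Nontrivial N] (s : Finset (Fin r)) :
    ∃ v : N, v ≠ 0 ∧ ∀ k ∈ s, ∃ I : Submodule (Hhat K (μ.1 k) q) (Hhat K (μ.1 k) q),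
      IsCoatom I ∧ ∀ a ∈ I, H.φ k a v = 0 := by
  induction s using Finset.induction_on with
  | empty => exact (exists_ne (0 : N)).imp fun v hv => ⟨hv, by simp⟩
  | insert l s hl ih =>
    obtain ⟨v, hv, hs⟩ := ih
    letI : Module (Hhat K (μ.1 l) q) N := Module.compHom N (H.φ l).toRingHom
    have hsmul (a : Hhat K (μ.1 l) q) (x : N) : a • x = H.φ l a x := rfl
    have : IsScalarTower K (Hhat K (μ.1 l) q) N := ⟨fun c a x => by
      rw [hsmul, hsmul, map_smul, LinearMap.smul_apply]⟩
    have : IsArtinian (Hhat K (μ.1 l) q) N := isArtinian_of_tower K inferInstance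
    -- the vectors with the same annihilators as `v` for the indices in `s`
    let U : Submodule (Hhat K (μ.1 l) q) N :=
      { carrier := {w | ∀ k ∈ s, ∀ a, H.φ k a v = 0 → H.φ k a w = 0}
        add_mem' := fun hx hy k hk a ha => by rw [map_add, hx k hk a ha, hy k hk a ha, add_zero]
        zero_mem' := fun k _ a _ => map_zero _
        smul_mem' := fun b x hx k hk a ha => by
          have := H.comm k l (ne_of_mem_of_not_mem hk hl) a b
          rw [hsmul, ← Module.End.mul_apply, this.eq, Module.End.mul_apply, hx k hk a ha,
            map_zero] }
    have hvU : v ∈ U := fun _ _ _ h => h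
    obtain ⟨S, hS, hSU⟩ := (eq_bot_or_exists_atom_le U).resolve_left
      ((Submodule.ne_bot_iff U).2 ⟨v, hvU, hv⟩)
    have : IsSimpleModule (Hhat K (μ.1 l) q) S := isSimpleModule_iff_isAtom.2 hS
    have : Nontrivial S := IsSimpleModule.nontrivial (Hhat K (μ.1 l) q) S
    obtain ⟨w, hw⟩ := exists_ne (0 : S)
    refine ⟨w, fun h => hw (Subtype.ext h), fun k hk => ?_⟩
    rcases Finset.mem_insert.1 hk with rfl | hk
    · refine ⟨LinearMap.ker (LinearMap.toSpanSingleton _ S w), ?_, fun a ha => ?_⟩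
      · exact (IsSimpleModule.ker_toSpanSingleton_isMaximal _ hw).1
      · exact congrArg Subtype.val (LinearMap.mem_ker.1 ha)
    · obtain ⟨I, hI, h⟩ := hs k hk
      exact ⟨I, hI, fun a ha => hSU w.2 k hk a (h a ha)⟩

variable (a : ∀ k, Hhat K (μ.1 k) q)

theorem pairwise_commute (s : Set (Fin r)) :
    s.Pairwise (Function.onFun Commute fun k => H.φ k (a k)) :=
  fun k _ l _ h => H.comm k l h _ _

/-- The action of a pure tensor of elements of the affine Hecke algebras. -/
def prodOp : Module.End K N :=
  Finset.univ.noncommProd (fun k => H.φ k (a k)) (H.pairwise_commute a _)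

/-- The factor with index `l` of the action of a pure tensor can be split off. -/
theorem exists_prodOp_update (l : Fin r) : ∃ R : Module.End K N,
    (∀ b, Commute R (H.φ l b)) ∧ ∀ b, H.prodOp (Function.update a l b) = R * H.φ l b := by
  refine ⟨(Finset.univ.erase l).noncommProd (fun k => H.φ k (a k)) (H.pairwise_commute a _),
    fun b => ?_, fun b => ?_⟩
  · exact (Finset.noncommProd_commute _ _ _ _ fun k hk =>
      H.comm l k (Finset.ne_of_mem_erase hk).symm _ _).symm
  · rw [prodOp, ← Finset.noncommProd_erase_mul _ (Finset.mem_univ l)]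
    congr 1
    · refine Finset.noncommProd_congr rfl (fun k hk => ?_) _
      rw [Function.update_of_ne (Finset.ne_of_mem_erase hk)]
    · rw [Function.update_self]

/-- The orbit map of a vector, on pure tensors of elements of the affine Hecke algebras modulo
subspaces `I_k`; the elements are lifted by linear sections. -/
def orbitMap {I : ∀ k, Submodule (Hhat K (μ.1 k) q) (Hhat K (μ.1 k) q)}
    (σ : ∀ k, (Hhat K (μ.1 k) q ⧸ I k) →ₗ[K] Hhat K (μ.1 k) q) (v : N) :
    MultilinearMap K (fun k => Hhat K (μ.1 k) q ⧸ I k) N where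
  toFun x := H.prodOp (fun k => σ k (x k)) v
  map_update_add' {hdec} x l y z := by
    obtain rfl : hdec = instDecidableEqFin r := Subsingleton.elim _ _
    obtain ⟨R, -, hR⟩ := H.exists_prodOp_update (fun k => σ k (x k)) l
    have h (y) : (fun k => σ k (Function.update x l y k)) =
        Function.update (fun k => σ k (x k)) l (σ l y) :=
      funext fun k => Function.apply_update (fun k => σ k) x l y k
    simp [h, hR]
  map_update_smul' {hdec} x l c y := by
    obtain rfl : hdec = instDecidableEqFin r := Subsingleton.elim _ _
    obtain ⟨R, -, hR⟩ := H.exists_prodOp_update (fun k => σ k (x k)) l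
    have h (y) : (fun k => σ k (Function.update x l y k)) =
        Function.update (fun k => σ k (x k)) l (σ l y) :=
      funext fun k => Function.apply_update (fun k => σ k) x l y k
    simp [h, hR]

variable {H}

/-- A finite-dimensional simple module over the tensor product of the affine Hecke algebras is the
external tensor product of simple modules. A vector annihilated by a maximal left ideal `I_k` of
the `k`-th algebra for every `k` gives a map from the tensor product of the quotients by the
`I_k`. -/
theorem Irred.exists_iso_tensor [IsAlgClosed K] [Module.Finite K N] (hH : H.Irred) :
    ∃ I : ∀ k, Submodule (Hhat K (μ.1 k) q) (Hhat K (μ.1 k) q), (∀ k, IsCoatom (I k)) ∧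
      Iso (tensor fun k => Algebra.lsmul K K (Hhat K (μ.1 k) q ⧸ I k)) H := by
  have := hH.1
  obtain ⟨v, hv, h⟩ := H.exists_isCoatom_annihilator Finset.univ
  choose I hI hIv using fun k => h k (Finset.mem_univ k)
  refine ⟨I, hI, ?_⟩
  have hs (k) : IsSimpleModule (Hhat K (μ.1 k) q) (Hhat K (μ.1 k) q ⧸ I k) :=
    isSimpleModule_iff_isCoatom.2 (hI k)
  have hnt (k) : Nontrivial (Hhat K (μ.1 k) q ⧸ I k) :=
    IsSimpleModule.nontrivial (Hhat K (μ.1 k) q) _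
  have hfin (k) : Module.Finite K (Hhat K (μ.1 k) q ⧸ I k) :=
    Hhat.finite_of_isSimpleModule (μ.1 k) q
  have hσ (k) := LinearMap.exists_rightInverse_of_surjective ((I k).mkQ.restrictScalars K)
    (LinearMap.range_eq_top.2 (I k).mkQ_surjective)
  choose σ hσ using hσ
  -- the choice of the lifts does not matter, as `I_k` annihilates `v`
  have hφσ (k) (b : Hhat K (μ.1 k) q) : H.φ k (σ k ((I k).mkQ b)) v = H.φ k b v := by
    have : σ k ((I k).mkQ b) - b ∈ I k :=
      (Submodule.Quotient.eq _).1 (LinearMap.congr_fun (hσ k) ((I k).mkQ b))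
    have := hIv k _ this
    rwa [map_sub, LinearMap.sub_apply, sub_eq_zero] at this
  have hmk (k) (x : Hhat K (μ.1 k) q ⧸ I k) : (I k).mkQ (σ k x) = x := LinearMap.congr_fun (hσ k) x
  refine Iso.of_ne_zero (irred_tensor fun k => lsmul_surjective K _) hH
    (PiTensorProduct.lift (H.orbitMap σ v)) (fun k a x => ?_) fun h0 => hv ?_
  · rw [← LinearMap.comp_apply, ← LinearMap.comp_apply]
    congr 1
    refine PiTensorProduct.ext (MultilinearMap.ext fun y => ?_)
    obtain ⟨R, hR1, hR2⟩ := H.exists_prodOp_update (fun k => σ k (y k)) k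
    have h (z) : H.orbitMap σ v (Function.update y k z) = R (H.φ k (σ k z) v) := by
      have : (fun l => σ l (Function.update y k z l)) =
          Function.update (fun l => σ l (y l)) k (σ k z) :=
        funext fun l => Function.apply_update (fun l => σ l) y k z l
      change H.prodOp (fun l => σ l (Function.update y k z l)) v = _
      rw [this, hR2, Module.End.mul_apply]
    have h2 := h (y k)
    rw [Function.update_eq_self] at h2
    have h3 : a • y k = (I k).mkQ (a * σ k (y k)) := by
      rw [← smul_eq_mul, map_smul, hmk]
    simp only [LinearMap.compMultilinearMap_apply, LinearMap.comp_apply, tensor_φ, onFactor_tprod,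
      PiTensorProduct.lift.tprod, h, Algebra.lsmul_coe]
    rw [h2, h3, hφσ, map_mul, Module.End.mul_apply, ← Module.End.mul_apply, (hR1 a).eq,
      Module.End.mul_apply]
  · have h1 : PiTensorProduct.lift (H.orbitMap σ v)
        (PiTensorProduct.tprod K fun k => (I k).mkQ 1) = v := by
      rw [PiTensorProduct.lift.tprod]
      refine Finset.noncommProd_induction _ _ _ (fun f : Module.End K N => f v = v) ?_ ?_ ?_
      · intro f g hf hg
        rw [Module.End.mul_apply, hg, hf]
      · rfl
      · intro k _
        rw [hφσ, map_one, Module.End.one_apply]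
    rw [← h1, h0, LinearMap.zero_apply]

end Factor

section Lsmul

variable [IsAlgClosed K] {L : Fin r → Type v} [∀ k, AddCommGroup (L k)] [∀ k, Module K (L k)]
  [∀ k, Module (Hhat K (μ.1 k) q) (L k)] [∀ k, IsScalarTower K (Hhat K (μ.1 k) q) (L k)]
  {L' : Fin r → Type w} [∀ k, AddCommGroup (L' k)] [∀ k, Module K (L' k)]
  [∀ k, Module (Hhat K (μ.1 k) q) (L' k)] [∀ k, IsScalarTower K (Hhat K (μ.1 k) q) (L' k)]

/-- The factors of an external tensor product are determined by it: they have the same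
annihilators as the tensor product. -/
theorem iso_tensor_lsmul_iff (hL : ∀ k, IsSimpleModule (Hhat K (μ.1 k) q) (L k))
    (hL' : ∀ k, IsSimpleModule (Hhat K (μ.1 k) q) (L' k)) :
    Iso (tensor fun k => (Algebra.lsmul K K (L k) : Hhat K (μ.1 k) q →ₐ[K] _))
      (tensor fun k => (Algebra.lsmul K K (L' k) : Hhat K (μ.1 k) q →ₐ[K] _)) ↔
    ∀ k, Nonempty (L k ≃ₗ[Hhat K (μ.1 k) q] L' k) := by
  have hnt (k) : Nontrivial (L k) := IsSimpleModule.nontrivial (Hhat K (μ.1 k) q) _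
  have hnt' (k) : Nontrivial (L' k) := IsSimpleModule.nontrivial (Hhat K (μ.1 k) q) _
  constructor
  · rintro ⟨e, he⟩ k
    have := Hhat.finite_of_isSimpleModule (K := K) (μ.1 k) q (M := L k)
    refine nonempty_equiv_of_annihilator K fun a => ?_
    have h1 : (∀ x : L k, a • x = 0) ↔ (Algebra.lsmul K K (L k) a : Module.End K (L k)) = 0 :=
      ⟨fun h => LinearMap.ext h, fun h => LinearMap.congr_fun h⟩
    have h2 : (∀ x : L' k, a • x = 0) ↔ (Algebra.lsmul K K (L' k) a : Module.End K (L' k)) = 0 :=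
      ⟨fun h => LinearMap.ext h, fun h => LinearMap.congr_fun h⟩
    rw [h1, h2, ← tensor_φ_eq_zero_iff
        (ψ := fun k => (Algebra.lsmul K K (L k) : Hhat K (μ.1 k) q →ₐ[K] _)),
      ← tensor_φ_eq_zero_iff
        (ψ := fun k => (Algebra.lsmul K K (L' k) : Hhat K (μ.1 k) q →ₐ[K] _))]
    constructor
    · intro h
      refine LinearMap.ext fun x => ?_
      obtain ⟨x, rfl⟩ := e.surjective x
      rw [← he, h, LinearMap.zero_apply, LinearMap.zero_apply, map_zero]
    · intro h
      refine LinearMap.ext fun x => e.injective ?_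
      rw [he, h, LinearMap.zero_apply, LinearMap.zero_apply, map_zero]
  · intro h
    exact iso_tensor (fun k => (h k).some.restrictScalars K) fun k a x => (h k).some.map_smul a x

end Lsmul

end HeckeFamily

/-! ### Simple modules of the cyclic group -/

section Cyclic

variable {K : Type u} [Field K] {r : ℕ}

theorem KG.gen_pow : KG.gen K r ^ r = 1 := by
  rw [KG.gen, ← map_pow, ← ofAdd_nsmul, nsmul_one, ZMod.natCast_self]
  exact map_one _

theorem KG.induction [NeZero r] {P : KG K r → Prop} (h1 : P 1)
    (hgen : ∀ a, P a → P (KG.gen K r * a)) (hadd : ∀ a b, P a → P b → P (a + b))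
    (hsmul : ∀ (c : K) a, P a → P (c • a)) (a : KG K r) : P a := by
  have hpow (m : ℕ) : P (KG.gen K r ^ m) := by
    induction m with
    | zero => simpa using h1
    | succ m ih => rw [pow_succ']; exact hgen _ ih
  induction a using MonoidAlgebra.induction_on with
  | of g =>
    have : MonoidAlgebra.of K (Multiplicative (ZMod r)) g =
        KG.gen K r ^ (Multiplicative.toAdd g).val := by
      rw [KG.gen, ← map_pow, ← ofAdd_nsmul]
      simp
    rw [this]
    exact hpow _
  | add a b ha hb => exact hadd a b ha hb
  | smul c a ha => exact hsmul c a ha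

variable [IsAlgClosed K] [NeZero r]

theorem KG.finrank_eq_one {V : Type*} [AddCommGroup V] [Module K V] [Module (KG K r) V]
    [IsScalarTower K (KG K r) V] (hV : IsSimpleModule (KG K r) V) : Module.finrank K V = 1 := by
  have : Module.Finite (KG K r) V := inferInstance
  have : Module.Finite K (KG K r) := inferInstance
  have : Module.Finite K V := Module.Finite.trans (KG K r) V
  exact IsSimpleModule.finrank_eq_one_of_isMulCommutative (KG K r) V K

theorem KG.exists_gen_smul {V : Type*} [AddCommGroup V] [Module K V] [Module (KG K r) V]
    [IsScalarTower K (KG K r) V] (hV : IsSimpleModule (KG K r) V) :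
    ∃ z : K, z ^ r = 1 ∧ ∀ x : V, KG.gen K r • x = z • x := by
  have hf := KG.finrank_eq_one hV
  obtain ⟨v, hv, h⟩ := finrank_eq_one_iff'.1 hf
  obtain ⟨z, hz⟩ := h (KG.gen K r • v)
  have hz' (x : V) : KG.gen K r • x = z • x := by
    obtain ⟨c, rfl⟩ := h x
    rw [smul_algebra_smul_comm, ← hz, smul_comm]
  refine ⟨z, ?_, hz'⟩
  have hp (m : ℕ) : KG.gen K r ^ m • v = z ^ m • v := by
    induction m with
    | zero => simp
    | succ m ih => rw [pow_succ', mul_smul, ih, hz', smul_smul, ← pow_succ']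
  have := hp r
  rw [KG.gen_pow, one_smul] at this
  exact (smul_left_injective K hv (by simpa using this)).symm

theorem KG.nonempty_equiv {V V' : Type*} [AddCommGroup V] [Module K V] [Module (KG K r) V]
    [IsScalarTower K (KG K r) V] [AddCommGroup V'] [Module K V'] [Module (KG K r) V']
    [IsScalarTower K (KG K r) V'] (hV : IsSimpleModule (KG K r) V)
    (hV' : IsSimpleModule (KG K r) V') {z : K} (hz : ∀ x : V, KG.gen K r • x = z • x)
    (hz' : ∀ x : V', KG.gen K r • x = z • x) : Nonempty (V ≃ₗ[KG K r] V') := by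
  have hf := KG.finrank_eq_one hV
  have : FiniteDimensional K V := FiniteDimensional.of_finrank_pos (by omega)
  have hf' := KG.finrank_eq_one hV'
  have : FiniteDimensional K V' := FiniteDimensional.of_finrank_pos (by omega)
  let e : V ≃ₗ[K] V' := LinearEquiv.ofFinrankEq V V' (hf.trans hf'.symm)
  refine ⟨{ e with map_smul' := fun a x => ?_ }⟩
  change e (a • x) = a • e x
  induction a using KG.induction generalizing x with
  | h1 => simp
  | hgen a ha => rw [mul_smul, mul_smul, hz, hz', map_smul, ha]
  | hadd a b ha hb => rw [add_smul, add_smul, map_add, ha, hb]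
  | hsmul c a ha => rw [smul_assoc, smul_assoc, map_smul, ha]

end Cyclic

/-! ### The inducing modules -/

section Inducing

variable {K : Type u} [Field K] (q : Kˣ) {r n : ℕ} (μ : RComp r n)
  (V : Fin r → Type v) [∀ k, AddCommGroup (V k)] [∀ k, Module K (V k)]
  (L : Fin r → Type w) [∀ k, AddCommGroup (L k)] [∀ k, Module K (L k)]
  [∀ k, Module (Hhat K (μ.1 k) q) (L k)] [∀ k, IsScalarTower K (Hhat K (μ.1 k) q) (L k)]

/-- The actions of the affine Hecke algebras on the inducing module. -/
def vlFamily : HeckeFamily q μ (VL K μ V L) :=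
  HeckeFamily.tensor fun k => (Module.End.lTensorAlgHom K (L k) (⨂[K] _p : Fin (μ.1 k), V k)).comp
    (Algebra.lsmul K K (L k))

theorem genAct_eq_parGen [∀ k, Module (KG K r) (V k)] [∀ k, IsScalarTower K (KG K r) (V k)]
    {Z : UnitRoots K r} (hZ : ∀ k (x : V k), KG.gen K r • x = Z.z k • x) :
    genAct K q μ V L = (vlFamily q μ V L).parGen Z := by
  funext y
  cases y with
  | t k p =>
    have h : (Algebra.lsmul K K (V k) (KG.gen K r) : Module.End K (V k)) = Z.z k • 1 :=
      LinearMap.ext (hZ k)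
    have h2 : onFactor (M := fun _ : Fin (μ.1 k) => V k) K p (Z.z k • 1) = Z.z k • 1 := by
      have := map_smul (onFactorHom K (fun _ : Fin (μ.1 k) => V k) p) (Z.z k) 1
      rwa [map_one] at this
    have h3 : TensorProduct.map (Z.z k • 1 : Module.End K (⨂[K] _p : Fin (μ.1 k), V k))
        (LinearMap.id : L k →ₗ[K] L k) = Z.z k • 1 := by
      rw [TensorProduct.map_smul_left]
      exact congrArg _ TensorProduct.map_id
    have h4 := map_smul (onFactorHom K
      (fun k : Fin r => (⨂[K] _p : Fin (μ.1 k), V k) ⊗[K] L k) k) (Z.z k) 1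
    rw [map_one] at h4
    rw [genAct, h, h2, h3]
    exact h4
  | g k p => exact (HeckeFamily.T_fin (vlFamily q μ V L) k p).symm
  | X k p => exact (HeckeFamily.Y_fin (vlFamily q μ V L) k p).symm
  | Xinv k p => exact (HeckeFamily.Yinv_fin (vlFamily q μ V L) k p).symm

/-- As the `V_k` are one-dimensional, they do not affect the actions of the Hecke algebras. -/
theorem iso_vlFamily (hV : ∀ k, Module.finrank K (V k) = 1) :
    HeckeFamily.Iso (HeckeFamily.tensor fun k =>
      (Algebra.lsmul K K (L k) : Hhat K (μ.1 k) q →ₐ[K] _)) (vlFamily q μ V L) := by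
  have hd (k : Fin r) : Nonempty ((⨂[K] _p : Fin (μ.1 k), V k) ≃ₗ[K] K) := by
    have : FiniteDimensional K (V k) := FiniteDimensional.of_finrank_pos (by rw [hV]; exact one_pos)
    exact ⟨(PiTensorProduct.congr fun _ => LinearEquiv.ofFinrankEq (V k) K
      ((hV k).trans (Module.finrank_self K).symm)).trans
      (PiTensorProduct.constantBaseRingEquiv (Fin (μ.1 k)) K).toLinearEquiv⟩
  obtain ⟨d⟩ := Classical.nonempty_pi.2 hd
  let e (k : Fin r) : (⨂[K] _p : Fin (μ.1 k), V k) ⊗[K] L k ≃ₗ[K] L k :=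
    (TensorProduct.congr (d k) (LinearEquiv.refl K (L k))).trans (TensorProduct.lid K (L k))
  refine HeckeFamily.Iso.symm (HeckeFamily.iso_tensor e fun k a x => ?_)
  induction x using TensorProduct.induction_on with
  | zero => simp
  | tmul y x =>
    change d k y • (a • x) = a • (d k y • x)
    exact (smul_algebra_smul_comm _ _ _).symm
  | add x y hx hy => rw [map_add, map_add, map_add, map_add, hx, hy]

theorem isVLAction_iff [∀ k, Module (KG K r) (V k)] [∀ k, IsScalarTower K (KG K r) (V k)]
    {Z : UnitRoots K r} (hZ : ∀ k (x : V k), KG.gen K r • x = Z.z k • x)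
    {ρ : Ypar K q μ →ₐ[K] Module.End K (VL K μ V L)} :
    IsVLAction K q μ V L ρ ↔ HeckeFamily.IsParAct Z (vlFamily q μ V L) ρ := by
  rw [IsVLAction, genAct_eq_parGen q μ V L hZ, HeckeFamily.IsParAct]

variable [IsAlgClosed K]

theorem irred_vlFamily (hV : ∀ k, Module.finrank K (V k) = 1)
    (hL : ∀ k, IsSimpleModule (Hhat K (μ.1 k) q) (L k)) : (vlFamily q μ V L).Irred := by
  have hnt (k) : Nontrivial (L k) := IsSimpleModule.nontrivial (Hhat K (μ.1 k) q) (L k)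
  have hfin (k) : Module.Finite K (L k) := Hhat.finite_of_isSimpleModule (μ.1 k) q
  exact (iso_vlFamily q μ V L hV).irred (HeckeFamily.irred_tensor fun k => lsmul_surjective K (L k))

theorem iso_vlFamily_iff (L' : Fin r → Type w) [∀ k, AddCommGroup (L' k)] [∀ k, Module K (L' k)]
    [∀ k, Module (Hhat K (μ.1 k) q) (L' k)] [∀ k, IsScalarTower K (Hhat K (μ.1 k) q) (L' k)]
    (hV : ∀ k, Module.finrank K (V k) = 1) (hL : ∀ k, IsSimpleModule (Hhat K (μ.1 k) q) (L k))
    (hL' : ∀ k, IsSimpleModule (Hhat K (μ.1 k) q) (L' k)) :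
    HeckeFamily.Iso (vlFamily q μ V L) (vlFamily q μ V L') ↔
      ∀ k, Nonempty (L k ≃ₗ[Hhat K (μ.1 k) q] L' k) := by
  rw [← HeckeFamily.iso_tensor_lsmul_iff hL hL']
  have h1 := iso_vlFamily q μ V L hV
  have h2 := iso_vlFamily q μ V L' hV
  exact ⟨fun h => (h1.trans h).trans h2.symm, fun h => (h1.symm.trans h).trans h2⟩

end Inducing

end AffineYokonuma

end

theorem theorem4p1 (K : Type u) [Field K] [IsAlgClosed K]
    (r n : ℕ) (hr : (r : K) ≠ 0) (hn : 1 ≤ n) (q : Kˣ)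
    (V : Fin r → Type v) [∀ k, AddCommGroup (V k)] [∀ k, Module K (V k)]
    [∀ k, Module (KG K r) (V k)] [∀ k, IsScalarTower K (KG K r) (V k)]
    (hVsimple : ∀ k, IsSimpleModule (KG K r) (V k))
    (hVdistinct : ∀ k l, Nonempty (V k ≃ₗ[KG K r] V l) → k = l) :
    -- the inducing modules exist (with unique structure) and the induced modules are simple
    (∀ (μ : RComp r n)
      (L : Fin r → Type w) [∀ k, AddCommGroup (L k)] [∀ k, Module K (L k)]
      [∀ k, Module (Hhat K (μ.1 k) q) (L k)] [∀ k, IsScalarTower K (Hhat K (μ.1 k) q) (L k)],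
      (∀ k, IsSimpleModule (Hhat K (μ.1 k) q) (L k)) →
      (∃! ρ : Ypar K q μ →ₐ[K] Module.End K (VL K μ V L), IsVLAction K q μ V L ρ) ∧
      ∀ ρ : Ypar K q μ →ₐ[K] Module.End K (VL K μ V L), IsVLAction K q μ V L ρ →
        IsSimpleModule (Yhat K r n q) (S K q μ V L ρ)) ∧
    -- every simple module is of this form
    (∀ (M : Type x) [AddCommGroup M] [Module (Yhat K r n q) M],
      IsSimpleModule (Yhat K r n q) M →
      ∃ (μ : RComp r n) (L : Fin r → Type u) (_ : ∀ k, AddCommGroup (L k))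
        (_ : ∀ k, Module K (L k)) (_ : ∀ k, Module (Hhat K (μ.1 k) q) (L k))
        (_ : ∀ k, IsScalarTower K (Hhat K (μ.1 k) q) (L k))
        (ρ : Ypar K q μ →ₐ[K] Module.End K (VL K μ V L)),
        (∀ k, IsSimpleModule (Hhat K (μ.1 k) q) (L k)) ∧ IsVLAction K q μ V L ρ ∧
        Nonempty (M ≃ₗ[Yhat K r n q] S K q μ V L ρ)) ∧
    -- different compositions give non-isomorphic modules
    (∀ (μ ν : RComp r n)
      (L : Fin r → Type w) [∀ k, AddCommGroup (L k)] [∀ k, Module K (L k)]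
      [∀ k, Module (Hhat K (μ.1 k) q) (L k)] [∀ k, IsScalarTower K (Hhat K (μ.1 k) q) (L k)]
      (L' : Fin r → Type w) [∀ k, AddCommGroup (L' k)] [∀ k, Module K (L' k)]
      [∀ k, Module (Hhat K (ν.1 k) q) (L' k)] [∀ k, IsScalarTower K (Hhat K (ν.1 k) q) (L' k)]
      (ρ : Ypar K q μ →ₐ[K] Module.End K (VL K μ V L))
      (ρ' : Ypar K q ν →ₐ[K] Module.End K (VL K ν V L')),
      (∀ k, IsSimpleModule (Hhat K (μ.1 k) q) (L k)) →
      (∀ k, IsSimpleModule (Hhat K (ν.1 k) q) (L' k)) →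
      IsVLAction K q μ V L ρ → IsVLAction K q ν V L' ρ' →
      Nonempty (S K q μ V L ρ ≃ₗ[Yhat K r n q] S K q ν V L' ρ') → μ = ν) ∧
    -- for one composition, the induced modules are isomorphic only if the given ones are
    (∀ (μ : RComp r n)
      (L : Fin r → Type w) [∀ k, AddCommGroup (L k)] [∀ k, Module K (L k)]
      [∀ k, Module (Hhat K (μ.1 k) q) (L k)] [∀ k, IsScalarTower K (Hhat K (μ.1 k) q) (L k)]
      (L' : Fin r → Type w) [∀ k, AddCommGroup (L' k)] [∀ k, Module K (L' k)]
      [∀ k, Module (Hhat K (μ.1 k) q) (L' k)] [∀ k, IsScalarTower K (Hhat K (μ.1 k) q) (L' k)]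
      (ρ : Ypar K q μ →ₐ[K] Module.End K (VL K μ V L))
      (ρ' : Ypar K q μ →ₐ[K] Module.End K (VL K μ V L')),
      (∀ k, IsSimpleModule (Hhat K (μ.1 k) q) (L k)) →
      (∀ k, IsSimpleModule (Hhat K (μ.1 k) q) (L' k)) →
      IsVLAction K q μ V L ρ → IsVLAction K q μ V L' ρ' →
      (Nonempty (S K q μ V L ρ ≃ₗ[Yhat K r n q] S K q μ V L' ρ') ↔
        ∀ k, Nonempty (L k ≃ₗ[Hhat K (μ.1 k) q] L' k))) := by
  have : NeZero r := ⟨fun h => hr (by rw [h, Nat.cast_zero])⟩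
  have hVf (k) := KG.finrank_eq_one (hVsimple k)
  choose z hzr hz using fun k => KG.exists_gen_smul (hVsimple k)
  let Z : UnitRoots K r :=
    { z := z
      pow := hzr
      inj := fun k l h => hVdistinct k l (KG.nonempty_equiv (hVsimple k) (hVsimple l) (hz k)
        fun x => by rw [h, hz])
      ne := hr }
  have hZ : ∀ k (x : V k), KG.gen K r • x = Z.z k • x := hz
  refine ⟨?_, ?_, ?_, ?_⟩
  · intro μ L _ _ _ _ hL
    refine ⟨⟨(vlFamily q μ V L).parAct Z hn, ?_, fun ρ hρ => ?_⟩, fun ρ hρ => ?_⟩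
    · exact (isVLAction_iff q μ V L hZ).2 (HeckeFamily.isParAct_parAct hn)
    · exact ((isVLAction_iff q μ V L hZ).1 hρ).unique (HeckeFamily.isParAct_parAct hn)
    · have := HeckeFamily.isSimpleModule_fMod (Z := Z) (hn := hn) (irred_vlFamily q μ V L hVf hL)
      exact IsSimpleModule.congr (HeckeFamily.indEquiv ((isVLAction_iff q μ V L hZ).1 hρ) hn)
  · intro M _ _ hM
    letI : Module K M := Module.compHom M (algebraMap K (Yhat K r n q))
    have : IsScalarTower K (Yhat K r n q) M := ⟨fun c a x => by
      rw [Algebra.smul_def, mul_smul]; rfl⟩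
    have : Module.Finite K M := Yhat.finite_of_surjective (K := K) (q := q) (NeZero.ne r) hn
      (AlgHom.id K (Yhat K r n q)) Function.surjective_id
    obtain ⟨μ, hirr, ⟨E⟩⟩ := HeckeFamily.exists_equiv_fMod (q := q) (M := M) hn Z
    obtain ⟨I, hI, hiso⟩ := hirr.exists_iso_tensor
    let L (k : Fin r) : Type u := Hhat K (μ.1 k) q ⧸ I k
    let ρ := (vlFamily q μ V L).parAct Z hn
    have hρ : HeckeFamily.IsParAct Z (vlFamily q μ V L) ρ := HeckeFamily.isParAct_parAct hn
    obtain ⟨F⟩ := (((iso_vlFamily q μ V L hVf).symm.trans hiso).fMod (Z := Z) (hn := hn))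
    exact ⟨μ, L, inferInstance, inferInstance, inferInstance, inferInstance, ρ,
      fun k => isSimpleModule_iff_isCoatom.2 (hI k), (isVLAction_iff q μ V L hZ).2 hρ,
      ⟨(((HeckeFamily.indEquiv hρ hn).trans F).trans E).symm⟩⟩
  · rintro μ ν L _ _ _ _ L' _ _ _ _ ρ ρ' hL hL' hρ hρ' ⟨E⟩
    have := (irred_vlFamily q μ V L hVf hL).1
    exact HeckeFamily.content_eq_of_equiv
      (((HeckeFamily.indEquiv ((isVLAction_iff q μ V L hZ).1 hρ) hn).symm.trans E).trans
        (HeckeFamily.indEquiv ((isVLAction_iff q ν V L' hZ).1 hρ') hn))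
  · intro μ L _ _ _ _ L' _ _ _ _ ρ ρ' hL hL' hρ hρ'
    let e := HeckeFamily.indEquiv ((isVLAction_iff q μ V L hZ).1 hρ) hn
    let e' := HeckeFamily.indEquiv ((isVLAction_iff q μ V L' hZ).1 hρ') hn
    rw [← iso_vlFamily_iff q μ V L L' hVf hL hL']
    constructor
    · rintro ⟨E⟩
      exact HeckeFamily.Iso.of_fMod ((e.symm.trans E).trans e')
    · intro h
      obtain ⟨F⟩ := h.fMod (Z := Z) (hn := hn)
      exact ⟨(e.trans F).trans e'.symm⟩
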